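/- Computational model. A randomized query algorithm is one fixed program (the same for all $n$) over finitely many integer registers, with integer arithmetic, comparisons, and loops, in which an instruction handling $m$ bits in total costs time polynomial in $m$ (here $(m+1)^2$). It may toss fair coins (each toss is paid for), and, for natural numbers $p',t$ and rational $\lambda=a/b\ge 0$ of its choice, it may draw an exact sample, in time polynomial in $p't$, $t$ and the bit lengths of $a,b$, from the truncated discretized exponential distribution $\mathcal D_{K,\delta,\lambda}$ on $\{k\delta: 0\le k\le K\}$, $\Pr(k\delta)=e^{-\lambda k\delta}-e^{-\lambda(k+1)\delta}$ for $k<K$ and $\Pr(K\delta)=e^{-\lambda K\delta}$, with $\delta=2^{-200p't}$ and $K=2t/\delta$. A real number is a $p$-bit number if it equals $N_1/N_2$ with integers $|N_1|\le 2^p$, $0<N_2\le 2^p$. Query access to a matrix $H$ and a vector $\varphi$ with $p$-bit numbers means that one can query (1) the entry $\langle x|H|y\rangle$ for given $x,y$, as a $p$-bit fraction; (2) the position of the $j$-th nonzero entry of a given row or of a given column, in an arbitrary fixed order; (3) the amplitude $\langle x|\varphi\rangle$ for given $x$, as a $p$-bit fraction, or the information that it is not a $p$-bit number. Theorem. Let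 $d,b,p,g$ be polynomials with natural number coefficients. There are a randomized query algorithm $\mathcal A$ and polynomials $T,Q$ such that the following holds for every $n\ge 0$, every real symmetric $2^n\times 2^n$ matrix $H$ all of whose rows and columns have at most $d(n)$ nonzero entries, with spectral norm $\|H\|\le b(n)$ and with $p(n)$-bit entries, every vector $\varphi\in\mathbb R^{2^n}$, and all correct query access to $(H,\varphi)$ with $p(n)$-bit numbers. Let $\lambda(H)$ be the smallest eigenvalue of $H$. (i) On every $x\in\{0,1\}^n$ and for all outcomes of the random choices, $\mathcal A(x)$ runs in time at most $T(n)$ and makes at most $Q(n)$ queries. (ii) If $\varphi$ is a (nonzero, not necessarily normalized) ground state of $H$, i.e. $\varphi\neq0$ and $H\varphi=\lambda(H)\varphi$, with $\langle\varphi|H|\varphi\rangle=0$, and all amplitudes of $\varphi$ are $p(n)$-bit numbers, then there is an $x\in\{0,1\}^n$ such that $\mathcal A(x)$ accepts with probability at least $1/2$. (iii) If $g(n)>0$ and $\lambda(H)\ge 1/g(n)$ ($\varphi$ being arbitrary), then for every $x\in\{0,1\}^n$, $\mathcal A(x)$ accepts with probability at most $2^{-n}$. -/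

import Mathlib

open scoped NNReal ENNReal Matrix

noncomputable section

/-! ## Linear algebra: sparsity, ground energy, ground states -/

/-- Every row and every column of `H` has at most `d` nonzero entries. -/
def IsSparse {ι : Type} (d : ℕ) (H : Matrix ι ι ℝ) : Prop :=
  (∀ x, {y | H x y ≠ 0}.ncard ≤ d) ∧ (∀ y, {x | H x y ≠ 0}.ncard ≤ d)

/-- The spectral norm `max_{v ≠ 0} ‖H v‖₂ / ‖v‖₂`. -/
def spectralNorm2 {ι : Type} [Fintype ι] [DecidableEq ι] (H : Matrix ι ι ℝ) : ℝ :=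
  ‖Matrix.toEuclideanCLM (n := ι) (𝕜 := ℝ) H‖

/-- The ground energy: the smallest eigenvalue (of a real symmetric matrix). -/
def groundEnergy {ι : Type} [Fintype ι] [DecidableEq ι] (H : Matrix ι ι ℝ) : ℝ :=
  sInf {μ : ℝ | Module.End.HasEigenvalue (Matrix.toLin' H) μ}

/-- A (not necessarily normalized) ground state: an eigenvector for the ground energy. -/
def IsGroundState {ι : Type} [Fintype ι] [DecidableEq ι] (H : Matrix ι ι ℝ) (φ : ι → ℝ) : Prop :=
  φ ≠ 0 ∧ H *ᵥ φ = groundEnergy H • φ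

/-! ## Numbers with `p` bits and query access -/

/-- `f = (N₁, N₂)` is a fraction with value `r` whose numerator and denominator have `p` bits. -/
def IsFraction (p : ℕ) (f : ℤ × ℤ) (r : ℝ) : Prop :=
  |f.1| ≤ 2 ^ p ∧ 0 < f.2 ∧ f.2 ≤ 2 ^ p ∧ r = (f.1 : ℝ) / (f.2 : ℝ)

/-- The real number `r` can be represented by `p` bits. -/
def IsRepresentable (p : ℕ) (r : ℝ) : Prop := ∃ f : ℤ × ℤ, IsFraction p f r

/-- The answers to all possible queries; `{0,1}ⁿ` is identified with `{0, …, 2ⁿ - 1}`. -/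
structure Oracle (n : ℕ) where
  /-- the entry of the matrix in a given row and column, as a fraction -/
  entry : Fin (2 ^ n) → Fin (2 ^ n) → ℤ × ℤ
  /-- the column indices of the nonzero entries of a given row -/
  row : Fin (2 ^ n) → List (Fin (2 ^ n))
  /-- the row indices of the nonzero entries of a given column -/
  col : Fin (2 ^ n) → List (Fin (2 ^ n))
  /-- the amplitude of the vector at a given index, as a fraction; `none` if the amplitude
  is not a number with the agreed number of bits -/
  amp : Fin (2 ^ n) → Option (ℤ × ℤ)

/-- `O` gives query access to `(H, φ)` with `p`-bit numbers. This forces the entries of `H`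
to be `p`-bit numbers; `φ` is arbitrary, but an amplitude is only revealed if it is a `p`-bit
number. Fractions need not be reduced, and the lists may come in any order. -/
structure Oracle.Answers {n : ℕ} (O : Oracle n) (p : ℕ)
    (H : Matrix (Fin (2 ^ n)) (Fin (2 ^ n)) ℝ) (φ : Fin (2 ^ n) → ℝ) : Prop where
  entry_spec : ∀ x y, IsFraction p (O.entry x y) (H x y)
  row_nodup : ∀ x, (O.row x).Nodup
  mem_row : ∀ x y, y ∈ O.row x ↔ H x y ≠ 0
  col_nodup : ∀ y, (O.col y).Nodup
  mem_col : ∀ y x, x ∈ O.col y ↔ H x y ≠ 0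
  amp_some : ∀ x f, O.amp x = some f → IsFraction p f (φ x)
  amp_none : ∀ x, O.amp x = none → ¬ IsRepresentable p (φ x)

/-! ## The two cases of the promise -/

/-- `⟨φ|H|φ⟩ = 0`, where `φ` is a ground state of `H` (with `p`-bit amplitudes). -/
def YesInstance {n : ℕ} (p : ℕ) (H : Matrix (Fin (2 ^ n)) (Fin (2 ^ n)) ℝ)
    (φ : Fin (2 ^ n) → ℝ) : Prop :=
  IsGroundState H φ ∧ φ ⬝ᵥ (H *ᵥ φ) = 0 ∧ ∀ x, IsRepresentable p (φ x)

/-- The ground energy of `H` is at least `1 / g` (for a positive integer `g`). -/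
def NoInstance {n : ℕ} (g : ℕ) (H : Matrix (Fin (2 ^ n)) (Fin (2 ^ n)) ℝ) : Prop :=
  0 < g ∧ 1 / (g : ℝ) ≤ groundEnergy H

/-! ## The truncated discretized exponential distribution -/

/-- The probability of the value `k δ`, for `0 ≤ k ≤ K`. -/
def truncExpProb (K : ℕ) (δ l : ℝ) (k : ℕ) : ℝ :=
  if k < K then Real.exp (-l * k * δ) - Real.exp (-l * (k + 1) * δ) else Real.exp (-l * K * δ)

theorem truncExpProb_nonneg (K : ℕ) (δ l : ℝ≥0) (k : ℕ) : 0 ≤ truncExpProb K δ l k := by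
  unfold truncExpProb
  split_ifs with h
  · have h1 : (0 : ℝ) ≤ l * δ := by positivity
    have : -(l : ℝ) * (k + 1) * δ ≤ -l * k * δ := by nlinarith
    have := Real.exp_le_exp.2 this
    linarith
  · positivity

theorem truncExpProb_sum (K : ℕ) (δ l : ℝ) :
    ∑ k ∈ Finset.range (K + 1), truncExpProb K δ l k = 1 := by
  rw [Finset.sum_range_succ]
  have h : ∀ k ∈ Finset.range K, truncExpProb K δ l k =
      Real.exp (-l * (k : ℕ) * δ) - Real.exp (-l * ((k + 1 : ℕ) : ℝ) * δ) := by
    intro k hk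
    simp [truncExpProb, Finset.mem_range.1 hk]
  rw [Finset.sum_congr rfl h,
    Finset.sum_range_sub' (fun k : ℕ => Real.exp (-l * (k : ℝ) * δ)) K]
  simp [truncExpProb]

/-- The truncated discretized exponential distribution `D_{K,δ,l}` on `{k δ : 0 ≤ k ≤ K}`,
as the law of the integer `k`. -/
def truncExp (K : ℕ) (δ l : ℝ≥0) : PMF (Fin (K + 1)) :=
  PMF.ofFintype (fun k => ENNReal.ofReal (truncExpProb K δ l k)) (by
    rw [← ENNReal.ofReal_sum_of_nonneg
        (fun (k : Fin (K + 1)) _ => truncExpProb_nonneg K δ l (k : ℕ)),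
      Fin.sum_univ_eq_sum_range (fun k => truncExpProb K δ l k), truncExpProb_sum]
    simp)

/-! ## Randomized query algorithms

Programs over finitely many integer registers, with logarithmic cost: an instruction that reads
and writes numbers with `m` bits altogether takes time `(m + 1)²`. A program is a fixed finite
object that works for all `n`. Loops are bounded by the value of a register, so that every program
terminates; the number of iterations is paid for in the running time. -/

/-- Programs. Registers are named by natural numbers, and `dst`, `num`, `den` are the registers in
which results are stored. -/
inductive Program : Type
  /-- do nothing -/
  | skip
  /-- load an integer constant -/
  | const (dst : ℕ) (c : ℤ)
  | add (dst a b : ℕ)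
  | sub (dst a b : ℕ)
  | mul (dst a b : ℕ)
  /-- integer division -/
  | div (dst a b : ℕ)
  | seq (P Q : Program)
  /-- if the value of register `a` is at most that of register `b`, then `P`, else `Q` -/
  | ifLe (a b : ℕ) (P Q : Program)
  /-- repeat `P` as many times as the value of register `a` on entry to the loop -/
  | loop (a : ℕ) (P : Program)
  /-- query: the matrix entry in the row and the column given by registers `x`, `y` -/
  | entry (num den x y : ℕ)
  /-- query: the column index of the `j`-th nonzero entry of row `x` (`-1` if there is none) -/
  | row (dst x j : ℕ)
  /-- query: the row index of the `j`-th nonzero entry of column `y` (`-1` if there is none) -/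
  | col (dst y j : ℕ)
  /-- query: the amplitude at `x`; the denominator `0` says that it is not representable -/
  | amp (num den x : ℕ)
  /-- toss as many fair coins as register `k` says, and read them as an integer in binary -/
  | coins (dst k : ℕ)
  /-- a sample of the truncated discretized exponential distribution `D_{K,δ,l}` with
  `δ = 2 ^ (-200 p t)`, `K = 2 t / δ` and `l = num / den`, as a multiple of `δ` -/
  | exponential (dst p t num den : ℕ)

/-- The contents of the registers, the time used, and the number of queries made so far. -/
structure Config : Type where
  store : ℕ → ℤ
  time : ℕ
  queries : ℕ

/-- The number of bits of an integer. -/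
def bits (z : ℤ) : ℕ := z.natAbs.size

namespace Config

/-- Write `v` into the register `r`. -/
def set (c : Config) (r : ℕ) (v : ℤ) : Config := { c with store := Function.update c.store r v }

/-- Pay for an instruction that handles `m` bits. -/
def pay (c : Config) (m : ℕ) : Config := { c with time := c.time + (m + 1) ^ 2 }

/-- Count one query. -/
def countQuery (c : Config) : Config := { c with queries := c.queries + 1 }

/-- The result of an arithmetic instruction. -/
def arith (c : Config) (dst a b : ℕ) (op : ℤ → ℤ → ℤ) : Config :=
  (c.pay (bits (c.store a) + bits (c.store b) +
    bits (op (c.store a) (c.store b)))).set dst (op (c.store a) (c.store b))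

/-- At the beginning, register `0` holds `n`, register `1` holds the input `x`, and all other
registers hold `0`. -/
def start (n : ℕ) (x : Fin (2 ^ n)) : Config where
  store := fun r => if r = 0 then (n : ℤ) else if r = 1 then ((x : ℕ) : ℤ) else 0
  time := 0
  queries := 0

/-- The algorithm accepts if register `2` holds `1` at the end. -/
def Accepts (c : Config) : Prop := c.store 2 = 1

end Config

/-- The index that an integer stands for, if it is in the range. -/
def toIndex (n : ℕ) (z : ℤ) : Option (Fin (2 ^ n)) :=
  if h : 0 ≤ z ∧ z.toNat < 2 ^ n then some ⟨z.toNat, h.2⟩ else none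

namespace Oracle

variable {n : ℕ}

/-- The answer to an entry query; `(0, 0)` for illegal indices. -/
def entryAt (O : Oracle n) (x y : ℤ) : ℤ × ℤ :=
  match toIndex n x, toIndex n y with
  | some i, some k => O.entry i k
  | _, _ => (0, 0)

/-- The `j`-th member of a list of indices, or `-1`. -/
def nth (l : List (Fin (2 ^ n))) (j : ℤ) : ℤ :=
  if 0 ≤ j then
    match l[j.toNat]? with
    | some i => ((i : ℕ) : ℤ)
    | none => -1
  else -1

/-- The answer to a row query; `-1` for an illegal index. -/
def rowAt (O : Oracle n) (x j : ℤ) : ℤ :=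
  match toIndex n x with
  | some i => nth (O.row i) j
  | none => -1

/-- The answer to a column query; `-1` for an illegal index. -/
def colAt (O : Oracle n) (y j : ℤ) : ℤ :=
  match toIndex n y with
  | some i => nth (O.col i) j
  | none => -1

/-- The answer to an amplitude query; `(0, 0)` for an illegal index, and if the amplitude is not
representable. -/
def ampAt (O : Oracle n) (x : ℤ) : ℤ × ℤ :=
  match toIndex n x with
  | some i => (O.amp i).getD (0, 0)
  | none => (0, 0)

end Oracle

namespace Program

variable {n : ℕ}

/-- The distribution of the configuration after running a program. -/
def run (O : Oracle n) : Program → Config → PMF Config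
  | skip, c => PMF.pure (c.pay 0)
  | const dst v, c => PMF.pure ((c.pay (bits v)).set dst v)
  | add dst a b, c => PMF.pure (c.arith dst a b (fun u v => u + v))
  | sub dst a b, c => PMF.pure (c.arith dst a b (fun u v => u - v))
  | mul dst a b, c => PMF.pure (c.arith dst a b (fun u v => u * v))
  | div dst a b, c => PMF.pure (c.arith dst a b (fun u v => u / v))
  | seq P Q, c => (run O P c).bind (run O Q)
  | ifLe a b P Q, c =>
      if c.store a ≤ c.store b then run O P (c.pay (bits (c.store a) + bits (c.store b)))
      else run O Q (c.pay (bits (c.store a) + bits (c.store b)))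
  | loop a P, c =>
      (fun μ : PMF Config => μ.bind fun c' => run O P (c'.pay (bits (c.store a))))^[
        (c.store a).toNat] (PMF.pure (c.pay (bits (c.store a))))
  | entry num den x y, c =>
      let f := O.entryAt (c.store x) (c.store y)
      PMF.pure (((c.countQuery.pay (bits (c.store x) + bits (c.store y) +
        bits f.1 + bits f.2)).set num f.1).set den f.2)
  | row dst x j, c =>
      let v := O.rowAt (c.store x) (c.store j)
      PMF.pure ((c.countQuery.pay (bits (c.store x) + bits (c.store j) + bits v)).set dst v)
  | col dst y j, c =>
      let v := O.colAt (c.store y) (c.store j)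
      PMF.pure ((c.countQuery.pay (bits (c.store y) + bits (c.store j) + bits v)).set dst v)
  | amp num den x, c =>
      let f := O.ampAt (c.store x)
      PMF.pure (((c.countQuery.pay (bits (c.store x) + bits f.1 + bits f.2)).set num f.1).set
        den f.2)
  | coins dst k, c =>
      (PMF.uniformOfFintype (Fin (2 ^ (c.store k).toNat))).map fun u =>
        (c.pay (bits (c.store k) + (c.store k).toNat)).set dst ((u : ℕ) : ℤ)
  | exponential dst p t num den, c =>
      let e := 200 * (c.store p).toNat * (c.store t).toNat
      (truncExp (2 * (c.store t).toNat * 2 ^ e) ((2 ^ e)⁻¹)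
        (((c.store num).toNat : ℝ≥0) / ((c.store den).toNat : ℝ≥0))).map fun k =>
          (c.pay (bits (c.store p) + bits (c.store t) + bits (c.store num) +
            bits (c.store den) + (c.store t).toNat + e)).set dst ((k : ℕ) : ℤ)

/-- The probability that the algorithm accepts when it is started on `x`. -/
def acceptProb (A : Program) (O : Oracle n) (x : Fin (2 ^ n)) : ℝ≥0∞ :=
  (A.run O (Config.start n x)).toOuterMeasure {c | c.Accepts}

/-- Whatever the outcomes of the random choices are, the algorithm, started on `x`, takes time at
most `T` and makes at most `Q` queries. -/
def RunsWithin (A : Program) (O : Oracle n) (x : Fin (2 ^ n)) (T Q : ℕ) : Prop :=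
  ∀ c ∈ (A.run O (Config.start n x)).support, c.time ≤ T ∧ c.queries ≤ Q

end Program

end

noncomputable section

/-! ## Killed walks with deterministic holding times -/

section Walk

variable {ι : Type} [Fintype ι]

/-! Fix a number `s`, a power of `n + C`, that dominates all the given polynomials at `n`, and let
`ψ` be the vector of reported amplitudes, with value 0 where the oracle reports none. The algorithm
runs the fixed-node walk guided by `ψ`: from `x` it jumps to `y` at rate `max (-H x y ψ y / ψ x) 0`
and stays put at an extra rate 1. Waiting times are not sampled: a visit of `x` with total rate `W
x` gives the deterministic credit `R / W x`, where `R = s ^ 3`. Before each step it checks that `ψ x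
≠ 0` and that the local energy `(H ψ) x / ψ x` is at most a rounding error. It makes `s ^ 6` steps
and accepts if it has survived and the credit is at least `s ^ 6`, so that the elapsed time is at
least `s ^ 3`.

If the ground energy is at least `c = 1 / s`, then survival is unlikely for every `ψ`. Conjugation
by `|ψ|` turns the rates into a symmetric nonnegative matrix `B`. The entries of `H` that have the
wrong sign relative to `ψ` are moved to the diagonal by the AM-GM inequality, and the local check
bounds this diagonal by `W`; hence `B ≤ W - c` as quadratic forms on the good points
(`fixedNode_form_le`). Weighting each visit by `exp (c / W)` gives an exponential Markov bound
(`survive_le_tilt`). As `W - c ≤ W exp (-c / W)`, the weighted step operator does not increase a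
weighted ℓ² norm (`energy_le`). The survival probability is therefore about `exp (-s ^ 2)` up to
factors `2 ^ O(s)`.

If `H ψ = 0`, then the local energy vanishes and only rounding can kill the walk. The jump chain is
reversible with respect to `ψ x ^ 2 (1 + D x)`, where `D x` is the exact jump rate, and its mean
rate is at most `1 + s ^ 2`. A renewal estimate (`sum_mul_expect_below_le`) shows that `s ^ 6` steps
rarely earn too little credit on average over the start, so some start is accepted with probability
at least one half.

Rates are rounded to multiples of `1 / P` with `P = 2 ^ s ^ 2`, and one step consumes `s ^ 2` fair
coins. The program then simulates the rounded walk exactly (`Program.val_eq_survive`). Its resources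
are bounded by a small type system for register sizes (`Typing.Valid.within`). -/

open Classical in
/-- The probability that a killed walk with transition probabilities `p`, started at `x` with
credit `a`, makes `k` steps from good points and ends with credit at least `N`, where each
visit of `x` gives the credit `h x`. -/
def survive (good : ι → Prop) (p : ι → ι → ℝ) (h : ι → ℤ) (N : ℤ) : ℕ → ι → ℤ → ℝ
  | 0, _, a => if N ≤ a then 1 else 0
  | k + 1, x, a => if good x then ∑ y, p x y * survive good p h N k y (a + h x) else 0

open Classical in
/-- The expected product of the weights `e` along `k` steps of a killed walk. -/
def tilt (good : ι → Prop) (p : ι → ι → ℝ) (e : ι → ℝ) : ℕ → ι → ℝ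
  | 0, _ => 1
  | k + 1, x => if good x then e x * ∑ y, p x y * tilt good p e k y else 0

theorem tilt_nonneg {good : ι → Prop} {p : ι → ι → ℝ} {e : ι → ℝ} (hp : ∀ x y, 0 ≤ p x y)
    (he : ∀ x, 0 ≤ e x) (k : ℕ) (x : ι) : 0 ≤ tilt good p e k x := by
  induction k generalizing x with
  | zero => simp [tilt]
  | succ k ih =>
    rw [tilt]
    split_ifs
    · exact mul_nonneg (he x) (Finset.sum_nonneg fun y _ => mul_nonneg (hp x y) (ih y))
    · exact le_rfl

/-- Exponential Markov inequality: the indicator of `N ≤ a` is at most `exp (c (a - N))`, and the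
exponential of the final credit factors along the path. -/
theorem survive_le_tilt {good : ι → Prop} {p : ι → ι → ℝ} {e : ι → ℝ} {h : ι → ℤ} {N : ℤ} {c : ℝ}
    (hc : 0 ≤ c) (hp : ∀ x y, 0 ≤ p x y) (he : ∀ x, good x → Real.exp (c * h x) ≤ e x)
    (he0 : ∀ x, 0 ≤ e x) (k : ℕ) (x : ι) (a : ℤ) :
    survive good p h N k x a ≤ Real.exp (c * (a - N)) * tilt good p e k x := by
  induction k generalizing x a with
  | zero =>
    rw [survive, tilt]
    split_ifs with h
    · have : (N : ℝ) ≤ a := by exact_mod_cast h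
      rw [mul_one]
      exact Real.one_le_exp (mul_nonneg hc (by linarith))
    · positivity
  | succ k ih =>
    rw [survive, tilt]
    split_ifs with hx
    · have h1 : ∀ y, p x y * survive good p h N k y (a + h x) ≤
          p x y * (Real.exp (c * (a - N)) * e x * tilt good p e k y) := by
        intro y
        refine mul_le_mul_of_nonneg_left ((ih y (a + h x)).trans ?_) (hp x y)
        refine mul_le_mul_of_nonneg_right ?_ (tilt_nonneg hp he0 k y)
        have : c * (((a + h x : ℤ) : ℝ) - N) = c * (a - N) + c * h x := by push_cast; ring
        rw [this, Real.exp_add]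
        exact mul_le_mul_of_nonneg_left (he x hx) (Real.exp_nonneg _)
      refine (Finset.sum_le_sum fun y _ => h1 y).trans_eq ?_
      rw [Finset.mul_sum, Finset.mul_sum]
      exact Finset.sum_congr rfl fun y _ => by ring
    · positivity

/-- Pairing the step inequality with `z'` bounds the left side by `⟨z', B z⟩`, which is polarized
into the forms at `z + z'` and `z - z'`. Since `B ≥ 0` entrywise, `-⟨w, B w⟩ ≤ ⟨|w|, B |w|⟩`, so the
one-sided form bound controls both terms. The parallelogram law then gives `4 E' ≤ 2 E + 2 E'` for
the two energies. -/
theorem energy_le {good : ι → Prop} {B : ι → ι → ℝ} {c z z' : ι → ℝ}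
    (hsymm : ∀ x y, B x y = B y x) (hB : ∀ x y, 0 ≤ B x y)
    (hz : ∀ x, ¬ good x → z x = 0) (hz' : ∀ x, ¬ good x → z' x = 0) (hz0 : ∀ x, 0 ≤ z' x)
    (hstep : ∀ x, good x → c x * z' x ≤ ∑ y, B x y * z y)
    (hform : ∀ u : ι → ℝ, (∀ x, ¬ good x → u x = 0) →
      ∑ x, ∑ y, B x y * (u x * u y) ≤ ∑ x, c x * u x ^ 2) :
    ∑ x, c x * z' x ^ 2 ≤ ∑ x, c x * z x ^ 2 := by
  have h1 : ∑ x, c x * z' x ^ 2 ≤ ∑ x, ∑ y, B x y * (z' x * z y) := by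
    refine Finset.sum_le_sum fun x _ => ?_
    by_cases hx : good x
    · have := mul_le_mul_of_nonneg_left (hstep x hx) (hz0 x)
      rw [Finset.mul_sum] at this
      calc c x * z' x ^ 2 = z' x * (c x * z' x) := by ring
        _ ≤ _ := this
        _ = _ := Finset.sum_congr rfl fun y _ => by ring
    · simp [hz' x hx]
  have h2 := hform (fun x => z x + z' x) fun x hx => by simp [hz x hx, hz' x hx]
  have h3 := hform (fun x => |z x - z' x|) fun x hx => by simp [hz x hx, hz' x hx]
  have h4 : -∑ x, ∑ y, B x y * ((z x - z' x) * (z y - z' y)) ≤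
      ∑ x, ∑ y, B x y * (|z x - z' x| * |z y - z' y|) := by
    rw [← Finset.sum_neg_distrib]
    refine Finset.sum_le_sum fun x _ => ?_
    rw [← Finset.sum_neg_distrib]
    refine Finset.sum_le_sum fun y _ => ?_
    rw [← abs_mul]
    have := mul_le_mul_of_nonneg_left (neg_abs_le ((z x - z' x) * (z y - z' y))) (hB x y)
    linarith
  have h5 : ∑ x, ∑ y, B x y * ((z x + z' x) * (z y + z' y)) -
      ∑ x, ∑ y, B x y * ((z x - z' x) * (z y - z' y)) =
      4 * ∑ x, ∑ y, B x y * (z' x * z y) := by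
    have h6 : ∑ x, ∑ y, B x y * (z x * z' y) = ∑ x, ∑ y, B x y * (z' x * z y) := by
      rw [Finset.sum_comm]
      refine Finset.sum_congr rfl fun x _ => Finset.sum_congr rfl fun y _ => ?_
      rw [hsymm y x]; ring
    have h7 : (4 : ℝ) * ∑ x, ∑ y, B x y * (z' x * z y) =
        2 * ∑ x, ∑ y, B x y * (z' x * z y) + 2 * ∑ x, ∑ y, B x y * (z x * z' y) := by
      rw [h6]; ring
    rw [h7]
    simp only [Finset.mul_sum, ← Finset.sum_add_distrib, ← Finset.sum_sub_distrib]
    refine Finset.sum_congr rfl fun x _ => Finset.sum_congr rfl fun y _ => ?_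
    ring
  have h8 : ∑ x, c x * (z x + z' x) ^ 2 + ∑ x, c x * |z x - z' x| ^ 2 =
      2 * ∑ x, c x * z x ^ 2 + 2 * ∑ x, c x * z' x ^ 2 := by
    simp only [Finset.mul_sum, ← Finset.sum_add_distrib, sq_abs]
    exact Finset.sum_congr rfl fun x _ => by ring
  linarith

/-- If the ground energy of the generator is at least `c`, then the walk is unlikely to survive
for a long time. -/
theorem survive_sq_le {good : ι → Prop} {p B : ι → ι → ℝ} {m W : ι → ℝ} {h : ι → ℤ} {N : ℤ}
    {c R : ℝ} (hc : 0 ≤ c) (hc1 : c ≤ 1) (hR : 0 < R) (hp : ∀ x y, 0 ≤ p x y)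
    (hp1 : ∀ x, good x → ∑ y, p x y ≤ 1) (hm : ∀ x, 0 ≤ m x) (hW : ∀ x, 1 ≤ W x)
    (hsymm : ∀ x y, B x y = B y x) (hB : ∀ x y, 0 ≤ B x y)
    (hpB : ∀ x y, good x → W x * (m x * p x y) ≤ B x y * m y)
    (hh : ∀ x, good x → h x * W x ≤ R)
    (hform : ∀ u : ι → ℝ, (∀ x, ¬ good x → u x = 0) →
      ∑ x, ∑ y, B x y * (u x * u y) ≤ ∑ x, (W x - c) * u x ^ 2)
    (k : ℕ) (x : ι) (a : ℤ) :
    survive good p h N (k + 1) x a ^ 2 * m x ^ 2 ≤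
      Real.exp (2 * (c / R * (a - N)) + 3) * ∑ y, W y * m y ^ 2 := by
  have hW0 : ∀ x, 0 < W x := fun x => one_pos.trans_le (hW x)
  set e : ι → ℝ := fun x => Real.exp (c / W x) with he
  have he0 : ∀ x, 0 ≤ e x := fun x => (Real.exp_pos _).le
  have hcW : ∀ x, c / W x ≤ 1 := fun x => (div_le_one (hW0 x)).2 (hc1.trans (hW x))
  have he1 : ∀ x, e x ≤ Real.exp 1 := fun x => Real.exp_le_exp.2 (hcW x)
  have hAn : ∀ k x, 0 ≤ tilt good p e k x := tilt_nonneg hp he0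
  -- The inverse of the tilt `e` enters the weight, so that `cc * z (k + 1)` is the untilted step
  -- applied to `z k`.
  set cc : ι → ℝ := fun x => W x * Real.exp (-(c / W x)) with hcc
  have hcc0 : ∀ x, 0 ≤ cc x := fun x => mul_nonneg (hW0 x).le (Real.exp_pos _).le
  -- The shift to `k + 1` makes `z k` vanish at bad points, as the form bound requires; `tilt` at 0
  -- does not.
  set z : ℕ → ι → ℝ := fun k x => m x * tilt good p e (k + 1) x with hz
  have hz0 : ∀ k x, 0 ≤ z k x := fun k x => mul_nonneg (hm x) (hAn _ x)
  have hbad : ∀ k x, ¬ good x → z k x = 0 := fun k x hx => by simp [hz, tilt, hx]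
  have hform' : ∀ u : ι → ℝ, (∀ x, ¬ good x → u x = 0) →
      ∑ x, ∑ y, B x y * (u x * u y) ≤ ∑ x, cc x * u x ^ 2 := by
    intro u hu
    refine (hform u hu).trans (Finset.sum_le_sum fun x _ => ?_)
    refine mul_le_mul_of_nonneg_right ?_ (sq_nonneg _)
    have h1 := mul_le_mul_of_nonneg_left (Real.add_one_le_exp (-(c / W x))) (hW0 x).le
    have h2 : W x * (-(c / W x) + 1) = W x - c := by
      have := (hW0 x).ne'
      field_simp; ring
    simp only [hcc]; linarith
  have hE : ∀ k, ∑ x, cc x * z (k + 1) x ^ 2 ≤ ∑ x, cc x * z k x ^ 2 := by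
    intro k
    refine energy_le hsymm hB (hbad k) (hbad (k + 1)) (hz0 _) (fun x hx => ?_) hform'
    have h1 : cc x * z (k + 1) x = ∑ y, W x * (m x * p x y) * tilt good p e (k + 1) y := by
      simp only [hz, hcc]
      conv_lhs => rw [tilt]
      rw [if_pos hx]
      have : W x * Real.exp (-(c / W x)) * (m x * (e x * ∑ y, p x y * tilt good p e (k + 1) y)) =
          (Real.exp (-(c / W x)) * e x) * (W x * m x * ∑ y, p x y * tilt good p e (k + 1) y) := by
        ring
      rw [this, he, ← Real.exp_add, neg_add_cancel, Real.exp_zero, one_mul, Finset.mul_sum]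
      exact Finset.sum_congr rfl fun y _ => by ring
    rw [h1]
    refine Finset.sum_le_sum fun y _ => ?_
    calc _ ≤ B x y * m y * tilt good p e (k + 1) y :=
          mul_le_mul_of_nonneg_right (hpB x y hx) (hAn _ y)
      _ = _ := by simp only [hz]; ring
  have hEk : ∀ k, ∑ x, cc x * z k x ^ 2 ≤ ∑ x, cc x * z 0 x ^ 2 := by
    intro k
    induction k with
    | zero => exact le_rfl
    | succ k ih => exact (hE k).trans ih
  have h0 : ∑ x, cc x * z 0 x ^ 2 ≤ Real.exp 2 * ∑ y, W y * m y ^ 2 := by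
    rw [Finset.mul_sum]
    refine Finset.sum_le_sum fun y _ => ?_
    have h1 : cc y ≤ W y := by
      have : Real.exp (-(c / W y)) ≤ 1 := by
        rw [Real.exp_le_one_iff]; have := div_nonneg hc (hW0 y).le; linarith
      simpa using mul_le_mul_of_nonneg_left this (hW0 y).le
    have h2 : z 0 y ≤ Real.exp 1 * m y := by
      by_cases hy : good y
      · simp only [hz, tilt, if_pos hy, mul_one]
        have : e y * ∑ x, p y x ≤ Real.exp 1 * 1 :=
          mul_le_mul (he1 y) (hp1 y hy) (Finset.sum_nonneg fun x _ => hp y x) (Real.exp_pos _).le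
        nlinarith [hm y]
      · rw [hbad 0 y hy]; exact mul_nonneg (Real.exp_pos _).le (hm y)
    have h3 : z 0 y ^ 2 ≤ Real.exp 2 * m y ^ 2 := by
      have h4 := pow_le_pow_left₀ (hz0 0 y) h2 2
      have h5 : Real.exp 2 = Real.exp 1 ^ 2 := by rw [← Real.exp_nat_mul]; norm_num
      rw [h5]; linarith [mul_pow (Real.exp 1) (m y) 2]
    calc cc y * z 0 y ^ 2 ≤ W y * (Real.exp 2 * m y ^ 2) :=
          mul_le_mul h1 h3 (sq_nonneg _) (hW0 y).le
      _ = _ := by ring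
  have h1 : cc x * z k x ^ 2 ≤ Real.exp 2 * ∑ y, W y * m y ^ 2 :=
    (Finset.single_le_sum (f := fun x => cc x * z k x ^ 2)
      (fun y _ => mul_nonneg (hcc0 y) (sq_nonneg _)) (Finset.mem_univ x)).trans ((hEk k).trans h0)
  have h2 : Real.exp (-1) ≤ cc x := by
    have h3 : Real.exp (-1) ≤ Real.exp (-(c / W x)) := Real.exp_le_exp.2 (by linarith [hcW x])
    have := mul_le_mul (hW x) h3 (Real.exp_pos _).le (hW0 x).le
    simpa [hcc] using this
  have h3 : z k x ^ 2 ≤ Real.exp 3 * ∑ y, W y * m y ^ 2 := by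
    have h4 := (mul_le_mul_of_nonneg_right h2 (sq_nonneg (z k x))).trans h1
    have h5 := mul_le_mul_of_nonneg_left h4 (Real.exp_pos 1).le
    rw [← mul_assoc, ← mul_assoc, ← Real.exp_add, ← Real.exp_add] at h5
    norm_num at h5
    exact h5
  have hs : survive good p h N (k + 1) x a ≤
      Real.exp (c / R * (a - N)) * tilt good p e (k + 1) x := by
    -- The exponent per unit of credit is `c / R`, because `h W ≤ R` turns it into at most `c / W`
    -- per visit.
    refine survive_le_tilt (div_nonneg hc hR.le) hp (fun y hy => Real.exp_le_exp.2 ?_) he0 _ _ _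
    rw [div_mul_eq_mul_div, div_le_div_iff₀ hR (hW0 y), mul_assoc]
    exact mul_le_mul_of_nonneg_left (hh y hy) hc
  have hsn : ∀ k x a, 0 ≤ survive good p h N k x a := by
    intro k
    induction k with
    | zero => intro x a; rw [survive]; split_ifs <;> norm_num
    | succ k ih =>
      intro x a
      rw [survive]
      split_ifs
      · exact Finset.sum_nonneg fun y _ => mul_nonneg (hp x y) (ih _ _)
      · exact le_rfl
  calc survive good p h N (k + 1) x a ^ 2 * m x ^ 2
      ≤ (Real.exp (c / R * (a - N)) * tilt good p e (k + 1) x) ^ 2 * m x ^ 2 :=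
        mul_le_mul_of_nonneg_right (pow_le_pow_left₀ (hsn _ _ _) hs 2) (sq_nonneg _)
    _ = Real.exp (2 * (c / R * (a - N))) * z k x ^ 2 := by
        have : Real.exp (2 * (c / R * (a - N))) = Real.exp (c / R * (a - N)) ^ 2 := by
          rw [← Real.exp_nat_mul]; norm_num
        rw [this]; simp only [hz]; ring
    _ ≤ Real.exp (2 * (c / R * (a - N))) * (Real.exp 3 * ∑ y, W y * m y ^ 2) :=
        mul_le_mul_of_nonneg_left h3 (Real.exp_pos _).le
    _ = _ := by rw [Real.exp_add]; ring

/-! ### Recurrent walks -/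

/-- The expected value of `f` at the credit after `k` steps of a Markov chain `K`. -/
def expect (K : ι → ι → ℝ) (h : ι → ℤ) (f : ℤ → ℝ) : ℕ → ι → ℤ → ℝ
  | 0, _, a => f a
  | k + 1, x, a => ∑ y, K x y * expect K h f k y (a + h x)

theorem expect_mono {K : ι → ι → ℝ} {h : ι → ℤ} {f g : ℤ → ℝ} (hK : ∀ x y, 0 ≤ K x y)
    (hfg : ∀ a, f a ≤ g a) (k : ℕ) (x : ι) (a : ℤ) : expect K h f k x a ≤ expect K h g k x a := by
  induction k generalizing x a with
  | zero => exact hfg a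
  | succ k ih =>
    exact Finset.sum_le_sum fun y _ => mul_le_mul_of_nonneg_left (ih y _) (hK x y)

theorem expect_const {K : ι → ι → ℝ} {h : ι → ℤ} (hK1 : ∀ x, ∑ y, K x y = 1) (c : ℝ)
    (k : ℕ) (x : ι) (a : ℤ) : expect K h (fun _ => c) k x a = c := by
  induction k generalizing x a with
  | zero => rfl
  | succ k ih => simp only [expect, ih, ← Finset.sum_mul, hK1, one_mul]

/-- The indicator function of the integers below `N`. -/
def below (N : ℤ) (a : ℤ) : ℝ := if a < N then 1 else 0

/-- Couple two copies of the chain along the same path: if the credit with the head start `b` still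
ends below `N`, the truncation at `N` has not cut off any of `b`. -/
theorem expect_min_le {K : ι → ι → ℝ} {h : ι → ℤ} {N b : ℤ} (hK : ∀ x y, 0 ≤ K x y) (hb : 0 ≤ b)
    (k : ℕ) (x : ι) (a : ℤ) :
    b * expect K h (below N) k x (a + b) + expect K h (fun a => ((min a N : ℤ) : ℝ)) k x a ≤
      expect K h (fun a => ((min a N : ℤ) : ℝ)) k x (a + b) := by
  induction k generalizing x a with
  | zero =>
    simp only [expect, below]
    split_ifs with hlt
    · rw [min_eq_left (by omega), min_eq_left hlt.le]; push_cast; linarith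
    · rw [mul_zero, zero_add]; exact_mod_cast min_le_min_right N (by omega)
  | succ k ih =>
    simp only [expect]
    rw [Finset.mul_sum, ← Finset.sum_add_distrib]
    refine Finset.sum_le_sum fun y _ => ?_
    have := mul_le_mul_of_nonneg_left (ih y (a + h x)) (hK x y)
    rw [add_right_comm a b (h x)]
    linarith

/-- The chain, started from a stationary distribution weighted by the holding times, is unlikely
to make many steps in a short time. -/
theorem sum_mul_expect_below_le {K : ι → ι → ℝ} {h : ι → ℤ} {ν : ι → ℝ} {N : ℤ}
    (hK : ∀ x y, 0 ≤ K x y) (hK1 : ∀ x, ∑ y, K x y = 1) (hh : ∀ x, 0 ≤ h x)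
    (hν : ∀ x, 0 ≤ ν x) (hstat : ∀ y, ∑ x, ν x * K x y = ν y) (hN : 0 ≤ N) (k : ℕ) :
    k * ∑ x, ν x * (h x * expect K h (below N) k x 0) ≤ N * ∑ x, ν x := by
  set V := expect K h (below N) with hV
  set M := expect K h (fun a => ((min a N : ℤ) : ℝ)) with hM
  -- Credit never decreases, so being below `N` later is the rarer event.
  have hdec : ∀ k x a, V (k + 1) x a ≤ V k x a := by
    intro k
    induction k with
    | zero =>
      intro x a
      simp only [hV, expect]
      rw [← Finset.sum_mul, hK1, one_mul, below, below]
      have := hh x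
      split_ifs <;> first | omega | norm_num
    | succ k ih =>
      intro x a
      rw [hV, expect, expect]
      exact Finset.sum_le_sum fun y _ => mul_le_mul_of_nonneg_left (ih y _) (hK x y)
  have hanti : ∀ j k, j ≤ k → ∀ x a, V k x a ≤ V j x a := by
    intro j k hjk x a
    induction k, hjk using Nat.le_induction with
    | base => exact le_rfl
    | succ k _ ih => exact (hdec k x a).trans ih
  have hstat' : ∀ f : ι → ℝ, ∑ x, ν x * ∑ y, K x y * f y = ∑ y, ν y * f y := by
    intro f
    simp only [Finset.mul_sum]
    rw [Finset.sum_comm]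
    refine Finset.sum_congr rfl fun y _ => ?_
    rw [← hstat y, Finset.sum_mul]
    exact Finset.sum_congr rfl fun x _ => by ring
  -- By stationarity the mean truncated credit grows at step `j` by at least the mean of `h x * V j
  -- x 0`. This is at least the same mean with `V k` as long as `j ≤ k`, whence the second
  -- alternative. At `j = k` the left side is compared with the cap `N`.
  have hkey : ∀ j, j * ∑ x, ν x * (h x * V k x 0) ≤ ∑ x, ν x * M j x 0 ∨ k < j := by
    intro j
    induction j with
    | zero =>
      left
      rw [Nat.cast_zero, zero_mul]
      exact Finset.sum_nonneg fun x _ => mul_nonneg (hν x) (by simp [hM, expect, hN])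
    | succ j ih =>
      rcases ih with ih | ih
      · by_cases hj : k < j + 1
        · exact Or.inr hj
        left
        have h1 : ∀ x, h x * V k x 0 + ∑ y, K x y * M j y 0 ≤ M (j + 1) x 0 := by
          intro x
          have h2 : (h x : ℝ) * V k x 0 ≤ h x * V (j + 1) x 0 :=
            mul_le_mul_of_nonneg_left (hanti _ _ (by omega) x 0) (by exact_mod_cast hh x)
          refine (add_le_add_left h2 _).trans ?_
          rw [hV, hM, expect, expect, Finset.mul_sum, ← Finset.sum_add_distrib]
          refine Finset.sum_le_sum fun y _ => ?_
          have := mul_le_mul_of_nonneg_left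
            (expect_min_le (N := N) (h := h) hK (hh x) j y 0) (hK x y)
          linarith
        have h3 : ∑ x, ν x * (h x * V k x 0 + ∑ y, K x y * M j y 0) ≤ ∑ x, ν x * M (j + 1) x 0 :=
          Finset.sum_le_sum fun x _ => mul_le_mul_of_nonneg_left (h1 x) (hν x)
        simp only [mul_add, Finset.sum_add_distrib, hstat'] at h3
        push_cast
        linarith
      · exact Or.inr (by omega)
  refine ((hkey k).resolve_right (lt_irrefl k)).trans ?_
  rw [Finset.mul_sum]
  refine Finset.sum_le_sum fun x _ => ?_
  rw [mul_comm]
  refine mul_le_mul_of_nonneg_right ?_ (hν x)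
  refine (expect_mono hK (fun a => ?_) k x 0).trans_eq (expect_const hK1 (N : ℝ) k x 0)
  exact_mod_cast min_le_right a N

/-- The substochastic walk `p` is the chain `K` with mass at most `ε` removed per step; it stays in
`S`, where every point is good. Survival can thus fail only through too little credit or through the
lost mass, which the union bound adds up. -/
theorem le_survive {S good : ι → Prop} {K p : ι → ι → ℝ} {h : ι → ℤ} {N : ℤ} {ε : ℝ} (hε : 0 ≤ ε)
    (hp : ∀ x y, 0 ≤ p x y) (hpK : ∀ x y, S x → p x y ≤ K x y) (hK1 : ∀ x, ∑ y, K x y = 1)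
    (hpε : ∀ x, S x → 1 - ε ≤ ∑ y, p x y) (hS : ∀ x y, S x → ¬ S y → p x y = 0)
    (hK : ∀ x y, 0 ≤ K x y) (hgood : ∀ x, S x → good x) (k : ℕ) (x : ι) (hx : S x) (a : ℤ) :
    1 - expect K h (below N) k x a - k * ε ≤ survive good p h N k x a := by
  have hV : ∀ k x a, 0 ≤ expect K h (below N) k x a := by
    intro k x a
    rw [← expect_const hK1 (0 : ℝ) k x a]
    refine expect_mono hK (fun a => ?_) k x a
    rw [below]; split_ifs <;> norm_num
  induction k generalizing x a with
  | zero =>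
    simp only [expect, survive, below]
    split_ifs <;> first | omega | norm_num
  | succ k ih =>
    rw [expect, survive, if_pos (hgood x hx)]
    have h1 : ∀ y, p x y - K x y * expect K h (below N) k y (a + h x) - K x y * (k * ε) ≤
        p x y * survive good p h N k y (a + h x) := by
      intro y
      have hk : 0 ≤ (k : ℝ) * ε := by positivity
      by_cases hy : S y
      · have h2 := mul_le_mul_of_nonneg_left (ih y hy (a + h x)) (hp x y)
        have h3 := mul_le_mul_of_nonneg_right (hpK x y hx) (hV k y (a + h x))
        have h4 := mul_le_mul_of_nonneg_right (hpK x y hx) hk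
        linarith
      · rw [hS x y hx hy]
        have h3 := mul_nonneg (hK x y) (hV k y (a + h x))
        have h4 := mul_nonneg (hK x y) hk
        linarith
    have h2 := Finset.sum_le_sum fun y (_ : y ∈ Finset.univ) => h1 y
    simp only [Finset.sum_sub_distrib, ← Finset.sum_mul, hK1] at h2
    have := hpε x hx
    push_cast
    linarith

end Walk

/-! ## The fixed-node walk -/

section FixedNode

variable {ι : Type} [Fintype ι] [DecidableEq ι]

/-- The rate `- H x y ψ y / ψ x`, in units of `1 / P` and rounded. -/
def drift (H : Matrix ι ι ℝ) (ψ : ι → ℝ) (P : ℤ) (x y : ι) : ℤ := ⌊-(H x y * ψ y / ψ x) * P⌋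

/-- The total rate at `x`, in units of `1 / P`. -/
def totalRate (H : Matrix ι ι ℝ) (ψ : ι → ℝ) (P : ℤ) (s : ℕ) (x : ι) : ℤ :=
  P + 2 * s + ∑ y, max (drift H ψ P x y) 0

/-- The local condition that is checked before a step. -/
def IsGood (H : Matrix ι ι ℝ) (ψ : ι → ℝ) (P : ℤ) (s : ℕ) (x : ι) : Prop :=
  ψ x ≠ 0 ∧ -(s : ℤ) ≤ ∑ y, drift H ψ P x y

/-- The number of random seeds that lead from `x` to `y`. -/
def seeds (H : Matrix ι ι ℝ) (ψ : ι → ℝ) (P : ℤ) (s : ℕ) (x y : ι) : ℤ :=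
  (if x = y then P * P / totalRate H ψ P s x else 0) +
    max (drift H ψ P x y) 0 * P / totalRate H ψ P s x

/-- The holding time at `x`, in units of `1 / R`. -/
def hold (H : Matrix ι ι ℝ) (ψ : ι → ℝ) (P : ℤ) (s : ℕ) (R : ℤ) (x : ι) : ℤ :=
  R * P / totalRate H ψ P s x

variable {H : Matrix ι ι ℝ} {ψ : ι → ℝ} {P : ℤ} {s : ℕ} {R : ℤ}

theorem le_totalRate (x : ι) : P + 2 * s ≤ totalRate H ψ P s x :=
  le_add_of_nonneg_right (Finset.sum_nonneg fun _ _ => le_max_right _ _)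

theorem totalRate_pos (hP : 0 < P) (x : ι) : 0 < totalRate H ψ P s x := by
  have := le_totalRate (H := H) (ψ := ψ) (P := P) (s := s) x
  omega

theorem cast_ediv_le (a : ℤ) {b : ℤ} (hb : 0 < b) : ((a / b : ℤ) : ℝ) ≤ (a : ℝ) / b := by
  have hb' : (0 : ℝ) < b := by exact_mod_cast hb
  rw [le_div_iff₀ hb']
  exact_mod_cast Int.ediv_mul_le a hb.ne'

theorem lt_cast_ediv_add_one (a : ℤ) {b : ℤ} (hb : 0 < b) :
    (a : ℝ) / b < ((a / b : ℤ) : ℝ) + 1 := by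
  have hb' : (0 : ℝ) < b := by exact_mod_cast hb
  rw [div_lt_iff₀ hb']
  exact_mod_cast Int.lt_ediv_add_one_mul_self a hb

theorem seeds_nonneg (hP : 0 < P) (x y : ι) : 0 ≤ seeds H ψ P s x y := by
  have hT := (totalRate_pos (H := H) (ψ := ψ) (s := s) hP x).le
  refine add_nonneg ?_ (Int.ediv_nonneg (mul_nonneg (le_max_right _ _) hP.le) hT)
  split_ifs
  · exact Int.ediv_nonneg (mul_nonneg hP.le hP.le) hT
  · exact le_rfl

theorem max_drift_le (hP : 0 < P) (x y : ι) :
    ((max (drift H ψ P x y) 0 : ℤ) : ℝ) ≤ max (-(H x y * ψ y / ψ x)) 0 * P := by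
  have hP' : (0 : ℝ) < P := by exact_mod_cast hP
  rw [max_mul_of_nonneg _ _ hP'.le, zero_mul]
  push_cast
  exact max_le_max_right 0 (Int.floor_le _)

/-- All roundings are downwards and the total rate cancels, so the rounded walk is dominated by the
exact rates. -/
theorem seeds_mul_le (hP : 0 < P) (x y : ι) :
    (totalRate H ψ P s x : ℝ) / P * ((seeds H ψ P s x y : ℝ) / P) ≤
      (if x = y then 1 else 0) + max (-(H x y * ψ y / ψ x)) 0 := by
  have hP' : (0 : ℝ) < P := by exact_mod_cast hP
  have hT := totalRate_pos (H := H) (ψ := ψ) (s := s) hP x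
  have hT' : (0 : ℝ) < totalRate H ψ P s x := by exact_mod_cast hT
  have h1 : (seeds H ψ P s x y : ℝ) ≤ ((if x = y then 1 else 0) * (P * P) +
      max (-(H x y * ψ y / ψ x)) 0 * P * P) / totalRate H ψ P s x := by
    rw [seeds, add_div]
    push_cast
    refine add_le_add ?_ ?_
    · split_ifs
      · simpa using cast_ediv_le (P * P) hT
      · simp
    · refine (cast_ediv_le _ hT).trans ?_
      rw [Int.cast_mul]
      exact div_le_div_of_nonneg_right (mul_le_mul_of_nonneg_right (max_drift_le hP x y) hP'.le)
        hT'.le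
  calc _ ≤ (totalRate H ψ P s x : ℝ) / P * ((((if x = y then 1 else 0) * (P * P) +
      max (-(H x y * ψ y / ψ x)) 0 * P * P) / totalRate H ψ P s x) / P) := by gcongr
    _ = _ := by field_simp

/-- The seeds of all targets fit among the `P` possible seeds; the surplus kills the walk. -/
theorem sum_seeds_le (hP : 0 < P) (x : ι) : ∑ y, seeds H ψ P s x y ≤ P := by
  have hT := totalRate_pos (H := H) (ψ := ψ) (s := s) hP x
  have hT' : (0 : ℝ) < totalRate H ψ P s x := by exact_mod_cast hT
  have hP' : (0 : ℝ) < P := by exact_mod_cast hP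
  have h1 : ∑ y, (seeds H ψ P s x y : ℝ) ≤
      (P * (P + ∑ y, ((max (drift H ψ P x y) 0 : ℤ) : ℝ))) / totalRate H ψ P s x := by
    have h2 : ∀ y, (seeds H ψ P s x y : ℝ) ≤ (if x = y then (P : ℝ) * P else 0) /
        totalRate H ψ P s x + (P * ((max (drift H ψ P x y) 0 : ℤ) : ℝ)) / totalRate H ψ P s x := by
      intro y
      rw [seeds]
      push_cast
      refine add_le_add ?_ ?_
      · split_ifs
        · simpa using cast_ediv_le (P * P) hT
        · simp
      · refine (cast_ediv_le _ hT).trans_eq ?_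
        push_cast; ring
    refine (Finset.sum_le_sum fun y _ => h2 y).trans_eq ?_
    rw [Finset.sum_add_distrib, ← Finset.sum_div, ← Finset.sum_div, ← Finset.mul_sum]
    simp only [Finset.sum_ite_eq, Finset.mem_univ, if_true]
    ring
  have h2 : (totalRate H ψ P s x : ℝ) =
      P + 2 * s + ∑ y, ((max (drift H ψ P x y) 0 : ℤ) : ℝ) := by
    rw [totalRate]; push_cast; rfl
  have h3 : ∑ y, (seeds H ψ P s x y : ℝ) ≤ P := by
    refine h1.trans ?_
    rw [div_le_iff₀ hT', h2]
    refine mul_le_mul_of_nonneg_left ?_ hP'.le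
    have : (0 : ℝ) ≤ s := by positivity
    linarith
  exact_mod_cast h3

theorem hold_nonneg (hP : 0 < P) (hR : 0 ≤ R) (x : ι) : 0 ≤ hold H ψ P s R x :=
  Int.ediv_nonneg (mul_nonneg hR hP.le) (totalRate_pos hP x).le

theorem hold_mul_le (hP : 0 < P) (x : ι) :
    (hold H ψ P s R x : ℝ) * (totalRate H ψ P s x / P) ≤ R := by
  have hT := totalRate_pos (H := H) (ψ := ψ) (s := s) hP x
  have hT' : (0 : ℝ) < totalRate H ψ P s x := by exact_mod_cast hT
  have hP' : (0 : ℝ) < P := by exact_mod_cast hP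
  have h1 := cast_ediv_le (R * P) hT
  rw [hold, ← mul_div_assoc, div_le_iff₀ hP']
  push_cast at h1
  rwa [le_div_iff₀ hT'] at h1

/-- The rounding errors in the rates are at most one for each nonzero entry of the row. -/
theorem sum_le_sum_max_drift (hs : {y | H x y ≠ 0}.ncard ≤ s) (hP : 0 < P) :
    (∑ y, max (-(H x y * ψ y / ψ x)) 0) * P - s ≤ ∑ y, ((max (drift H ψ P x y) 0 : ℤ) : ℝ) := by
  have hP' : (0 : ℝ) < P := by exact_mod_cast hP
  have h1 : ∀ y, max (-(H x y * ψ y / ψ x)) 0 * P - (if H x y ≠ 0 then 1 else 0) ≤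
      ((max (drift H ψ P x y) 0 : ℤ) : ℝ) := by
    intro y
    by_cases hy : H x y = 0
    · simp [hy, drift]
    · rw [if_pos hy, max_mul_of_nonneg _ _ hP'.le, zero_mul, drift]
      push_cast
      have := Int.lt_floor_add_one (-(H x y * ψ y / ψ x) * P)
      rw [sub_le_iff_le_add]
      refine max_le ?_ ?_
      · linarith [le_max_left ((⌊-(H x y * ψ y / ψ x) * P⌋ : ℤ) : ℝ) 0]
      · linarith [le_max_right ((⌊-(H x y * ψ y / ψ x) * P⌋ : ℤ) : ℝ) 0]
  have h2 := Finset.sum_le_sum fun y (_ : y ∈ Finset.univ) => h1 y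
  rw [Finset.sum_sub_distrib, ← Finset.sum_mul, Finset.sum_boole] at h2
  have h3 : ((Finset.univ.filter fun y => H x y ≠ 0).card : ℝ) ≤ s := by
    rw [← Set.ncard_coe_finset]
    simpa using hs
  linarith

theorem one_add_le_totalRate {x : ι} (hs : {y | H x y ≠ 0}.ncard ≤ s) (hP : 0 < P) :
    1 + ∑ y, max (-(H x y * ψ y / ψ x)) 0 ≤ (totalRate H ψ P s x : ℝ) / P := by
  have hP' : (0 : ℝ) < P := by exact_mod_cast hP
  have h1 := sum_le_sum_max_drift (ψ := ψ) hs hP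
  rw [le_div_iff₀ hP', totalRate]
  push_cast at h1 ⊢
  have : (0 : ℝ) ≤ s := by positivity
  linarith

/-- The local check says that the wrong-sign entries exceed the positive rates by at most `s / P`.
The rounding of the positive rates costs another `s / P`, so the `2 * s` in `totalRate` covers both.
-/
theorem IsGood.one_add_le {x : ι} (hx : IsGood H ψ P s x) (hs : {y | H x y ≠ 0}.ncard ≤ s)
    (hP : 0 < P) : 1 + ∑ y, max (H x y * ψ y / ψ x) 0 ≤ (totalRate H ψ P s x : ℝ) / P := by
  have hP' : (0 : ℝ) < P := by exact_mod_cast hP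
  have h1 := sum_le_sum_max_drift (ψ := ψ) hs hP
  have h2 : -(s : ℝ) ≤ ∑ y, (drift H ψ P x y : ℝ) := by exact_mod_cast hx.2
  have h3 : ∑ y, (drift H ψ P x y : ℝ) ≤ (∑ y, -(H x y * ψ y / ψ x)) * P := by
    rw [Finset.sum_mul]
    exact Finset.sum_le_sum fun y _ => Int.floor_le _
  have h4 : ∑ y, -(H x y * ψ y / ψ x) =
      ∑ y, max (-(H x y * ψ y / ψ x)) 0 - ∑ y, max (H x y * ψ y / ψ x) 0 := by
    rw [← Finset.sum_sub_distrib]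
    refine Finset.sum_congr rfl fun y _ => ?_
    rcases le_total (H x y * ψ y / ψ x) 0 with h | h
    · rw [max_eq_left (by linarith), max_eq_right h]; ring
    · rw [max_eq_right (by linarith), max_eq_left h]; ring
  rw [h4, sub_mul] at h3
  rw [le_div_iff₀ hP', totalRate]
  push_cast at h1 ⊢
  linarith

/-- The off-diagonal part of the fixed-node operator. -/
def fixedNode (H : Matrix ι ι ℝ) (ψ : ι → ℝ) (x y : ι) : ℝ :=
  (if x = y then 1 else 0) + max (-(H x y * (ψ x / |ψ x|) * (ψ y / |ψ y|))) 0

theorem fixedNode_symm (hH : H.IsSymm) (x y : ι) : fixedNode H ψ x y = fixedNode H ψ y x := by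
  rw [fixedNode, fixedNode, hH.apply x y, mul_right_comm]
  simp only [eq_comm]

theorem fixedNode_nonneg (x y : ι) : 0 ≤ fixedNode H ψ x y := by
  rw [fixedNode]
  have := le_max_right (-(H x y * (ψ x / |ψ x|) * (ψ y / |ψ y|))) 0
  split_ifs <;> linarith

/-- Conjugation by `|ψ|` makes the rates symmetric, which yields both the form bound and
reversibility. Division by zero gives 0, so zeros of `ψ` get the sign 0. -/
theorem abs_mul_rate (x y : ι) :
    |ψ x| * ((if x = y then 1 else 0) + max (-(H x y * ψ y / ψ x)) 0) =
      if ψ x = 0 then 0 else fixedNode H ψ x y * |ψ y| := by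
  rcases eq_or_ne (ψ x) 0 with hx | hx
  · simp [hx]
  have h1 : |ψ x| * max (-(H x y * ψ y / ψ x)) 0 =
      max (-(H x y * (ψ x / |ψ x|) * (ψ y / |ψ y|))) 0 * |ψ y| := by
    rw [mul_max_of_nonneg _ _ (abs_nonneg _), max_mul_of_nonneg _ _ (abs_nonneg _)]
    congr 1
    · have h3 : |ψ x| / ψ x = ψ x / |ψ x| := by
        rw [div_eq_div_iff hx (abs_ne_zero.2 hx), abs_mul_abs_self]
      have h4 : ψ y / |ψ y| * |ψ y| = ψ y := by
        rcases eq_or_ne (ψ y) 0 with h | h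
        · simp [h]
        · exact div_mul_cancel₀ _ (abs_ne_zero.2 h)
      rw [neg_mul, mul_assoc _ (ψ y / |ψ y|), h4, ← h3]
      ring
    · ring
  rw [if_neg hx, mul_add, h1, fixedNode, add_mul]
  rcases eq_or_ne x y with rfl | hxy
  · simp
  · simp [hxy]

/-- With `G` the matrix `H` conjugated by the signs of `ψ`, one has `fixedNode = 1 + G⁺ - G`. The
form of `G` is at least `c` because `u` vanishes at the zeros of `ψ`, so the signs preserve its
norm. The form of `G⁺` is bounded by a diagonal one, and the local check bounds that diagonal plus 1
by the total rate. -/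
theorem fixedNode_form_le (hH : H.IsSymm) {c : ℝ}
    (hc : ∀ u : ι → ℝ, c * ∑ x, u x ^ 2 ≤ ∑ x, ∑ y, H x y * (u x * u y))
    (hs : ∀ x, {y | H x y ≠ 0}.ncard ≤ s) (hP : 0 < P) (u : ι → ℝ)
    (hu : ∀ x, ¬ IsGood H ψ P s x → u x = 0) :
    ∑ x, ∑ y, fixedNode H ψ x y * (u x * u y) ≤
      ∑ x, ((totalRate H ψ P s x : ℝ) / P - c) * u x ^ 2 := by
  have hu' : ∀ x, ψ x = 0 → u x = 0 := fun x hx => hu x fun h => h.1 hx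
  have h1 : ∑ x, ∑ y, fixedNode H ψ x y * (u x * u y) = ∑ x, u x ^ 2 +
      ∑ x, ∑ y, max (H x y * (ψ x / |ψ x|) * (ψ y / |ψ y|)) 0 * (u x * u y) -
      ∑ x, ∑ y, H x y * ((ψ x / |ψ x| * u x) * (ψ y / |ψ y| * u y)) := by
    rw [← Finset.sum_add_distrib, ← Finset.sum_sub_distrib]
    refine Finset.sum_congr rfl fun x _ => ?_
    have h2 : u x ^ 2 = ∑ y, (if x = y then 1 else 0) * (u x * u y) := by
      simp [sq]
    rw [h2, ← Finset.sum_add_distrib, ← Finset.sum_sub_distrib]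
    refine Finset.sum_congr rfl fun y _ => ?_
    rw [fixedNode]
    rcases le_total (H x y * (ψ x / |ψ x|) * (ψ y / |ψ y|)) 0 with h | h
    · rw [max_eq_left (by linarith), max_eq_right h]; ring
    · rw [max_eq_right (by linarith), max_eq_left h]; ring
  have h3 : ∑ x, (ψ x / |ψ x| * u x) ^ 2 = ∑ x, u x ^ 2 := by
    refine Finset.sum_congr rfl fun x _ => ?_
    rcases eq_or_ne (ψ x) 0 with hx | hx
    · simp [hu' x hx]
    · rw [mul_pow, div_pow, sq_abs, div_self (pow_ne_zero 2 hx), one_mul]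
  have h4 := hc fun x => ψ x / |ψ x| * u x
  rw [h3] at h4
  -- AM-GM with the weight `|ψ y| / |ψ x|`, chosen so that the diagonal terms become the wrong-sign
  -- part of the local energy.
  have h5 : ∀ x y, max (H x y * (ψ x / |ψ x|) * (ψ y / |ψ y|)) 0 * (u x * u y) ≤
      (max (H x y * ψ y / ψ x) 0 * u x ^ 2 + max (H y x * ψ x / ψ y) 0 * u y ^ 2) / 2 := by
    intro x y
    have h6 : 0 ≤ (max (H x y * ψ y / ψ x) 0 * u x ^ 2 +
        max (H y x * ψ x / ψ y) 0 * u y ^ 2) / 2 := by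
      have := le_max_right (H x y * ψ y / ψ x) 0
      have := le_max_right (H y x * ψ x / ψ y) 0
      positivity
    rcases eq_or_ne (ψ x) 0 with hx | hx
    · rw [hu' x hx, zero_mul, mul_zero]; rwa [hu' x hx] at h6
    rcases eq_or_ne (ψ y) 0 with hy | hy
    · rw [hu' y hy, mul_zero, mul_zero]; rwa [hu' y hy] at h6
    have hx' := abs_pos.2 hx
    have hy' := abs_pos.2 hy
    have key : ∀ a b : ι, ψ a ≠ 0 → ψ b ≠ 0 → max (H a b * ψ b / ψ a) 0 =
        max (H a b * (ψ a / |ψ a|) * (ψ b / |ψ b|)) 0 * (|ψ b| / |ψ a|) := by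
      intro a b ha hb
      have ha' := abs_pos.2 ha
      have hb' := abs_pos.2 hb
      rw [max_mul_of_nonneg _ _ (by positivity), zero_mul]
      congr 1
      field_simp
      rw [sq_abs]
    rw [key x y hx hy, key y x hy hx, hH.apply x y, mul_right_comm (H x y) (ψ y / |ψ y|)]
    set A := max (H x y * (ψ x / |ψ x|) * (ψ y / |ψ y|)) 0
    have hA : 0 ≤ A := le_max_right _ _
    have h7 : u x * u y ≤ (|ψ y| / |ψ x| * u x ^ 2 + |ψ x| / |ψ y| * u y ^ 2) / 2 := by
      rw [le_div_iff₀ two_pos]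
      have h8 : 0 ≤ (|ψ y| * u x - |ψ x| * u y) ^ 2 / (|ψ x| * |ψ y|) := by positivity
      have h9 : (|ψ y| * u x - |ψ x| * u y) ^ 2 / (|ψ x| * |ψ y|) =
          |ψ y| / |ψ x| * u x ^ 2 + |ψ x| / |ψ y| * u y ^ 2 - u x * u y * 2 := by
        field_simp; ring
      linarith
    calc _ ≤ A * ((|ψ y| / |ψ x| * u x ^ 2 + |ψ x| / |ψ y| * u y ^ 2) / 2) :=
          mul_le_mul_of_nonneg_left h7 hA
      _ = _ := by ring
  have h6 : ∑ x, ∑ y, max (H x y * (ψ x / |ψ x|) * (ψ y / |ψ y|)) 0 * (u x * u y) ≤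
      ∑ x, (∑ y, max (H x y * ψ y / ψ x) 0) * u x ^ 2 := by
    refine (Finset.sum_le_sum fun x _ => Finset.sum_le_sum fun y _ => h5 x y).trans_eq ?_
    have h7 : ∑ x, ∑ y, max (H y x * ψ x / ψ y) 0 * u y ^ 2 =
        ∑ x, ∑ y, max (H x y * ψ y / ψ x) 0 * u x ^ 2 := Finset.sum_comm
    simp only [← Finset.sum_div, Finset.sum_add_distrib, h7, Finset.sum_mul]
    ring
  have h7 : ∑ x, u x ^ 2 + ∑ x, (∑ y, max (H x y * ψ y / ψ x) 0) * u x ^ 2 ≤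
      ∑ x, (totalRate H ψ P s x : ℝ) / P * u x ^ 2 := by
    rw [← Finset.sum_add_distrib]
    refine Finset.sum_le_sum fun x _ => ?_
    by_cases hx : IsGood H ψ P s x
    · have := mul_le_mul_of_nonneg_right (hx.one_add_le (hs x) hP) (sq_nonneg (u x))
      linarith
    · simp [hu x hx]
  simp only [sub_mul, Finset.sum_sub_distrib, ← Finset.mul_sum]
  linarith

end FixedNode

/-! ### Survival of the fixed-node walk in the two cases of the promise -/

section FixedNodeBounds

variable {ι : Type} [Fintype ι] [DecidableEq ι] {H : Matrix ι ι ℝ} {ψ : ι → ℝ} {P : ℤ} {s : ℕ}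

theorem pow_le_two_pow_sq (hs : 64 ≤ s) : s ^ 8 ≤ 2 ^ s ^ 2 :=
  calc s ^ 8 ≤ (2 ^ s) ^ 8 := Nat.pow_le_pow_left Nat.lt_two_pow_self.le 8
    _ = 2 ^ (s * 8) := (pow_mul _ _ _).symm
    _ ≤ 2 ^ s ^ 2 := Nat.pow_le_pow_right two_pos (by nlinarith)

theorem rate_nonneg (x : ι) : 0 ≤ ∑ y, max (-(H x y * ψ y / ψ x)) 0 :=
  Finset.sum_nonneg fun _ _ => le_max_right _ _

theorem totalRate_le (hP : 0 < P) (x : ι) : (totalRate H ψ P s x : ℝ) / P ≤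
    1 + ∑ y, max (-(H x y * ψ y / ψ x)) 0 + 2 * s / P := by
  have hP' : (0 : ℝ) < P := by exact_mod_cast hP
  have h1 := Finset.sum_le_sum fun y (_ : y ∈ Finset.univ) =>
    max_drift_le (H := H) (ψ := ψ) hP x y
  rw [← Finset.sum_mul] at h1
  rw [div_le_iff₀ hP', add_mul, div_mul_cancel₀ _ hP'.ne', totalRate]
  push_cast at h1 ⊢
  linarith

theorem exp_neg_natCast_le (k : ℕ) : Real.exp (-(k : ℝ)) ≤ (1 / 2) ^ k := by
  have h1 : Real.exp (-1) ≤ 1 / 2 := by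
    rw [Real.exp_neg, one_div]
    exact inv_anti₀ two_pos (by linarith [Real.add_one_le_exp (1 : ℝ)])
  have h2 : Real.exp (-(k : ℝ)) = Real.exp (-1) ^ k := by rw [← Real.exp_nat_mul]; ring_nf
  rw [h2]
  exact pow_le_pow_left₀ (Real.exp_pos _).le h1 k

/-- If the ground energy is at least `1 / s`, the fixed-node walk rarely survives. -/
theorem fixedNode_survive_le (hH : H.IsSymm) (hs : 64 ≤ s)
    (hc : ∀ u : ι → ℝ, 1 / (s : ℝ) * ∑ x, u x ^ 2 ≤ ∑ x, ∑ y, H x y * (u x * u y))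
    (hsp : ∀ x, {y | H x y ≠ 0}.ncard ≤ s) (hcard : Fintype.card ι ≤ 2 ^ s)
    (hHb : ∀ x y, |H x y| ≤ 2 ^ s) (hψ : ∀ x, |ψ x| ≤ 2 ^ s)
    (hψ' : ∀ x, ψ x ≠ 0 → 1 ≤ |ψ x| * 2 ^ s) (hP : P = 2 ^ s ^ 2) (x : ι) :
    survive (IsGood H ψ P s) (fun x y => (seeds H ψ P s x y : ℝ) / P) (hold H ψ P s (s ^ 3))
      (s ^ 6) (s ^ 6) x 0 ≤ (1 / 2) ^ s := by
  have hP0 : 0 < P := by rw [hP]; positivity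
  have hP' : (0 : ℝ) < P := by exact_mod_cast hP0
  have hs0 : (64 : ℝ) ≤ s := by exact_mod_cast hs
  -- The energy estimate needs at least one step.
  obtain ⟨k, hk⟩ : ∃ k, s ^ 6 = k + 1 := ⟨s ^ 6 - 1, by
    have := pow_pos (show 0 < s by omega) 6; omega⟩
  rw [hk]
  rcases eq_or_ne (ψ x) 0 with hx | hx
  · rw [survive, if_neg fun h => h.1 hx]; positivity
  have hp : ∀ x y, 0 ≤ (seeds H ψ P s x y : ℝ) / P := fun x y =>
    div_nonneg (by exact_mod_cast seeds_nonneg hP0 x y) hP'.le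
  have hW : ∀ x, 1 ≤ (totalRate H ψ P s x : ℝ) / P := fun x => by
    linarith [one_add_le_totalRate (ψ := ψ) (hsp x) hP0, rate_nonneg (H := H) (ψ := ψ) x]
  have key := survive_sq_le (good := IsGood H ψ P s) (m := fun x => |ψ x|)
    (B := fixedNode H ψ) (p := fun x y => (seeds H ψ P s x y : ℝ) / P)
    (W := fun x => (totalRate H ψ P s x : ℝ) / P) (h := hold H ψ P s (s ^ 3))
    (N := s ^ 6) (c := 1 / (s : ℝ)) (R := (s : ℝ) ^ 3) (by positivity)
    (by rw [div_le_one (by linarith)]; linarith) (by positivity) hp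
    (fun x _ => by
      rw [← Finset.sum_div, div_le_one hP']
      exact_mod_cast sum_seeds_le hP0 x)
    (fun x => abs_nonneg _) hW (fixedNode_symm hH) fixedNode_nonneg
    (fun x y hx => by
      rw [mul_left_comm]
      refine (mul_le_mul_of_nonneg_left (seeds_mul_le hP0 x y) (abs_nonneg _)).trans_eq ?_
      rw [abs_mul_rate, if_neg hx.1])
    (fun x _ => by
      have := hold_mul_le (H := H) (ψ := ψ) (s := s) (R := (s : ℤ) ^ 3) hP0 x
      push_cast at this
      exact this)
    (fun u hu => fixedNode_form_le hH hc hsp hP0 u hu) k x 0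
  set S := survive (IsGood H ψ P s) (fun x y => (seeds H ψ P s x y : ℝ) / P)
    (hold H ψ P s (s ^ 3)) (s ^ 6) (k + 1) x 0
  -- One factor `2 ^ s` each for the entry, for `ψ y`, and for the inverse of `ψ x`.
  have hrate : ∀ x y, max (-(H x y * ψ y / ψ x)) 0 ≤ 2 ^ (3 * s) := by
    intro x y
    refine max_le ((le_abs_self _).trans ?_) (by positivity)
    rw [abs_neg, abs_div, abs_mul]
    rcases eq_or_ne (ψ x) 0 with hx | hx
    · simp [hx]
    · rw [div_le_iff₀ (abs_pos.2 hx)]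
      calc |H x y| * |ψ y| ≤ 2 ^ s * 2 ^ s * 1 := by
            rw [mul_one]
            exact mul_le_mul (hHb x y) (hψ y) (abs_nonneg _) (by positivity)
        _ ≤ 2 ^ s * 2 ^ s * (|ψ x| * 2 ^ s) := by
            exact mul_le_mul_of_nonneg_left (hψ' x hx) (by positivity)
        _ = _ := by rw [pow_mul']; ring
  have hcard' : (Fintype.card ι : ℝ) ≤ 2 ^ s := by exact_mod_cast hcard
  have hW' : ∀ x, (totalRate H ψ P s x : ℝ) / P ≤ 2 ^ (4 * s + 1) := by
    intro x
    refine (totalRate_le hP0 x).trans ?_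
    have h1 : ∑ y, max (-(H x y * ψ y / ψ x)) 0 ≤ 2 ^ s * 2 ^ (3 * s) := by
      refine (Finset.sum_le_sum fun y _ => hrate x y).trans ?_
      rw [Finset.sum_const, nsmul_eq_mul]
      exact mul_le_mul_of_nonneg_right hcard' (by positivity)
    have h2 : 2 * (s : ℝ) / P ≤ 2 * s := by
      refine div_le_self (by positivity) ?_
      rw [hP]; push_cast; exact one_le_pow₀ one_le_two
    have h3 : 1 + 2 * (s : ℝ) ≤ 2 ^ (4 * s) := by
      have h4 : s + 1 ≤ 2 ^ s := Nat.lt_two_pow_self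
      have h5 : (s : ℝ) + 1 ≤ 2 ^ s := by exact_mod_cast h4
      have h6 : (2 : ℝ) ^ (4 * s) = (2 ^ s) ^ 4 := by rw [pow_mul']
      rw [h6]
      have h7 : ((2 : ℝ) ^ s) ^ 2 ≤ (2 ^ s) ^ 4 := pow_le_pow_right₀ (one_le_pow₀ one_le_two) (by norm_num)
      nlinarith
    have h4 : (2 : ℝ) ^ (4 * s + 1) = 2 ^ s * 2 ^ (3 * s) + 2 ^ (4 * s) := by
      rw [← pow_add]; ring_nf
    linarith
  have hsum : ∑ y, (totalRate H ψ P s y : ℝ) / P * |ψ y| ^ 2 ≤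
      2 ^ s * (2 ^ (4 * s + 1) * (2 ^ s) ^ 2) := by
    refine (Finset.sum_le_sum fun y _ => mul_le_mul (hW' y)
      (pow_le_pow_left₀ (abs_nonneg _) (hψ y) 2) (sq_nonneg _) (by positivity)).trans ?_
    rw [Finset.sum_const, nsmul_eq_mul]
    exact mul_le_mul_of_nonneg_right hcard' (by positivity)
  -- The exponent is `3 - 2 s ^ 2`. The energy costs `2 ^ (7 s + 1)` and division by `ψ x ^ 2` costs
  -- `2 ^ (2 s)`; the target for the square is `2 ^ (-2 s)`, which adds up to `11 s + 1`.
  have hexp : Real.exp (2 * (1 / (s : ℝ) / s ^ 3 * (((0 : ℤ) : ℝ) - ((s ^ 6 : ℤ) : ℝ))) + 3) ≤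
      (1 / 2) ^ (11 * s + 1) := by
    refine le_trans (Real.exp_le_exp.2 ?_) (exp_neg_natCast_le _)
    have : 1 / (s : ℝ) / s ^ 3 * (((0 : ℤ) : ℝ) - ((s ^ 6 : ℤ) : ℝ)) = - s ^ 2 := by
      push_cast
      have : (s : ℝ) ≠ 0 := by linarith
      field_simp; ring
    rw [this]; push_cast; nlinarith
  have h1 : S ^ 2 * 1 ≤ S ^ 2 * |ψ x| ^ 2 * (2 ^ s) ^ 2 := by
    rw [mul_assoc, ← mul_pow]
    exact mul_le_mul_of_nonneg_left (one_le_pow₀ (hψ' x hx)) (sq_nonneg _)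
  have h2 : S ^ 2 ≤ ((1 / 2) ^ s) ^ 2 := by
    have h3 := key.trans (mul_le_mul hexp hsum
      (Finset.sum_nonneg fun y _ => mul_nonneg (by linarith [hW y]) (sq_nonneg _)) (by positivity))
    have h4 := mul_le_mul_of_nonneg_right h3 (show (0 : ℝ) ≤ (2 ^ s) ^ 2 by positivity)
    have h5 : (1 / 2 : ℝ) ^ (11 * s + 1) * (2 ^ s * (2 ^ (4 * s + 1) * (2 ^ s) ^ 2)) * (2 ^ s) ^ 2 =
        ((1 / 2) ^ s) ^ 2 := by
      have h6 : (2 : ℝ) ^ s * (1 / 2) ^ s = 1 := by rw [← mul_pow]; norm_num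
      have h7 : (1 / 2 : ℝ) ^ (11 * s + 1) * (2 ^ s * (2 ^ (4 * s + 1) * (2 ^ s) ^ 2)) * (2 ^ s) ^ 2 =
          (2 ^ s * (1 / 2) ^ s) ^ 9 * ((1 / 2) ^ s) ^ 2 := by
        rw [pow_add, pow_add, pow_mul', pow_mul']; ring
      rw [h7, h6]; ring
    linarith
  exact (abs_le_of_sq_le_sq' h2 (by positivity)).2

/-- Lost seeds: at most one for staying, one for each of `s` neighbours, and `2 s` for the slack in
the total rate. -/
theorem one_sub_le_sum_seeds {x : ι} (hs : {y | H x y ≠ 0}.ncard ≤ s) (hP : 0 < P) :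
    1 - (3 * s + 1) / (P : ℝ) ≤ ∑ y, (seeds H ψ P s x y : ℝ) / P := by
  have hT := totalRate_pos (H := H) (ψ := ψ) (s := s) hP x
  have hT' : (0 : ℝ) < totalRate H ψ P s x := by exact_mod_cast hT
  have hP' : (0 : ℝ) < P := by exact_mod_cast hP
  have h1 : ∀ y, (if x = y then (P : ℝ) * P / totalRate H ψ P s x - 1 else 0) +
      (P / totalRate H ψ P s x * ((max (drift H ψ P x y) 0 : ℤ) : ℝ) -
        (if H x y ≠ 0 then 1 else 0)) ≤ (seeds H ψ P s x y : ℝ) := by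
    intro y
    rw [seeds]
    push_cast
    refine add_le_add ?_ ?_
    · split_ifs
      · have := lt_cast_ediv_add_one (P * P) hT
        push_cast at this ⊢; linarith
      · simp
    · by_cases hy : H x y = 0
      · simp [hy, drift]
      · rw [if_pos hy]
        have := lt_cast_ediv_add_one (max (drift H ψ P x y) 0 * P) hT
        have h2 : (P : ℝ) / totalRate H ψ P s x * ((max (drift H ψ P x y) 0 : ℤ) : ℝ) =
          ((max (drift H ψ P x y) 0 * P : ℤ) : ℝ) / totalRate H ψ P s x := by push_cast; ring
        push_cast at this h2 ⊢; linarith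
  have h2 := Finset.sum_le_sum fun y (_ : y ∈ Finset.univ) => h1 y
  rw [Finset.sum_add_distrib, Finset.sum_sub_distrib, ← Finset.mul_sum, Finset.sum_boole,
    Finset.sum_ite_eq, if_pos (Finset.mem_univ x)] at h2
  have h3 : ((Finset.univ.filter fun y => H x y ≠ 0).card : ℝ) ≤ s := by
    rw [← Set.ncard_coe_finset]
    simpa using hs
  have h4 : (totalRate H ψ P s x : ℝ) =
      P + 2 * s + ∑ y, ((max (drift H ψ P x y) 0 : ℤ) : ℝ) := by
    rw [totalRate]; push_cast; rfl
  have h5 : (P : ℝ) * P / totalRate H ψ P s x +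
      P / totalRate H ψ P s x * ∑ y, ((max (drift H ψ P x y) 0 : ℤ) : ℝ) =
      P - P / totalRate H ψ P s x * (2 * s) := by
    rw [eq_sub_iff_add_eq]
    calc _ = (P : ℝ) / totalRate H ψ P s x *
        (P + 2 * s + ∑ y, ((max (drift H ψ P x y) 0 : ℤ) : ℝ)) := by ring
      _ = P := by rw [← h4, div_mul_cancel₀ _ hT'.ne']
  have h6 : (P : ℝ) / totalRate H ψ P s x * (2 * s) ≤ 2 * s := by
    refine mul_le_of_le_one_left (by positivity) ((div_le_one hT').2 ?_)
    have := le_totalRate (H := H) (ψ := ψ) (P := P) (s := s) x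
    exact_mod_cast (by omega : P ≤ totalRate H ψ P s x)
  rw [← Finset.sum_div, le_div_iff₀ hP', sub_mul, div_mul_cancel₀ _ hP'.ne']
  linarith

/-- The exact rates add up to zero, and each floor at a nonzero entry loses at most 1. -/
theorem isGood_of_mulVec_eq_zero {x : ι} (hs : {y | H x y ≠ 0}.ncard ≤ s)
    (hker : H *ᵥ ψ = 0) (hx : ψ x ≠ 0) : IsGood H ψ P s x := by
  refine ⟨hx, ?_⟩
  have h1 : ∀ y, -(H x y * ψ y / ψ x) * P - (if H x y ≠ 0 then 1 else 0) ≤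
      (drift H ψ P x y : ℝ) := by
    intro y
    by_cases hy : H x y = 0
    · simp [hy, drift]
    · rw [if_pos hy]
      exact (Int.sub_one_lt_floor _).le
  have h2 := Finset.sum_le_sum fun y (_ : y ∈ Finset.univ) => h1 y
  rw [Finset.sum_sub_distrib, ← Finset.sum_mul, Finset.sum_boole, Finset.sum_neg_distrib,
    ← Finset.sum_div] at h2
  have h3 : ((Finset.univ.filter fun y => H x y ≠ 0).card : ℝ) ≤ s := by
    rw [← Set.ncard_coe_finset]
    simpa using hs
  have h4 : ∑ y, H x y * ψ y = 0 := congrFun hker x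
  rw [h4] at h2
  have h5 : -(s : ℝ) ≤ ∑ y, (drift H ψ P x y : ℝ) := by
    simp only [zero_div, neg_zero, zero_mul] at h2
    linarith
  exact_mod_cast h5

/-- If `ψ` is in the kernel of `H`, the fixed-node walk survives from some point. -/
theorem exists_half_le_survive (hH : H.IsSymm) (hs : 64 ≤ s)
    (hsp : ∀ x, {y | H x y ≠ 0}.ncard ≤ s) (hHb : ∀ x y, |H x y| ≤ s)
    (hker : H *ᵥ ψ = 0) (hψ : ψ ≠ 0) (hP : P = 2 ^ s ^ 2) :
    ∃ x, 1 / 2 ≤ survive (IsGood H ψ P s) (fun x y => (seeds H ψ P s x y : ℝ) / P)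
      (hold H ψ P s (s ^ 3)) (s ^ 6) (s ^ 6) x 0 := by
  have hP0 : 0 < P := by rw [hP]; positivity
  have hP' : (0 : ℝ) < P := by exact_mod_cast hP0
  have hs0 : (64 : ℝ) ≤ s := by exact_mod_cast hs
  have hPs : (s : ℝ) ^ 8 ≤ P := by rw [hP]; exact_mod_cast pow_le_two_pow_sq hs
  set D : ι → ℝ := fun x => ∑ y, max (-(H x y * ψ y / ψ x)) 0 with hD
  have hD0 : ∀ x, 0 ≤ D x := rate_nonneg
  have hD1 : ∀ x, 0 < 1 + D x := fun x => by linarith [hD0 x]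
  -- The jump chain of the unrounded walk.
  set K : ι → ι → ℝ := fun x y =>
    ((if x = y then 1 else 0) + max (-(H x y * ψ y / ψ x)) 0) / (1 + D x) with hK
  set h := hold H ψ P s (s ^ 3) with hh
  have hnum : ∀ x y, 0 ≤ (if x = y then (1 : ℝ) else 0) + max (-(H x y * ψ y / ψ x)) 0 := by
    intro x y
    have := le_max_right (-(H x y * ψ y / ψ x)) 0
    split_ifs <;> linarith
  have hK0 : ∀ x y, 0 ≤ K x y := fun x y => div_nonneg (hnum x y) (hD1 x).le
  have hK1 : ∀ x, ∑ y, K x y = 1 := by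
    intro x
    simp only [hK]
    rw [← Finset.sum_div, Finset.sum_add_distrib, Finset.sum_ite_eq, if_pos (Finset.mem_univ x)]
    exact div_self (hD1 x).ne'
  have hp : ∀ x y, 0 ≤ (seeds H ψ P s x y : ℝ) / P := fun x y =>
    div_nonneg (by exact_mod_cast seeds_nonneg hP0 x y) hP'.le
  have hpK : ∀ x y, (seeds H ψ P s x y : ℝ) / P ≤ K x y := by
    intro x y
    rw [le_div_iff₀ (hD1 x), mul_comm]
    exact (mul_le_mul_of_nonneg_right (one_add_le_totalRate (hsp x) hP0) (hp x y)).trans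
      (seeds_mul_le hP0 x y)
  -- The continuous-time walk is reversible for `ψ ^ 2`; its jump chain carries the extra factor of
  -- the jump rate.
  set ν : ι → ℝ := fun x => ψ x ^ 2 * (1 + D x) with hν
  have hν0 : ∀ x, 0 ≤ ν x := fun x => mul_nonneg (sq_nonneg _) (hD1 x).le
  have hrev : ∀ x y, ν x * K x y = |ψ x| * (fixedNode H ψ x y * |ψ y|) := by
    intro x y
    have h1 := abs_mul_rate (H := H) (ψ := ψ) x y
    have h2 : ν x * K x y = |ψ x| *
        (|ψ x| * ((if x = y then 1 else 0) + max (-(H x y * ψ y / ψ x)) 0)) := by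
      simp only [hν, hK]
      rw [mul_assoc, mul_div_cancel₀ _ (hD1 x).ne', ← sq_abs]; ring
    rw [h2, h1]
    split_ifs with hx
    · simp [hx]
    · rfl
  have hstat : ∀ y, ∑ x, ν x * K x y = ν y := by
    intro y
    have h1 : ∀ x, ν x * K x y = ν y * K y x := by
      intro x
      rw [hrev, hrev, fixedNode_symm hH x y]; ring
    simp only [h1, ← Finset.mul_sum, hK1, mul_one]
  -- The rate may be huge at single points, but its `ψ ^ 2`-mean is polynomial: `ψ x` cancels in the
  -- denominator, and sparsity and the entry bound give `s` each.
  have hνsum : ∑ x, ν x ≤ (1 + (s : ℝ) ^ 2) * ∑ x, ψ x ^ 2 := by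
    have h1 : ∀ x y, ψ x ^ 2 * max (-(H x y * ψ y / ψ x)) 0 ≤
        (s : ℝ) / 2 * ((if H x y ≠ 0 then 1 else 0) * ψ x ^ 2) +
        (s : ℝ) / 2 * ((if H y x ≠ 0 then 1 else 0) * ψ y ^ 2) := by
      intro x y
      rcases eq_or_ne (H x y) 0 with hxy | hxy
      · simp [hxy, hH.apply x y]
      rw [hH.apply x y, if_pos hxy, one_mul, one_mul, mul_max_of_nonneg _ _ (sq_nonneg _), mul_zero]
      refine max_le ?_ (by positivity)
      have h2 : ψ x ^ 2 * -(H x y * ψ y / ψ x) = -(H x y * (ψ x * ψ y)) := by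
        rcases eq_or_ne (ψ x) 0 with hx | hx
        · simp [hx]
        · field_simp
      rw [h2]
      have h3 : -(H x y * (ψ x * ψ y)) ≤ s * (|ψ x| * |ψ y|) := by
        refine (neg_le_abs _).trans ?_
        rw [abs_mul, abs_mul]
        exact mul_le_mul_of_nonneg_right (hHb x y) (by positivity)
      have h4 : |ψ x| * |ψ y| ≤ (ψ x ^ 2 + ψ y ^ 2) / 2 := by
        have := sq_nonneg (|ψ x| - |ψ y|)
        rw [← sq_abs (ψ x), ← sq_abs (ψ y)]; linarith
      have h5 := mul_le_mul_of_nonneg_left h4 (show (0 : ℝ) ≤ s by positivity)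
      linarith
    have h6 : ∑ x, ∑ y, (if H x y ≠ 0 then (1 : ℝ) else 0) * ψ x ^ 2 ≤ s * ∑ x, ψ x ^ 2 := by
      rw [Finset.mul_sum]
      refine Finset.sum_le_sum fun x _ => ?_
      rw [← Finset.sum_mul, Finset.sum_boole]
      refine mul_le_mul_of_nonneg_right ?_ (sq_nonneg _)
      rw [← Set.ncard_coe_finset]
      simpa using hsp x
    have h7 : ∑ x, ∑ y, (if H y x ≠ 0 then (1 : ℝ) else 0) * ψ y ^ 2 =
        ∑ x, ∑ y, (if H x y ≠ 0 then (1 : ℝ) else 0) * ψ x ^ 2 := Finset.sum_comm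
    have h8 : ∑ x, ψ x ^ 2 * D x ≤ s * (s * ∑ x, ψ x ^ 2) := by
      simp only [hD, Finset.mul_sum (s := Finset.univ) (f := fun y => max (-(H _ y * ψ y / ψ _)) 0)]
      refine (Finset.sum_le_sum fun x _ => Finset.sum_le_sum fun y _ => h1 x y).trans ?_
      simp only [Finset.sum_add_distrib, ← Finset.mul_sum, h7]
      have := mul_le_mul_of_nonneg_left h6 (show (0 : ℝ) ≤ s by positivity)
      linarith
    simp only [hν, mul_add, mul_one, Finset.sum_add_distrib]
    linarith
  -- One unit is lost to the floor, another to the slack in the total rate.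
  have hhold : ∀ x, (s : ℝ) ^ 3 / (1 + D x) ≤ h x + 2 := by
    intro x
    have hT := totalRate_pos (H := H) (ψ := ψ) (s := s) hP0 x
    have h1 := lt_cast_ediv_add_one ((s : ℤ) ^ 3 * P) hT
    have h2 : ((s : ℤ) ^ 3 * P / totalRate H ψ P s x : ℤ) = h x := rfl
    rw [h2] at h1
    have hW : 0 < (totalRate H ψ P s x : ℝ) / P := div_pos (by exact_mod_cast hT) hP'
    have h3 : ((((s : ℤ) ^ 3 * P : ℤ)) : ℝ) / totalRate H ψ P s x =
        s ^ 3 / ((totalRate H ψ P s x : ℝ) / P) := by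
      push_cast; rw [div_div_eq_mul_div]
    rw [h3] at h1
    have h4 := totalRate_le (H := H) (ψ := ψ) (s := s) hP0 x
    have h5 := one_add_le_totalRate (ψ := ψ) (hsp x) hP0
    set W := (totalRate H ψ P s x : ℝ) / P
    have h6 : (s : ℝ) ^ 3 / (1 + D x) - s ^ 3 / W ≤ 1 := by
      rw [div_sub_div _ _ (hD1 x).ne' hW.ne', div_le_one (mul_pos (hD1 x) hW)]
      have h7 : (s : ℝ) ^ 3 * (W - (1 + D x)) ≤ s ^ 3 * (2 * s / P) :=
        mul_le_mul_of_nonneg_left (by linarith) (by positivity)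
      have h8 : (s : ℝ) ^ 3 * (2 * s / P) ≤ 1 := by
        rw [← mul_div_assoc, div_le_one hP']
        refine le_trans ?_ hPs
        have h9 : (64 : ℝ) ^ 4 ≤ s ^ 4 := pow_le_pow_left₀ (by norm_num) hs0 4
        nlinarith [pow_pos (show (0 : ℝ) < s by linarith) 4]
      have h10 : 1 * 1 ≤ (1 + D x) * W :=
        mul_le_mul (by linarith [hD0 x]) (by linarith [hD0 x]) zero_le_one (hD1 x).le
      linarith
    linarith
  set V := expect K h (below (s ^ 6)) (s ^ 6) with hV
  have hV0 : ∀ x, 0 ≤ V x 0 := by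
    intro x
    rw [← expect_const (h := h) hK1 (0 : ℝ) (s ^ 6) x 0]
    refine expect_mono hK0 (fun a => ?_) _ _ _
    rw [below]; split_ifs <;> norm_num
  have hV1 : ∀ x, V x 0 ≤ 1 := by
    intro x
    rw [← expect_const (h := h) hK1 (1 : ℝ) (s ^ 6) x 0]
    refine expect_mono hK0 (fun a => ?_) _ _ _
    rw [below]; split_ifs <;> norm_num
  have hrenew := sum_mul_expect_below_le (h := h) (N := s ^ 6) hK0 hK1
    (fun x => hold_nonneg hP0 (by positivity) x) hν0 hstat (by positivity) (s ^ 6)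
  push_cast at hrenew
  -- The number of steps equals the credit threshold, so they cancel.
  have hrenew' : ∑ x, ν x * (h x * V x 0) ≤ ∑ x, ν x :=
    le_of_mul_le_mul_left hrenew (by positivity)
  have hmean : (s : ℝ) ^ 3 * ∑ x, ψ x ^ 2 * V x 0 ≤ 3 * ∑ x, ν x := by
    have h1 : ∀ x, (s : ℝ) ^ 3 * (ψ x ^ 2 * V x 0) ≤ ν x * (h x * V x 0) + 2 * ν x := by
      intro x
      have h2 : (s : ℝ) ^ 3 * (ψ x ^ 2 * V x 0) = ν x * (s ^ 3 / (1 + D x) * V x 0) := by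
        simp only [hν]
        have := (hD1 x).ne'
        field_simp
      rw [h2]
      have h3 : (s : ℝ) ^ 3 / (1 + D x) * V x 0 ≤ h x * V x 0 + 2 := by
        have := mul_le_mul_of_nonneg_right (hhold x) (hV0 x)
        linarith [hV1 x]
      have := mul_le_mul_of_nonneg_left h3 (hν0 x)
      linarith
    rw [Finset.mul_sum]
    refine (Finset.sum_le_sum fun x _ => h1 x).trans ?_
    rw [Finset.sum_add_distrib, ← Finset.mul_sum]
    linarith
  obtain ⟨x₀, hx₀⟩ : ∃ x, ψ x ≠ 0 := Function.ne_iff.1 hψ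
  -- The `ψ ^ 2`-mean of `V` is at most `3 (1 + s ^ 2) / s ^ 3`, which is at most `1 / 4` for `s ≥
  -- 64`.
  obtain ⟨x, hx, hVx⟩ : ∃ x, ψ x ≠ 0 ∧ V x 0 ≤ 1 / 4 := by
    by_contra! hcon
    have h1 : ∑ x, ψ x ^ 2 * (1 / 4) < ∑ x, ψ x ^ 2 * V x 0 := by
      refine Finset.sum_lt_sum (fun x _ => ?_) ⟨x₀, Finset.mem_univ _, ?_⟩
      · rcases eq_or_ne (ψ x) 0 with hx | hx
        · simp [hx]
        · exact mul_le_mul_of_nonneg_left (hcon x hx).le (sq_nonneg _)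
      · exact mul_lt_mul_of_pos_left (hcon x₀ hx₀) (by positivity)
    rw [← Finset.sum_mul] at h1
    have h2 : 0 < ∑ x, ψ x ^ 2 :=
      Finset.sum_pos' (fun x _ => sq_nonneg _) ⟨x₀, Finset.mem_univ _, by positivity⟩
    have h3 : (s : ℝ) ^ 3 * ((∑ x, ψ x ^ 2) * (1 / 4)) < s ^ 3 * ∑ x, ψ x ^ 2 * V x 0 :=
      mul_lt_mul_of_pos_left h1 (by positivity)
    have h4 : 12 * (1 + (s : ℝ) ^ 2) ≤ s ^ 3 := by nlinarith
    have h5 := mul_le_mul_of_nonneg_right h4 h2.le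
    linarith
  refine ⟨x, ?_⟩
  have hfin := le_survive (S := fun x => ψ x ≠ 0) (good := IsGood H ψ P s) (K := K)
    (p := fun x y => (seeds H ψ P s x y : ℝ) / P) (h := h) (N := s ^ 6)
    (ε := (3 * s + 1) / P) (by positivity) hp (fun x y _ => hpK x y) hK1
    (fun x _ => one_sub_le_sum_seeds (hsp x) hP0)
    (fun x y hx hy => by
      have hy' : ψ y = 0 := not_not.1 hy
      have hxy : x ≠ y := fun h => hx (h ▸ hy')
      simp [seeds, drift, hy', hxy])
    hK0 (fun x hx => isGood_of_mulVec_eq_zero (hsp x) hker hx) (s ^ 6) x hx 0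
  -- The total rounding loss over all steps is negligible because `P ≥ s ^ 8`.
  have hε : ((s ^ 6 : ℕ) : ℝ) * ((3 * s + 1) / P) ≤ 1 / 4 := by
    rw [← mul_div_assoc, div_le_iff₀ hP']
    push_cast
    have h6 : (0 : ℝ) < s ^ 6 := by positivity
    have h7 : 3 * (s : ℝ) + 1 ≤ 1 / 4 * s ^ 2 := by nlinarith
    have h8 := mul_le_mul_of_nonneg_left h7 h6.le
    linarith
  have h9 : expect K h (below (s ^ 6)) (s ^ 6) x 0 ≤ 1 / 4 := hVx
  linarith

end FixedNodeBounds

/-! ## Semantics of deterministic programs -/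

namespace Program

variable {n : ℕ}

/-- The program makes no random choices. -/
def CoinFree : Program → Prop
  | seq P Q => P.CoinFree ∧ Q.CoinFree
  | ifLe _ _ P Q => P.CoinFree ∧ Q.CoinFree
  | loop _ P => P.CoinFree
  | coins _ _ => False
  | exponential _ _ _ _ _ => False
  | _ => True

/-- The effect of a deterministic program on the registers. -/
def ev (O : Oracle n) : Program → (ℕ → ℤ) → ℕ → ℤ
  | const dst v, σ => Function.update σ dst v
  | add dst a b, σ => Function.update σ dst (σ a + σ b)
  | sub dst a b, σ => Function.update σ dst (σ a - σ b)
  | mul dst a b, σ => Function.update σ dst (σ a * σ b)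
  | div dst a b, σ => Function.update σ dst (σ a / σ b)
  | seq P Q, σ => ev O Q (ev O P σ)
  | ifLe a b P Q, σ => if σ a ≤ σ b then ev O P σ else ev O Q σ
  | loop a P, σ => (ev O P)^[(σ a).toNat] σ
  | entry num den x y, σ =>
      Function.update (Function.update σ num (O.entryAt (σ x) (σ y)).1) den
        (O.entryAt (σ x) (σ y)).2
  | row dst x j, σ => Function.update σ dst (O.rowAt (σ x) (σ j))
  | col dst y j, σ => Function.update σ dst (O.colAt (σ y) (σ j))
  | amp num den x, σ =>
      Function.update (Function.update σ num (O.ampAt (σ x)).1) den (O.ampAt (σ x)).2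
  | _, σ => σ

/-- No instruction looks at the time or at the query count, so correctness can be argued on stores
alone. -/
theorem CoinFree.run_eq (O : Oracle n) {P : Program} (hP : P.CoinFree) (c : Config) :
    ∃ c', run O P c = PMF.pure c' ∧ c'.store = ev O P c.store := by
  induction P generalizing c with
  | skip => exact ⟨_, rfl, rfl⟩
  | const => exact ⟨_, rfl, rfl⟩
  | add => exact ⟨_, rfl, rfl⟩
  | sub => exact ⟨_, rfl, rfl⟩
  | mul => exact ⟨_, rfl, rfl⟩
  | div => exact ⟨_, rfl, rfl⟩
  | entry => exact ⟨_, rfl, rfl⟩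
  | row => exact ⟨_, rfl, rfl⟩
  | col => exact ⟨_, rfl, rfl⟩
  | amp => exact ⟨_, rfl, rfl⟩
  | coins => exact hP.elim
  | exponential => exact hP.elim
  | seq P Q ihP ihQ =>
    obtain ⟨c₁, h₁, h₁'⟩ := ihP hP.1 c
    obtain ⟨c₂, h₂, h₂'⟩ := ihQ hP.2 c₁
    exact ⟨c₂, by rw [run, h₁, PMF.pure_bind, h₂], by rw [h₂', h₁', ev]⟩
  | ifLe a b P Q ihP ihQ =>
    by_cases hab : c.store a ≤ c.store b
    · obtain ⟨c', h, h'⟩ := ihP hP.1 (c.pay (bits (c.store a) + bits (c.store b)))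
      exact ⟨c', by rw [run, if_pos hab, h], by rw [h', ev, if_pos hab]; rfl⟩
    · obtain ⟨c', h, h'⟩ := ihQ hP.2 (c.pay (bits (c.store a) + bits (c.store b)))
      exact ⟨c', by rw [run, if_neg hab, h], by rw [h', ev, if_neg hab]; rfl⟩
  | loop a P ih =>
    rw [run, ev]
    generalize (c.store a).toNat = k
    induction k with
    | zero => exact ⟨_, rfl, rfl⟩
    | succ k ihk =>
      obtain ⟨c₁, h₁, h₁'⟩ := ihk
      obtain ⟨c₂, h₂, h₂'⟩ := ih hP (c₁.pay (bits (c.store a)))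
      refine ⟨c₂, ?_, ?_⟩
      · rw [Function.iterate_succ_apply', h₁, PMF.pure_bind, h₂]
      · rw [h₂', Function.iterate_succ_apply', ← h₁']; rfl

/-- Lets an induction condition on the first iteration of a loop, whose semantics appends iterations
at the end. -/
theorem iterate_bind {α : Type} (f : α → PMF α) (k : ℕ) (μ : PMF α) :
    (fun μ : PMF α => μ.bind f)^[k] μ =
      μ.bind fun c => (fun μ : PMF α => μ.bind f)^[k] (PMF.pure c) := by
  induction k generalizing μ with
  | zero => exact (PMF.bind_pure μ).symm
  | succ k ih =>
    simp only [Function.iterate_succ_apply]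
    rw [ih, PMF.bind_bind]
    congr 1
    funext c
    rw [PMF.pure_bind, ← ih]

end Program

/-! ## Bounds on the resources -/

/-- Bounds on the contents of registers. A register `r` outside `acc` never exceeds `β r`, while
the number of bits of a register in `acc` grows by at most `g` in each instruction. -/
structure Typing where
  /-- the bounds -/
  β : ℕ → ℕ
  /-- the registers that may grow -/
  acc : Finset ℕ
  /-- the number of bits at the beginning -/
  E : ℕ
  /-- the number of bits that may be gained in an instruction -/
  g : ℕ

namespace Typing

/-- The bound on register `r` after `τ` instructions. -/
def lim (t : Typing) (τ r : ℕ) : ℕ := if r ∈ t.acc then 2 ^ (t.E + t.g * τ) else t.β r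

/-- All registers obey their bounds. -/
def Inv (t : Typing) (τ : ℕ) (σ : ℕ → ℤ) : Prop := ∀ r, (σ r).natAbs ≤ t.lim τ r

/-- A bound on the number of instructions. -/
def steps (t : Typing) : Program → ℕ
  | .seq P Q => t.steps P + t.steps Q
  | .ifLe _ _ P Q => 1 + (t.steps P + t.steps Q)
  | .loop a P => 1 + t.β a * (1 + t.steps P)
  | _ => 1

/-- The instructions of the program respect the bounds, for indices with `n` bits and fractions
with `p` bits. -/
def Fits (t : Typing) (n p : ℕ) : Program → Prop
  | .skip => True
  | .const dst v => v.natAbs ≤ t.β dst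
  | .add dst a b => dst ∈ t.acc ∨ (a ∉ t.acc ∧ b ∉ t.acc ∧ t.β a + t.β b ≤ t.β dst)
  | .sub dst a b => dst ∈ t.acc ∨ (a ∉ t.acc ∧ b ∉ t.acc ∧ t.β a + t.β b ≤ t.β dst)
  | .mul dst a b => (dst ∈ t.acc ∧ b ∉ t.acc ∧ t.β b ≤ 2 ^ t.g) ∨
      (a ∉ t.acc ∧ b ∉ t.acc ∧ t.β a * t.β b ≤ t.β dst)
  | .div dst a _ => a ∉ t.acc ∧ t.β a ≤ t.β dst
  | .seq P Q => t.Fits n p P ∧ t.Fits n p Q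
  | .ifLe _ _ P Q => t.Fits n p P ∧ t.Fits n p Q
  | .loop a P => a ∉ t.acc ∧ t.Fits n p P
  | .entry num den _ _ => 2 ^ p ≤ t.β num ∧ 2 ^ p ≤ t.β den
  | .row dst _ _ => 2 ^ n ≤ t.β dst
  | .col dst _ _ => 2 ^ n ≤ t.β dst
  | .amp num den _ => 2 ^ p ≤ t.β num ∧ 2 ^ p ≤ t.β den
  | .coins dst k => k ∉ t.acc ∧ 2 ^ t.β k ≤ t.β dst
  | .exponential _ _ _ _ _ => False

/-- The registers bound is consistent. -/
structure Valid (t : Typing) : Prop where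
  le : ∀ r, t.β r ≤ 2 ^ t.E
  pos : 1 ≤ t.g

variable {t : Typing}

theorem Valid.lim_le (ht : t.Valid) (τ r : ℕ) : t.lim τ r ≤ 2 ^ (t.E + t.g * τ) := by
  rw [lim]
  split_ifs
  · exact le_rfl
  · exact (ht.le r).trans (Nat.pow_le_pow_right two_pos (Nat.le_add_right _ _))

theorem Valid.β_le_lim (ht : t.Valid) (τ r : ℕ) : t.β r ≤ t.lim τ r := by
  rw [lim]
  split_ifs
  · exact (ht.le r).trans (Nat.pow_le_pow_right two_pos (Nat.le_add_right _ _))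
  · exact le_rfl

theorem lim_mono {τ τ' : ℕ} (h : τ ≤ τ') (r : ℕ) : t.lim τ r ≤ t.lim τ' r := by
  rw [lim, lim]
  split_ifs
  · exact Nat.pow_le_pow_right two_pos (by gcongr)
  · exact le_rfl

theorem Inv.mono {τ τ' : ℕ} {σ : ℕ → ℤ} (hσ : t.Inv τ σ) (h : τ ≤ τ') : t.Inv τ' σ :=
  fun r => (hσ r).trans (lim_mono h r)

theorem Inv.update {τ : ℕ} {σ : ℕ → ℤ} (hσ : t.Inv τ σ) {r : ℕ} {v : ℤ}
    (hv : v.natAbs ≤ t.lim τ r) : t.Inv τ (Function.update σ r v) := by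
  intro q
  rcases eq_or_ne q r with rfl | hq
  · rwa [Function.update_self]
  · rw [Function.update_of_ne hq]; exact hσ q

theorem Inv.le_β {τ : ℕ} {σ : ℕ → ℤ} (hσ : t.Inv τ σ) {r : ℕ} (hr : r ∉ t.acc) :
    (σ r).natAbs ≤ t.β r := by
  have := hσ r
  rwa [lim, if_neg hr] at this

theorem bits_le {z : ℤ} {L : ℕ} (h : z.natAbs ≤ 2 ^ L) : bits z ≤ L + 1 :=
  Nat.size_le.2 (h.trans_lt (Nat.pow_lt_pow_right one_lt_two (Nat.lt_succ_self L)))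

theorem Valid.bits_le_of_le_lim (ht : t.Valid) {τ L r : ℕ} (hL : t.E + t.g * τ ≤ L) {z : ℤ}
    (hz : z.natAbs ≤ t.lim τ r) : bits z ≤ L + 1 :=
  bits_le ((hz.trans (ht.lim_le τ r)).trans (Nat.pow_le_pow_right two_pos hL))

/-- The largest cost of an instruction on registers with `L` bits. -/
def cost (L : ℕ) : ℕ := (4 * L + 5) ^ 2

theorem pay_le {m L : ℕ} (h : m ≤ 4 * L + 4) : (m + 1) ^ 2 ≤ cost L :=
  Nat.pow_le_pow_left (by omega) 2

/-- What a run of a program that respects the bounds may lead to. -/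
def Within (t : Typing) (τ k L : ℕ) (c c' : Config) : Prop :=
  t.Inv (τ + k) c'.store ∧ c'.time ≤ c.time + k * cost L ∧ c'.queries ≤ c.queries + k

theorem Valid.arith_within (ht : t.Valid) {τ L dst a b : ℕ} {op : ℤ → ℤ → ℤ} {c : Config}
    (hL : t.E + t.g * (τ + 1) ≤ L) (hc : t.Inv τ c.store)
    (hop : (op (c.store a) (c.store b)).natAbs ≤ t.lim (τ + 1) dst) :
    t.Within τ 1 L c (c.arith dst a b op) := by
  have hc' := hc.mono (Nat.le_add_right τ 1)
  refine ⟨hc'.update hop, ?_, Nat.le_add_right _ _⟩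
  rw [one_mul]
  refine Nat.add_le_add_left (pay_le ?_) _
  have h1 := ht.bits_le_of_le_lim hL (hc' a)
  have h2 := ht.bits_le_of_le_lim hL (hc' b)
  have h3 := ht.bits_le_of_le_lim hL hop
  omega

/-- A sum gains at most one bit, which `1 ≤ t.g` pays for. -/
theorem Valid.add_le (ht : t.Valid) {τ dst a b : ℕ} {σ : ℕ → ℤ} (hσ : t.Inv τ σ) {v : ℤ}
    (hv : v.natAbs ≤ (σ a).natAbs + (σ b).natAbs)
    (h : dst ∈ t.acc ∨ (a ∉ t.acc ∧ b ∉ t.acc ∧ t.β a + t.β b ≤ t.β dst)) :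
    v.natAbs ≤ t.lim (τ + 1) dst := by
  rcases h with h | ⟨ha, hb, h⟩
  · have h1 := (hσ a).trans (ht.lim_le τ a)
    have h2 := (hσ b).trans (ht.lim_le τ b)
    have h3 : 2 ^ (t.E + t.g * τ + 1) ≤ 2 ^ (t.E + t.g * (τ + 1)) :=
      Nat.pow_le_pow_right two_pos (by have := ht.pos; rw [mul_add]; omega)
    rw [lim, if_pos h]
    rw [pow_succ] at h3
    omega
  · have h1 := hσ.le_β ha
    have h2 := hσ.le_β hb
    have h3 := ht.β_le_lim (τ + 1) dst
    omega

/-- The answers to all queries have `p`-bit numerators and denominators. -/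
def Small {n : ℕ} (O : Oracle n) (p : ℕ) : Prop :=
  (∀ x y, (O.entryAt x y).1.natAbs ≤ 2 ^ p ∧ (O.entryAt x y).2.natAbs ≤ 2 ^ p) ∧
    ∀ x, (O.ampAt x).1.natAbs ≤ 2 ^ p ∧ (O.ampAt x).2.natAbs ≤ 2 ^ p

theorem natAbs_nth_le {n : ℕ} (l : List (Fin (2 ^ n))) (j : ℤ) :
    (Oracle.nth l j).natAbs ≤ 2 ^ n := by
  have h1 := Nat.one_le_two_pow (n := n)
  rw [Oracle.nth]
  split_ifs
  · split
    · rename_i i _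
      have := i.2
      omega
    · simpa using h1
  · simpa using h1

theorem natAbs_rowAt_le {n : ℕ} (O : Oracle n) (x j : ℤ) : (O.rowAt x j).natAbs ≤ 2 ^ n := by
  rw [Oracle.rowAt]
  split
  · exact natAbs_nth_le _ _
  · simpa using Nat.one_le_two_pow (n := n)

theorem natAbs_colAt_le {n : ℕ} (O : Oracle n) (x j : ℤ) : (O.colAt x j).natAbs ≤ 2 ^ n := by
  rw [Oracle.colAt]
  split
  · exact natAbs_nth_le _ _
  · simpa using Nat.one_le_two_pow (n := n)

/-- A program that respects the bounds makes at most `steps` instructions, which cost at most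
`cost L` each. -/
theorem Valid.within (ht : t.Valid) {n p : ℕ} {O : Oracle n} (hO : Small O p) {P : Program}
    (hP : t.Fits n p P) {τ L : ℕ} (hL : t.E + t.g * (τ + t.steps P) ≤ L) {c : Config}
    (hc : t.Inv τ c.store) {c' : Config} (h : c' ∈ (P.run O c).support) :
    t.Within τ (t.steps P) L c c' := by
  induction P generalizing τ c c' with
  | skip =>
    rw [Program.run, PMF.mem_support_pure_iff] at h
    subst h
    refine ⟨hc.mono (Nat.le_add_right _ _), ?_, Nat.le_add_right _ _⟩
    simp only [steps, one_mul]
    exact Nat.add_le_add_left (pay_le (by omega)) _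
  | const dst v =>
    rw [Program.run, PMF.mem_support_pure_iff] at h
    subst h
    have hv := (show v.natAbs ≤ t.β dst from hP).trans (ht.β_le_lim (τ + 1) dst)
    refine ⟨(hc.mono (Nat.le_add_right _ _)).update hv, ?_, Nat.le_add_right _ _⟩
    simp only [steps, one_mul]
    refine Nat.add_le_add_left (pay_le ?_) _
    have := ht.bits_le_of_le_lim hL hv
    omega
  | add dst a b =>
    rw [Program.run, PMF.mem_support_pure_iff] at h
    subst h
    exact ht.arith_within hL hc (ht.add_le hc (Int.natAbs_add_le _ _) hP)
  | sub dst a b =>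
    rw [Program.run, PMF.mem_support_pure_iff] at h
    subst h
    exact ht.arith_within hL hc (ht.add_le hc (by omega) hP)
  | mul dst a b =>
    rw [Program.run, PMF.mem_support_pure_iff] at h
    subst h
    refine ht.arith_within hL hc ?_
    rw [Int.natAbs_mul]
    rcases hP with ⟨hdst, hb, hg⟩ | ⟨ha, hb, hab⟩
    · rw [lim, if_pos hdst, mul_add, mul_one, ← add_assoc, pow_add]
      exact Nat.mul_le_mul ((hc a).trans (ht.lim_le τ a)) ((hc.le_β hb).trans hg)
    · exact (Nat.mul_le_mul (hc.le_β ha) (hc.le_β hb)).trans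
        (hab.trans (ht.β_le_lim (τ + 1) dst))
  | div dst a b =>
    rw [Program.run, PMF.mem_support_pure_iff] at h
    subst h
    -- A quotient is no larger than its numerator, so the divisor may be an accumulator.
    exact ht.arith_within hL hc ((Int.natAbs_ediv_le_natAbs _ _).trans
      ((hc.le_β hP.1).trans (hP.2.trans (ht.β_le_lim (τ + 1) dst))))
  | seq P Q ihP ihQ =>
    rw [Program.run, PMF.mem_support_bind_iff] at h
    obtain ⟨c₁, h₁, h₂⟩ := h
    rw [steps] at hL ⊢
    have hL₁ : t.E + t.g * (τ + t.steps P) ≤ L :=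
      le_trans (by gcongr; omega) hL
    obtain ⟨a₁, b₁, d₁⟩ := ihP hP.1 hL₁ hc h₁
    obtain ⟨a₂, b₂, d₂⟩ := ihQ hP.2 (by rwa [add_assoc]) a₁ h₂
    rw [add_assoc] at a₂
    refine ⟨a₂, ?_, by omega⟩
    rw [add_mul]; omega
  | ifLe a b P Q ihP ihQ =>
    rw [Program.run] at h
    rw [steps] at hL ⊢
    have hτ : t.E + t.g * τ ≤ L := le_trans (by gcongr; omega) hL
    have hpay : (bits (c.store a) + bits (c.store b) + 1) ^ 2 ≤ cost L := by
      refine pay_le ?_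
      have h1 := ht.bits_le_of_le_lim hτ (hc a)
      have h2 := ht.bits_le_of_le_lim hτ (hc b)
      omega
    split_ifs at h
    · obtain ⟨a₁, b₁, d₁⟩ := ihP hP.1 (le_trans (by gcongr; omega) hL) (by exact hc) h
      refine ⟨a₁.mono (by omega), ?_, ?_⟩
      · simp only [Config.pay] at b₁
        rw [add_mul, add_mul]; omega
      · simp only [Config.pay] at d₁; omega
    · obtain ⟨a₁, b₁, d₁⟩ := ihQ hP.2 (le_trans (by gcongr; omega) hL) (by exact hc) h
      refine ⟨a₁.mono (by omega), ?_, ?_⟩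
      · simp only [Config.pay] at b₁
        rw [add_mul, add_mul]; omega
      · simp only [Config.pay] at d₁; omega
  | loop a P ih =>
    rw [Program.run] at h
    rw [steps] at hL ⊢
    have hpay : (bits (c.store a) + 1) ^ 2 ≤ cost L := by
      refine pay_le ?_
      have h1 := ht.bits_le_of_le_lim (le_trans (by gcongr; omega) hL) (hc a)
      omega
    have hk : (c.store a).toNat ≤ t.β a := le_trans (by omega) (hc.le_β hP.1)
    -- The loop register is not an accumulator, so its static bound limits the iterations;
    -- accumulators grow with their number.
    suffices H : ∀ k ≤ t.β a, ∀ c' ∈ ((fun μ : PMF Config =>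
        μ.bind fun c' => Program.run O P (c'.pay (bits (c.store a))))^[k]
          (PMF.pure (c.pay (bits (c.store a))))).support,
        t.Within τ (1 + k * (1 + t.steps P)) L c c' by
      obtain ⟨a₁, b₁, d₁⟩ := H _ hk _ h
      have hle : 1 + (c.store a).toNat * (1 + t.steps P) ≤ 1 + t.β a * (1 + t.steps P) := by
        gcongr
      exact ⟨a₁.mono (by omega), b₁.trans (by gcongr), by omega⟩
    intro k
    induction k with
    | zero =>
      intro _ c' h'
      rw [Function.iterate_zero, id, PMF.mem_support_pure_iff] at h'
      subst h'
      refine ⟨hc.mono (by omega), ?_, by simp only [Config.pay]; omega⟩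
      simp only [Config.pay, zero_mul, add_zero, one_mul]
      omega
    | succ k ihk =>
      intro hk' c' h'
      rw [Function.iterate_succ_apply', PMF.mem_support_bind_iff] at h'
      obtain ⟨c₁, h₁, h₂⟩ := h'
      obtain ⟨a₁, b₁, d₁⟩ := ihk (by omega) c₁ h₁
      have hle : (k + 1) * (1 + t.steps P) ≤ t.β a * (1 + t.steps P) := by gcongr
      have hkk : (k + 1) * (1 + t.steps P) = k * (1 + t.steps P) + (1 + t.steps P) := by ring
      obtain ⟨a₂, b₂, d₂⟩ := ih hP.2 (τ := τ + (1 + k * (1 + t.steps P)))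
        (le_trans (Nat.add_le_add_left (Nat.mul_le_mul_left _ (by omega)) _) hL) (by exact a₁) h₂
      simp only [Config.pay] at d₂
      refine ⟨a₂.mono (by omega), ?_, ?_⟩
      · simp only [Config.pay] at b₂
        have : (1 + (k + 1) * (1 + t.steps P)) * cost L =
            (1 + k * (1 + t.steps P)) * cost L + (cost L + t.steps P * cost L) := by ring
        omega
      · linarith
  | entry num den x y =>
    rw [Program.run, PMF.mem_support_pure_iff] at h
    subst h
    have hc' := hc.mono (Nat.le_add_right τ 1)
    obtain ⟨h1, h2⟩ := hO.1 (c.store x) (c.store y)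
    have h1' := h1.trans (hP.1.trans (ht.β_le_lim (τ + 1) num))
    have h2' := h2.trans (hP.2.trans (ht.β_le_lim (τ + 1) den))
    refine ⟨(hc'.update h1').update h2', ?_, le_rfl⟩
    simp only [steps, one_mul]
    refine Nat.add_le_add_left (pay_le ?_) _
    have := ht.bits_le_of_le_lim hL h1'
    have := ht.bits_le_of_le_lim hL h2'
    have := ht.bits_le_of_le_lim hL (hc' x)
    have := ht.bits_le_of_le_lim hL (hc' y)
    omega
  | row dst x j =>
    rw [Program.run, PMF.mem_support_pure_iff] at h
    subst h
    have hc' := hc.mono (Nat.le_add_right τ 1)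
    have h1 := (natAbs_rowAt_le O (c.store x) (c.store j)).trans
      ((show 2 ^ n ≤ t.β dst from hP).trans (ht.β_le_lim (τ + 1) dst))
    refine ⟨hc'.update h1, ?_, le_rfl⟩
    simp only [steps, one_mul]
    refine Nat.add_le_add_left (pay_le ?_) _
    have := ht.bits_le_of_le_lim hL h1
    have := ht.bits_le_of_le_lim hL (hc' x)
    have := ht.bits_le_of_le_lim hL (hc' j)
    omega
  | col dst y j =>
    rw [Program.run, PMF.mem_support_pure_iff] at h
    subst h
    have hc' := hc.mono (Nat.le_add_right τ 1)
    have h1 := (natAbs_colAt_le O (c.store y) (c.store j)).trans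
      ((show 2 ^ n ≤ t.β dst from hP).trans (ht.β_le_lim (τ + 1) dst))
    refine ⟨hc'.update h1, ?_, le_rfl⟩
    simp only [steps, one_mul]
    refine Nat.add_le_add_left (pay_le ?_) _
    have := ht.bits_le_of_le_lim hL h1
    have := ht.bits_le_of_le_lim hL (hc' y)
    have := ht.bits_le_of_le_lim hL (hc' j)
    omega
  | amp num den x =>
    rw [Program.run, PMF.mem_support_pure_iff] at h
    subst h
    have hc' := hc.mono (Nat.le_add_right τ 1)
    obtain ⟨h1, h2⟩ := hO.2 (c.store x)
    have h1' := h1.trans (hP.1.trans (ht.β_le_lim (τ + 1) num))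
    have h2' := h2.trans (hP.2.trans (ht.β_le_lim (τ + 1) den))
    refine ⟨(hc'.update h1').update h2', ?_, le_rfl⟩
    simp only [steps, one_mul]
    refine Nat.add_le_add_left (pay_le ?_) _
    have := ht.bits_le_of_le_lim hL h1'
    have := ht.bits_le_of_le_lim hL h2'
    have := ht.bits_le_of_le_lim hL (hc' x)
    omega
  | coins dst k =>
    rw [Program.run, PMF.mem_support_map_iff] at h
    obtain ⟨u, hu, rfl⟩ := h
    have hu' : u < 2 ^ (c.store k).toNat := by
      obtain ⟨v, _, hv⟩ := (PMF.mem_support_bind_iff _ _ _).1 hu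
      rw [(PMF.mem_support_pure_iff _ _).1 hv]
      exact v.2
    have hc' := hc.mono (Nat.le_add_right τ 1)
    have hk := hc.le_β hP.1
    have h1 : (((u : ℕ) : ℤ)).natAbs ≤ t.lim (τ + 1) dst := by
      refine le_trans ?_ (hP.2.trans (ht.β_le_lim (τ + 1) dst))
      rw [Int.natAbs_natCast]
      exact hu'.le.trans (Nat.pow_le_pow_right two_pos (by omega))
    refine ⟨hc'.update h1, ?_, Nat.le_add_right _ _⟩
    simp only [steps, one_mul]
    refine Nat.add_le_add_left (pay_le ?_) _
    have := ht.bits_le_of_le_lim hL (hc' k)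
    -- Tosses are paid for in unary, and their number is at most `E` because the result fits in `E`
    -- bits.
    have h2 : t.β k ≤ t.E := (Nat.pow_le_pow_iff_right one_lt_two).1 (hP.2.trans (ht.le dst))
    have h3 : t.E ≤ L := (Nat.le_add_right _ _).trans hL
    omega
  | exponential => exact hP.elim

end Typing

/-! ## The algorithm -/

namespace Program

variable {n : ℕ}

/-- The registers that a program may change. -/
def writes : Program → List ℕ
  | const dst _ => [dst]
  | add dst _ _ => [dst]
  | sub dst _ _ => [dst]
  | mul dst _ _ => [dst]
  | div dst _ _ => [dst]
  | seq P Q => P.writes ++ Q.writes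
  | ifLe _ _ P Q => P.writes ++ Q.writes
  | loop _ P => P.writes
  | entry num den _ _ => [num, den]
  | row dst _ _ => [dst]
  | col dst _ _ => [dst]
  | amp num den _ => [num, den]
  | coins dst _ => [dst]
  | exponential dst _ _ _ _ => [dst]
  | skip => []

theorem iterate_apply_of_forall {f : (ℕ → ℤ) → ℕ → ℤ} {r : ℕ} (h : ∀ σ, f σ r = σ r) (k : ℕ)
    (σ : ℕ → ℤ) : f^[k] σ r = σ r := by
  induction k with
  | zero => rfl
  | succ k ih => rw [Function.iterate_succ_apply', h, ih]

/-- The frame rule; its side condition is decidable for concrete programs and registers. -/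
theorem ev_apply_of_notMem (O : Oracle n) {P : Program} {r : ℕ} (h : r ∉ P.writes) (σ : ℕ → ℤ) :
    ev O P σ r = σ r := by
  induction P generalizing σ with
  | seq P Q ihP ihQ =>
    rw [writes, List.mem_append, not_or] at h
    rw [ev, ihQ h.2, ihP h.1]
  | ifLe a b P Q ihP ihQ =>
    rw [writes, List.mem_append, not_or] at h
    rw [ev]
    split_ifs
    · exact ihP h.1 σ
    · exact ihQ h.2 σ
  | loop a P ih => exact iterate_apply_of_forall (fun σ => ih h σ) _ _
  | _ => simp_all [ev, writes, Function.update_of_ne]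

/-- Run the programs in a list one after another. -/
def seqs : List Program → Program
  | [] => skip
  | P :: l => seq P (seqs l)

/-- Compute the next neighbour of the current index and its rate. -/
def weigh : Program :=
  seqs [row 12 1 11,
    ifLe 3 12
      (seqs [entry 13 14 1 12, amp 15 16 12, mul 19 13 15, mul 20 19 17, mul 30 20 18,
        mul 31 30 6, sub 32 3 31, mul 33 14 16, mul 34 17 17, mul 35 33 34, div 21 32 35])
      (const 21 0)]

/-- Add up the rates. -/
def tally : Program :=
  seqs [weigh, add 22 22 21, ifLe 21 3 skip (add 23 23 21), add 11 11 4]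

/-- Reduce the seed by register `25`, and move to the index in register `i` if it becomes
negative. -/
def pick (i : ℕ) : Program :=
  ifLe 3 10 (seqs [sub 10 10 25, ifLe 3 10 skip (add 26 i 3)]) skip

/-- Let the next neighbour have its share of the seeds. -/
def choose : Program :=
  seqs [weigh, ifLe 21 3 skip (seqs [mul 36 21 6, div 25 36 23, pick 12]), add 11 11 4]

/-- A step of the walk with the seed in register `10`. -/
def move : Program :=
  seqs [amp 17 18 1, const 22 0, const 11 0, add 38 7 7, add 23 6 38, loop 7 tally,
    const 26 (-1), const 11 0, div 25 37 23, pick 1, loop 7 choose, div 25 8 23, add 24 24 25,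
    mul 34 17 17, ifLe 4 34 (ifLe 27 22 (add 1 26 3) (const 1 (-1))) (const 1 (-1))]

/-- Accept if the walk survived and has enough credit. -/
def verdict : Program := ifLe 9 24 (ifLe 3 1 (const 2 1) skip) skip

/-- The walk, after the parameters have been computed. -/
def walk : Program := seq (loop 9 (seq (coins 10 5) move)) verdict

/-! ### What a step does -/

/-- The rate of the transition from `x` to `y`. -/
def rateTo (O : Oracle n) (P x y : ℤ) : ℤ :=
  if 0 ≤ y then
    (0 - (O.entryAt x y).1 * (O.ampAt y).1 * (O.ampAt x).1 * (O.ampAt x).2 * P) /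
      ((O.entryAt x y).2 * (O.ampAt y).2 * ((O.ampAt x).1 * (O.ampAt x).1))
  else 0

/-- The rate of the transition to the `j`-th neighbour of `x`. -/
def rate (O : Oracle n) (P x j : ℤ) : ℤ := rateTo O P x (O.rowAt x j)

/-- The total rate. -/
def rateSum (O : Oracle n) (P : ℤ) (s : ℕ) (x : ℤ) : ℤ :=
  P + (s + s) + ∑ j ∈ Finset.range s, max (rate O P x j) 0

/-- Give `q` seeds to `y`. -/
def give (y q : ℤ) (u : ℤ × ℤ) : ℤ × ℤ :=
  if 0 ≤ u.1 then (u.1 - q, if 0 ≤ u.1 - q then u.2 else y) else u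

/-- The remaining seed and the new index after `k` neighbours have been considered. -/
def picks (O : Oracle n) (P : ℤ) (s : ℕ) (x r : ℤ) : ℕ → ℤ × ℤ
  | 0 => give x (P * P / rateSum O P s x) (r, -1)
  | k + 1 => if rate O P x k ≤ 0 then picks O P s x r k
      else give (O.rowAt x k) (rate O P x k * P / rateSum O P s x) (picks O P s x r k)

/-- The new index. -/
def next (O : Oracle n) (P : ℤ) (s : ℕ) (x r : ℤ) : ℤ :=
  if 1 ≤ (O.ampAt x).1 * (O.ampAt x).1 ∧ -(s : ℤ) ≤ ∑ j ∈ Finset.range s, rate O P x j then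
    (picks O P s x r s).2 else -1

/-- Register `1` holds the current index, `17` and `18` its amplitude, `6` the scale `P`, and `11`
the neighbour counter; `12` and `21` receive the neighbour and its rate. -/
theorem weigh_apply_rate (O : Oracle n) {σ : ℕ → ℤ} (h3 : σ 3 = 0)
    (h17 : σ 17 = (O.ampAt (σ 1)).1) (h18 : σ 18 = (O.ampAt (σ 1)).2) :
    ev O weigh σ 21 = rate O (σ 6) (σ 1) (σ 11) := by
  by_cases h : 0 ≤ O.rowAt (σ 1) (σ 11)
  · simp [weigh, seqs, ev, rate, rateTo, h, h3, h17, h18]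
  · simp [weigh, seqs, ev, rate, rateTo, h, h3]

theorem weigh_apply_index (O : Oracle n) (σ : ℕ → ℤ) :
    ev O weigh σ 12 = O.rowAt (σ 1) (σ 11) := by
  by_cases h : σ 3 ≤ O.rowAt (σ 1) (σ 11)
  · simp [weigh, seqs, ev, h]
  · simp [weigh, seqs, ev, h]

theorem tally_iterate (O : Oracle n) {σ : ℕ → ℤ} (h3 : σ 3 = 0) (h4 : σ 4 = 1)
    (h17 : σ 17 = (O.ampAt (σ 1)).1) (h18 : σ 18 = (O.ampAt (σ 1)).2) (h11 : σ 11 = 0) (k : ℕ) :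
    ((ev O tally)^[k] σ) 11 = k ∧
    ((ev O tally)^[k] σ) 22 = σ 22 + ∑ j ∈ Finset.range k, rate O (σ 6) (σ 1) j ∧
    ((ev O tally)^[k] σ) 23 = σ 23 + ∑ j ∈ Finset.range k, max (rate O (σ 6) (σ 1) j) 0 := by
  induction k with
  | zero => simp [h11]
  | succ k ih =>
    rw [Function.iterate_succ_apply', Finset.sum_range_succ, Finset.sum_range_succ]
    have hf : ∀ r, r ∉ tally.writes → ((ev O tally)^[k] σ) r = σ r := fun r hr =>
      iterate_apply_of_forall (fun σ => ev_apply_of_notMem O hr σ) k σ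
    set σ' := (ev O tally)^[k] σ
    have e1 := hf 1 (by decide)
    have e3 := hf 3 (by decide)
    have e4 := hf 4 (by decide)
    have e6 := hf 6 (by decide)
    have e17 := hf 17 (by decide)
    have e18 := hf 18 (by decide)
    have hw := weigh_apply_rate O (σ := σ') (by rw [e3, h3]) (by rw [e17, e1, h17])
      (by rw [e18, e1, h18])
    rw [e6, e1, ih.1] at hw
    have hg : ∀ r, r ∉ weigh.writes → ev O weigh σ' r = σ' r := fun r hr =>
      ev_apply_of_notMem O hr σ'
    have g3 := hg 3 (by decide)
    have g4 := hg 4 (by decide)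
    have g11 := hg 11 (by decide)
    have g22 := hg 22 (by decide)
    have g23 := hg 23 (by decide)
    by_cases hr : rate O (σ 6) (σ 1) k ≤ 0
    · rw [max_eq_right hr]
      simp [tally, seqs, ev, hw, g3, g4, g11, g22, g23, e3, e4, h3, h4,
        hr, ih, add_assoc]
    · rw [max_eq_left (by omega)]
      simp [tally, seqs, ev, hw, g3, g4, g11, g22, g23, e3, e4, h3, h4,
        hr, ih, add_assoc]

/-- A negative seed in register `10` marks that a target has been chosen. Register `i` is read after
`10` was overwritten, so they must differ. -/
theorem pick_apply (O : Oracle n) {σ : ℕ → ℤ} (h3 : σ 3 = 0) {i : ℕ} (hi : i ≠ 10) :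
    (ev O (pick i) σ) 10 = (give (σ i) (σ 25) (σ 10, σ 26)).1 ∧
    (ev O (pick i) σ) 26 = (give (σ i) (σ 25) (σ 10, σ 26)).2 := by
  by_cases h : 0 ≤ σ 10
  · by_cases h' : σ 25 ≤ σ 10
    · simp [pick, seqs, ev, give, h3, h, h']
    · simp [pick, seqs, ev, give, h3, h, h', hi]
  · simp [pick, ev, give, h3, h]

theorem choose_iterate (O : Oracle n) {σ : ℕ → ℤ} {s : ℕ} {r : ℤ} (h3 : σ 3 = 0) (h4 : σ 4 = 1)
    (h17 : σ 17 = (O.ampAt (σ 1)).1) (h18 : σ 18 = (O.ampAt (σ 1)).2) (h11 : σ 11 = 0)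
    (h23 : σ 23 = rateSum O (σ 6) s (σ 1)) (h10 : σ 10 = (picks O (σ 6) s (σ 1) r 0).1)
    (h26 : σ 26 = (picks O (σ 6) s (σ 1) r 0).2) (k : ℕ) :
    ((ev O choose)^[k] σ) 11 = k ∧
    ((ev O choose)^[k] σ) 10 = (picks O (σ 6) s (σ 1) r k).1 ∧
    ((ev O choose)^[k] σ) 26 = (picks O (σ 6) s (σ 1) r k).2 := by
  induction k with
  | zero => exact ⟨h11, h10, h26⟩
  | succ k ih =>
    rw [Function.iterate_succ_apply']
    have hf : ∀ r, r ∉ choose.writes → ((ev O choose)^[k] σ) r = σ r := fun r hr =>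
      iterate_apply_of_forall (fun σ => ev_apply_of_notMem O hr σ) k σ
    set σ' := (ev O choose)^[k] σ
    have e1 := hf 1 (by decide)
    have e3 := hf 3 (by decide)
    have e4 := hf 4 (by decide)
    have e6 := hf 6 (by decide)
    have e17 := hf 17 (by decide)
    have e18 := hf 18 (by decide)
    have e23 := hf 23 (by decide)
    have hw := weigh_apply_rate O (σ := σ') (by rw [e3, h3]) (by rw [e17, e1, h17])
      (by rw [e18, e1, h18])
    rw [e6, e1, ih.1] at hw
    have hi := weigh_apply_index O σ'
    rw [e1, ih.1] at hi
    have hg : ∀ r, r ∉ weigh.writes → ev O weigh σ' r = σ' r := fun r hr =>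
      ev_apply_of_notMem O hr σ'
    have g3 := hg 3 (by decide)
    have g4 := hg 4 (by decide)
    have g6 := hg 6 (by decide)
    have g10 := hg 10 (by decide)
    have g11 := hg 11 (by decide)
    have g23 := hg 23 (by decide)
    have g26 := hg 26 (by decide)
    by_cases hr : rate O (σ 6) (σ 1) k ≤ 0
    · simp [choose, seqs, ev, hw, g3, g4, g10, g11, g26, e3, e4, h3, h4,
        hr, ih, picks]
    -- The store in the middle of `choose` is written out so that `pick_apply` and the frame rule
    -- apply to it.
    · have hp := pick_apply O (i := 12) (σ := Function.update (Function.update (ev O weigh σ') 36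
          (ev O weigh σ' 21 * ev O weigh σ' 6)) 25
            (ev O weigh σ' 21 * ev O weigh σ' 6 / ev O weigh σ' 23))
        (by simp [g3, e3, h3]) (by decide)
      have hq := ev_apply_of_notMem O (P := pick 12) (r := 11) (by decide)
        (Function.update (Function.update (ev O weigh σ') 36
          (ev O weigh σ' 21 * ev O weigh σ' 6)) 25
            (ev O weigh σ' 21 * ev O weigh σ' 6 / ev O weigh σ' 23))
      have hq' := ev_apply_of_notMem O (P := pick 12) (r := 4) (by decide)
        (Function.update (Function.update (ev O weigh σ') 36
          (ev O weigh σ' 21 * ev O weigh σ' 6)) 25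
            (ev O weigh σ' 21 * ev O weigh σ' 6 / ev O weigh σ' 23))
      simp [hw, hi, g4, g6, g10, g11, g23, g26, e4, e6, e23, h4, h23, ih]
        at hp hq hq'
      simp [choose, seqs, ev, hw, g3, g6, g23, e3, e6, e23, h3, h23,
        hr, picks, hp, hq, hq']

/-- The contents of the registers between two steps. -/
structure State (s : ℕ) (x a : ℤ) (σ : ℕ → ℤ) : Prop where
  index : σ 1 = x
  out : σ 2 = 0
  zero : σ 3 = 0
  one : σ 4 = 1
  size : σ 5 = s ^ 2
  scale : σ 6 = 2 ^ s ^ 2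
  sparsity : σ 7 = s
  unit : σ 8 = s ^ 3 * 2 ^ s ^ 2
  count : σ 9 = s ^ 6
  credit : σ 24 = a
  threshold : σ 27 = -s
  square : σ 37 = 2 ^ s ^ 2 * 2 ^ s ^ 2

end Program

/-! ### One step of the program, and the acceptance probability as a recursion -/

namespace Program

variable {n : ℕ}

/-- A step moves to the new index and adds the holding time to the credit. -/
theorem State.move (O : Oracle n) {s : ℕ} {x a : ℤ} {σ : ℕ → ℤ} (h : State s x a σ) (r : ℤ) :
    State s (next O (2 ^ s ^ 2) s x r)
      (a + s ^ 3 * 2 ^ s ^ 2 / rateSum O (2 ^ s ^ 2) s x)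
      (ev O Program.move (Function.update σ 10 r)) := by
  obtain ⟨h1, h2, h3, h4, h5, h6, h7, h8, h9, h24, h27, h37⟩ := h
  have hconst : ∀ q, q ∉ (10 :: Program.move.writes) →
      ev O Program.move (Function.update σ 10 r) q = σ q := by
    intro q hq
    rw [List.mem_cons, not_or] at hq
    rw [ev_apply_of_notMem O hq.2, Function.update_of_ne hq.1]
  -- Checkpoints: setup, summed rates, share for staying computed, that share given away, all shares
  -- given away.
  set σ₁ := ev O (seqs [amp 17 18 1, const 22 0, const 11 0, add 38 7 7, add 23 6 38])
    (Function.update σ 10 r) with hσ₁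
  set σ₂ := (ev O tally)^[(σ₁ 7).toNat] σ₁ with hσ₂
  set σ₃ := ev O (seqs [const 26 (-1), const 11 0, div 25 37 23]) σ₂ with hσ₃
  set σ₄ := ev O (pick 1) σ₃ with hσ₄
  set σ₅ := (ev O choose)^[(σ₄ 7).toNat] σ₄ with hσ₅
  have hmove : ev O Program.move (Function.update σ 10 r) = ev O (seqs [div 25 8 23, add 24 24 25,
    mul 34 17 17, ifLe 4 34 (ifLe 27 22 (add 1 26 3) (const 1 (-1))) (const 1 (-1))]) σ₅ := rfl
  have f1 : ∀ q, q ∉ [10, 17, 18, 22, 11, 38, 23] → σ₁ q = σ q := by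
    intro q hq
    simp only [List.mem_cons, List.not_mem_nil, not_or, or_false] at hq
    simp [hσ₁, seqs, ev, hq]
  have f2 : ∀ q, q ∉ tally.writes → σ₂ q = σ₁ q := fun q hq =>
    iterate_apply_of_forall (fun σ => ev_apply_of_notMem O hq σ) _ _
  have f3 : ∀ q, q ∉ [26, 11, 25] → σ₃ q = σ₂ q := by
    intro q hq
    simp only [List.mem_cons, List.not_mem_nil, not_or, or_false] at hq
    simp [hσ₃, seqs, ev, hq]
  have f4 : ∀ q, q ∉ (pick 1).writes → σ₄ q = σ₃ q := fun q hq => ev_apply_of_notMem O hq _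
  have f5 : ∀ q, q ∉ choose.writes → σ₅ q = σ₄ q := fun q hq =>
    iterate_apply_of_forall (fun σ => ev_apply_of_notMem O hq σ) _ _
  have g1 : ∀ q, q ∉ [10, 17, 18, 22, 11, 38, 23] ++ tally.writes ++ [26, 11, 25] ++
      (pick 1).writes → σ₄ q = σ q := by
    intro q hq
    simp only [List.mem_append, not_or] at hq
    rw [f4 q hq.2, f3 q hq.1.2, f2 q hq.1.1.2, f1 q hq.1.1.1]
  have g2 : ∀ q, q ∉ tally.writes ++ [26, 11, 25] ++ (pick 1).writes → σ₄ q = σ₁ q := by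
    intro q hq
    simp only [List.mem_append, not_or] at hq
    rw [f4 q hq.2, f3 q hq.1.2, f2 q hq.1.1]
  have g3 : ∀ q, q ∉ [26, 11, 25] ++ (pick 1).writes → σ₄ q = σ₂ q := by
    intro q hq
    simp only [List.mem_append, not_or] at hq
    rw [f4 q hq.2, f3 q hq.1]
  have i17 : σ₁ 17 = (O.ampAt x).1 := by simp [hσ₁, seqs, ev, h1]
  have i18 : σ₁ 18 = (O.ampAt x).2 := by simp [hσ₁, seqs, ev, h1]
  have i1 : σ₁ 1 = x := by rw [f1 1 (by decide), h1]
  have i6 : σ₁ 6 = 2 ^ s ^ 2 := by rw [f1 6 (by decide), h6]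
  have i22 : σ₁ 22 = 0 := by simp [hσ₁, seqs, ev]
  have i23 : σ₁ 23 = 2 ^ s ^ 2 + (s + s) := by simp [hσ₁, seqs, ev, h6, h7]
  have i7 : (σ₁ 7).toNat = s := by rw [f1 7 (by decide), h7]; simp
  obtain ⟨-, j22, j23⟩ := tally_iterate O (σ := σ₁) (by rw [f1 3 (by decide), h3])
    (by rw [f1 4 (by decide), h4]) (by rw [i17, i1]) (by rw [i18, i1]) (by simp [hσ₁, seqs, ev])
    (σ₁ 7).toNat
  rw [← hσ₂, i6, i1, i22, i7, zero_add] at j22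
  rw [← hσ₂, i6, i1, i23, i7] at j23
  have k1 : σ₄ 1 = x := by rw [g1 1 (by decide), h1]
  have k6 : σ₄ 6 = 2 ^ s ^ 2 := by rw [g1 6 (by decide), h6]
  have k23 : σ₄ 23 = rateSum O (2 ^ s ^ 2) s x := by rw [g3 23 (by decide), j23]; rfl
  have m25 : σ₃ 25 = 2 ^ s ^ 2 * 2 ^ s ^ 2 / rateSum O (2 ^ s ^ 2) s x := by
    have : σ₂ 37 = 2 ^ s ^ 2 * 2 ^ s ^ 2 := by rw [f2 37 (by decide), f1 37 (by decide), h37]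
    have e : σ₃ 25 = σ₂ 37 / σ₂ 23 := by simp [hσ₃, seqs, ev]
    rw [e, this, j23]; rfl
  have m26 : σ₃ 26 = -1 := by simp [hσ₃, seqs, ev]
  have m10 : σ₃ 10 = r := by
    rw [f3 10 (by decide), f2 10 (by decide)]
    simp [hσ₁, seqs, ev]
  have m1 : σ₃ 1 = x := by rw [f3 1 (by decide), f2 1 (by decide), i1]
  obtain ⟨p10, p26⟩ := pick_apply O (σ := σ₃) (i := 1)
    (by rw [f3 3 (by decide), f2 3 (by decide), f1 3 (by decide), h3]) (by decide)
  rw [m25, m26, m10, m1] at p10 p26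
  have k7 : (σ₄ 7).toNat = s := by rw [g1 7 (by decide), h7]; simp
  obtain ⟨-, -, q26⟩ := choose_iterate O (σ := σ₄) (s := s) (r := r)
    (by rw [g1 3 (by decide), h3]) (by rw [g1 4 (by decide), h4])
    (by rw [g2 17 (by decide), i17, k1]) (by rw [g2 18 (by decide), i18, k1])
    (by rw [f4 11 (by decide)]; simp [hσ₃, seqs, ev]) (by rw [k23, k6, k1])
    (by rw [k6, k1]; exact p10) (by rw [k6, k1]; exact p26) (σ₄ 7).toNat
  rw [← hσ₅, k6, k1, k7] at q26
  have r17 : σ₅ 17 = (O.ampAt x).1 := by rw [f5 17 (by decide), g2 17 (by decide), i17]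
  have r22 : σ₅ 22 = ∑ j ∈ Finset.range s, rate O (2 ^ s ^ 2) x j := by
    rw [f5 22 (by decide), g3 22 (by decide), j22]
  have r23 : σ₅ 23 = rateSum O (2 ^ s ^ 2) s x := by rw [f5 23 (by decide), k23]
  have r3 : σ₅ 3 = 0 := by rw [f5 3 (by decide), g1 3 (by decide), h3]
  have r4 : σ₅ 4 = 1 := by rw [f5 4 (by decide), g1 4 (by decide), h4]
  have r8 : σ₅ 8 = s ^ 3 * 2 ^ s ^ 2 := by rw [f5 8 (by decide), g1 8 (by decide), h8]
  have r24 : σ₅ 24 = a := by rw [f5 24 (by decide), g1 24 (by decide), h24]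
  have r27 : σ₅ 27 = -s := by rw [f5 27 (by decide), g1 27 (by decide), h27]
  refine ⟨?_, ?_, ?_, ?_, ?_, ?_, ?_, ?_, ?_, ?_, ?_, ?_⟩
  · rw [hmove, next]
    by_cases t1 : 1 ≤ (O.ampAt x).1 * (O.ampAt x).1
    · by_cases t2 : -(s : ℤ) ≤ ∑ j ∈ Finset.range s, rate O (2 ^ s ^ 2) x j
      · rw [if_pos ⟨t1, t2⟩]
        simp [seqs, ev, r17, r22, r3, r4, r27, t1, t2, q26]
      · rw [if_neg fun t => t2 t.2]
        simp [seqs, ev, r17, r22, r4, r27, t1, t2]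
    · rw [if_neg fun t => t1 t.1]
      simp [seqs, ev, r17, r4, t1]
  · rw [hconst 2 (by decide), h2]
  · rw [hconst 3 (by decide), h3]
  · rw [hconst 4 (by decide), h4]
  · rw [hconst 5 (by decide), h5]
  · rw [hconst 6 (by decide), h6]
  · rw [hconst 7 (by decide), h7]
  · rw [hconst 8 (by decide), h8]
  · rw [hconst 9 (by decide), h9]
  · rw [hmove]
    by_cases t1 : 1 ≤ (O.ampAt x).1 * (O.ampAt x).1
    · by_cases t2 : -(s : ℤ) ≤ ∑ j ∈ Finset.range s, rate O (2 ^ s ^ 2) x j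
      · simp [seqs, ev, r17, r22, r4, r27, t1, t2, r24, r8, r23]
      · simp [seqs, ev, r17, r22, r4, r27, t1, t2, r24, r8, r23]
    · simp [seqs, ev, r17, r4, t1, r24, r8, r23]
  · rw [hconst 27 (by decide), h27]
  · rw [hconst 37 (by decide), h37]

/-- The probability of acceptance when `k` steps remain. -/
def val (O : Oracle n) (s : ℕ) : ℕ → ℤ → ℤ → ℝ
  | 0, x, a => if (s : ℤ) ^ 6 ≤ a ∧ 0 ≤ x then 1 else 0
  | k + 1, x, a => (∑ r ∈ Finset.range (2 ^ s ^ 2), val O s k (next O (2 ^ s ^ 2) s x r)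
      (a + s ^ 3 * 2 ^ s ^ 2 / rateSum O (2 ^ s ^ 2) s x)) / 2 ^ s ^ 2

theorem val_nonneg (O : Oracle n) (s k : ℕ) (x a : ℤ) : 0 ≤ val O s k x a := by
  induction k generalizing x a with
  | zero => rw [val]; split_ifs <;> norm_num
  | succ k ih => exact div_nonneg (Finset.sum_nonneg fun r _ => ih _ _) (by positivity)

theorem coinFree_move : Program.move.CoinFree := by
  simp [Program.move, seqs, CoinFree, tally, choose, weigh, pick]

theorem run_coins_seq (O : Oracle n) (dst k : ℕ) (P : Program) (c : Config) :
    run O (seq (coins dst k) P) c = (PMF.uniformOfFintype (Fin (2 ^ (c.store k).toNat))).bind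
      fun u => run O P ((c.pay (bits (c.store k) + (c.store k).toNat)).set dst ((u : ℕ) : ℤ)) := by
  rw [run, run, PMF.bind_map]
  exact (PMF.bind_bind _ _ _).trans (congrArg _ (funext fun u => PMF.pure_bind _ _))

/-- Condition on the seed of the first step: the rest of that step is deterministic and restores
`State`. The payment `m` affects only the time, so it may be arbitrary. -/
theorem toOuterMeasure_walk (O : Oracle n) {s : ℕ} (m k : ℕ) {x a : ℤ} {c : Config}
    (hc : State s x a c.store) :
    (((fun μ : PMF Config => μ.bind fun c' => run O (seq (coins 10 5) Program.move) (c'.pay m))^[k]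
      (PMF.pure c)).bind (run O verdict)).toOuterMeasure {c | c.Accepts} =
        ENNReal.ofReal (val O s k x a) := by
  induction k generalizing x a c with
  | zero =>
    have hv : verdict.CoinFree := by simp [verdict, CoinFree]
    obtain ⟨c', h, h'⟩ := hv.run_eq O c
    rw [Function.iterate_zero, id, PMF.pure_bind, h, PMF.toOuterMeasure_pure_apply]
    have hacc : c' ∈ {c : Config | c.Accepts} ↔ (s : ℤ) ^ 6 ≤ a ∧ 0 ≤ x := by
      rw [Set.mem_ofPred_eq, Config.Accepts, h']
      by_cases t1 : (s : ℤ) ^ 6 ≤ a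
      · by_cases t2 : 0 ≤ x
        · simp [verdict, ev, hc.count, hc.credit, hc.zero, hc.index, t1, t2]
        · simp [verdict, ev, hc.count, hc.credit, hc.zero, hc.index, t1, t2, hc.out]
      · simp [verdict, ev, hc.count, hc.credit, t1, hc.out]
    rw [val]
    simp only [hacc]
    split_ifs <;> simp
  | succ k ih =>
    rw [Function.iterate_succ_apply, PMF.pure_bind, iterate_bind, run_coins_seq, PMF.bind_bind,
      PMF.bind_bind, PMF.toOuterMeasure_bind_apply, tsum_fintype]
    have hsize : ((c.pay m).store 5).toNat = s ^ 2 := by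
      rw [show (c.pay m).store 5 = s ^ 2 from hc.size]; norm_cast
    have hterm : ∀ u : Fin (2 ^ ((c.pay m).store 5).toNat),
        ((run O Program.move (((c.pay m).pay (bits ((c.pay m).store 5) +
          ((c.pay m).store 5).toNat)).set 10 ((u : ℕ) : ℤ))).bind fun c =>
            ((fun μ : PMF Config => μ.bind fun c' =>
              run O (seq (coins 10 5) Program.move) (c'.pay m))^[k] (PMF.pure c)).bind
                (run O verdict)).toOuterMeasure {c | c.Accepts} =
        ENNReal.ofReal (val O s k (next O (2 ^ s ^ 2) s x ((u : ℕ) : ℤ))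
          (a + s ^ 3 * 2 ^ s ^ 2 / rateSum O (2 ^ s ^ 2) s x)) := by
      intro u
      obtain ⟨c', h, h'⟩ := coinFree_move.run_eq O (((c.pay m).pay (bits ((c.pay m).store 5) +
          ((c.pay m).store 5).toNat)).set 10 ((u : ℕ) : ℤ))
      rw [h, PMF.pure_bind]
      refine ih ?_
      rw [h']
      exact hc.move O _
    rw [Finset.sum_congr rfl fun u _ => congrArg₂ (· * ·) (PMF.uniformOfFintype_apply u) (hterm u),
      ← Finset.mul_sum, ← ENNReal.ofReal_sum_of_nonneg fun u _ => val_nonneg O s k _ _,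
      Fin.sum_univ_eq_sum_range (fun u => val O s k (next O (2 ^ s ^ 2) s x u)
          (a + s ^ 3 * 2 ^ s ^ 2 / rateSum O (2 ^ s ^ 2) s x)), hsize, Fintype.card_fin,
      val, div_eq_inv_mul, ENNReal.ofReal_mul (by positivity)]
    congr 1
    rw [ENNReal.ofReal_inv_of_pos (by positivity)]
    congr 1
    rw [← Nat.cast_ofNat (R := ℝ), ← Nat.cast_pow, ENNReal.ofReal_natCast]

theorem run_walk (O : Oracle n) {s : ℕ} {x a : ℤ} {c : Config} (hc : State s x a c.store) :
    (run O walk c).toOuterMeasure {c | c.Accepts} = ENNReal.ofReal (val O s (s ^ 6) x a) := by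
  have h9 : (c.store 9).toNat = s ^ 6 := by rw [hc.count]; norm_cast
  rw [walk, run, run, h9]
  exact toOuterMeasure_walk O _ _ hc

end Program

/-! ## The algorithm simulates the fixed-node walk -/

namespace Oracle

variable {n : ℕ}

theorem toIndex_coe (i : Fin (2 ^ n)) : toIndex n ((i : ℕ) : ℤ) = some i := by
  have : (0 : ℤ) ≤ ((i : ℕ) : ℤ) ∧ (((i : ℕ) : ℤ)).toNat < 2 ^ n := ⟨by positivity, by simp⟩
  rw [toIndex, dif_pos this]
  simp

theorem toIndex_neg_one : toIndex n (-1) = none := by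
  simp [toIndex]

theorem entryAt_coe (O : Oracle n) (i k : Fin (2 ^ n)) :
    O.entryAt ((i : ℕ) : ℤ) ((k : ℕ) : ℤ) = O.entry i k := by
  rw [entryAt, toIndex_coe, toIndex_coe]

theorem ampAt_coe (O : Oracle n) (i : Fin (2 ^ n)) :
    O.ampAt ((i : ℕ) : ℤ) = (O.amp i).getD (0, 0) := by
  rw [ampAt, toIndex_coe]

theorem rowAt_coe (O : Oracle n) (i : Fin (2 ^ n)) (j : ℤ) :
    O.rowAt ((i : ℕ) : ℤ) j = nth (O.row i) j := by
  rw [rowAt, toIndex_coe]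

theorem ampAt_neg_one (O : Oracle n) : O.ampAt (-1) = (0, 0) := by
  rw [ampAt, toIndex_neg_one]

/-- Positions beyond the end of the list answer `-1` and contribute nothing, so the program may
always scan `s` positions. -/
theorem sum_nth {M : Type} [AddCommMonoid M] (F : ℤ → M) (hF : F (-1) = 0)
    (l : List (Fin (2 ^ n))) {s : ℕ} (hs : l.length ≤ s) :
    ∑ j ∈ Finset.range s, F (nth l j) = (l.map fun i : Fin (2 ^ n) => F ((i : ℕ) : ℤ)).sum := by
  induction l generalizing s with
  | nil =>
    refine Finset.sum_eq_zero fun j _ => ?_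
    simp [nth, hF]
  | cons a l ih =>
    obtain ⟨s, rfl⟩ : ∃ r, s = r + 1 := ⟨s - 1, by rw [List.length_cons] at hs; omega⟩
    rw [Finset.sum_range_succ', List.map_cons, List.sum_cons,
      ← ih (s := s) (by rw [List.length_cons] at hs; omega), add_comm]
    refine congrArg₂ (· + ·) (by simp [nth]) (Finset.sum_congr rfl fun j _ => ?_)
    have h1 : (0 : ℤ) ≤ ((j + 1 : ℕ) : ℤ) := by positivity
    have h2 : (0 : ℤ) ≤ (j : ℤ) := by positivity
    rw [nth, nth, if_pos h1, if_pos h2, Int.toNat_natCast, Int.toNat_natCast,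
      List.getElem?_cons_succ]

/-- The amplitude that the oracle reports, and `0` if there is no such answer. -/
def reported (O : Oracle n) (i : Fin (2 ^ n)) : ℝ :=
  ((O.ampAt ((i : ℕ) : ℤ)).1 : ℝ) / ((O.ampAt ((i : ℕ) : ℤ)).2 : ℝ)

variable {O : Oracle n} {p : ℕ} {H : Matrix (Fin (2 ^ n)) (Fin (2 ^ n)) ℝ} {φ : Fin (2 ^ n) → ℝ}

theorem Answers.amp_cases (hO : O.Answers p H φ) (i : Fin (2 ^ n)) :
    (O.ampAt ((i : ℕ) : ℤ) = (0, 0) ∧ ¬ IsRepresentable p (φ i)) ∨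
      IsFraction p (O.ampAt ((i : ℕ) : ℤ)) (φ i) := by
  rw [ampAt_coe]
  rcases h : O.amp i with _ | f
  · exact Or.inl ⟨rfl, hO.amp_none i h⟩
  · exact Or.inr (hO.amp_some i f h)

theorem Answers.reported_eq (hO : O.Answers p H φ) {i : Fin (2 ^ n)}
    (hi : IsRepresentable p (φ i)) : O.reported i = φ i := by
  rcases hO.amp_cases i with ⟨_, h⟩ | h
  · exact (h hi).elim
  · exact h.2.2.2.symm

theorem Answers.reported_ne_zero (hO : O.Answers p H φ) (i : Fin (2 ^ n)) :
    O.reported i ≠ 0 ↔ (O.ampAt ((i : ℕ) : ℤ)).1 ≠ 0 := by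
  rcases hO.amp_cases i with ⟨h, _⟩ | h
  · simp [reported, h]
  · have := h.2.1.ne'
    simp [reported, this]

theorem Answers.abs_reported_le (hO : O.Answers p H φ) (i : Fin (2 ^ n)) :
    |O.reported i| ≤ 2 ^ p := by
  rcases hO.amp_cases i with ⟨h, _⟩ | h
  · simp [reported, h]
  · rw [reported, abs_div]
    have h1 : (1 : ℝ) ≤ |((O.ampAt ((i : ℕ) : ℤ)).2 : ℝ)| := by
      rw [← Int.cast_abs, abs_of_pos h.2.1]
      exact_mod_cast h.2.1
    refine (div_le_self (abs_nonneg _) h1).trans ?_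
    rw [← Int.cast_abs]
    exact_mod_cast h.1

theorem Answers.one_le_abs_reported_mul (hO : O.Answers p H φ) {i : Fin (2 ^ n)}
    (hi : O.reported i ≠ 0) : 1 ≤ |O.reported i| * 2 ^ p := by
  have hne := (hO.reported_ne_zero i).1 hi
  rcases hO.amp_cases i with ⟨h, _⟩ | h
  · simp [h] at hne
  · have h2 : (0 : ℝ) < ((O.ampAt ((i : ℕ) : ℤ)).2 : ℝ) := by exact_mod_cast h.2.1
    rw [reported, abs_div, abs_of_pos h2, div_mul_eq_mul_div, le_div_iff₀ h2, one_mul]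
    have h3 : (1 : ℝ) ≤ |((O.ampAt ((i : ℕ) : ℤ)).1 : ℝ)| := by
      rw [← Int.cast_abs]; exact_mod_cast Int.one_le_abs hne
    have h4 : ((O.ampAt ((i : ℕ) : ℤ)).2 : ℝ) ≤ 2 ^ p := by exact_mod_cast h.2.2.1
    nlinarith

theorem Answers.abs_entry_le (hO : O.Answers p H φ) (i k : Fin (2 ^ n)) : |H i k| ≤ 2 ^ p := by
  have h := hO.entry_spec i k
  rw [h.2.2.2, abs_div]
  have h1 : (1 : ℝ) ≤ |((O.entry i k).2 : ℝ)| := by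
    rw [← Int.cast_abs, abs_of_pos h.2.1]
    exact_mod_cast h.2.1
  refine (div_le_self (abs_nonneg _) h1).trans ?_
  rw [← Int.cast_abs]
  exact_mod_cast h.1

theorem floor_intCast_div (a : ℤ) {b : ℤ} (hb : 0 < b) : ⌊(a : ℝ) / b⌋ = a / b :=
  Int.floor_eq_iff.2 ⟨cast_ediv_le a hb, lt_cast_ediv_add_one a hb⟩

theorem Answers.rateTo_eq (hO : O.Answers p H φ) (P : ℤ) {i : Fin (2 ^ n)}
    (hi : O.reported i ≠ 0) (k : Fin (2 ^ n)) :
    Program.rateTo O P ((i : ℕ) : ℤ) ((k : ℕ) : ℤ) = drift H O.reported P i k := by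
  have hne := (hO.reported_ne_zero i).1 hi
  have hH := hO.entry_spec i k
  rw [Program.rateTo, if_pos (by positivity), entryAt_coe, drift]
  -- If the neighbour has no representable amplitude, the answer `(0, 0)` gives rate 0 in integer
  -- arithmetic and amplitude 0 in real arithmetic.
  rcases hO.amp_cases k with ⟨hk, _⟩ | hk
  · simp [reported, hk]
  rcases hO.amp_cases i with ⟨h, _⟩ | h
  · simp [h] at hne
  have hden : 0 < (O.entry i k).2 * (O.ampAt ((k : ℕ) : ℤ)).2 *
      ((O.ampAt ((i : ℕ) : ℤ)).1 * (O.ampAt ((i : ℕ) : ℤ)).1) :=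
    mul_pos (mul_pos hH.2.1 hk.2.1) (mul_self_pos.2 hne)
  rw [← floor_intCast_div _ hden, hH.2.2.2, reported, reported]
  congr 1
  have h1 : ((O.entry i k).2 : ℝ) ≠ 0 := by exact_mod_cast hH.2.1.ne'
  have h2 : ((O.ampAt ((k : ℕ) : ℤ)).2 : ℝ) ≠ 0 := by exact_mod_cast hk.2.1.ne'
  have h3 : ((O.ampAt ((i : ℕ) : ℤ)).2 : ℝ) ≠ 0 := by exact_mod_cast h.2.1.ne'
  have h4 : ((O.ampAt ((i : ℕ) : ℤ)).1 : ℝ) ≠ 0 := by exact_mod_cast hne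
  push_cast
  field_simp
  ring

theorem Answers.length_row_le (hO : O.Answers p H φ) {s : ℕ}
    (hs : ∀ x, {y | H x y ≠ 0}.ncard ≤ s) (i : Fin (2 ^ n)) : (O.row i).length ≤ s := by
  rw [← List.toFinset_card_of_nodup (hO.row_nodup i), ← Set.ncard_coe_finset]
  convert hs i using 2
  ext y
  simp [hO.mem_row i y]

theorem Answers.sum_rowAt (hO : O.Answers p H φ) {s : ℕ}
    (hs : ∀ x, {y | H x y ≠ 0}.ncard ≤ s) (i : Fin (2 ^ n)) {M : Type} [AddCommMonoid M]
    (F : ℤ → M) (hF : F (-1) = 0) (hF' : ∀ k, H i k = 0 → F ((k : ℕ) : ℤ) = 0) :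
    ∑ j ∈ Finset.range s, F (O.rowAt ((i : ℕ) : ℤ) j) = ∑ k : Fin (2 ^ n), F ((k : ℕ) : ℤ) := by
  simp only [rowAt_coe]
  rw [sum_nth F hF _ (hO.length_row_le hs i), ← List.sum_toFinset _ (hO.row_nodup i)]
  refine Finset.sum_subset (Finset.subset_univ _) fun k _ hk => hF' k ?_
  rw [List.mem_toFinset, hO.mem_row] at hk
  exact not_not.1 hk

theorem rateTo_neg_one (P x : ℤ) : Program.rateTo O P x (-1) = 0 := by
  simp [Program.rateTo]

theorem Answers.sum_rate (hO : O.Answers p H φ) {s : ℕ}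
    (hs : ∀ x, {y | H x y ≠ 0}.ncard ≤ s) (P : ℤ) {i : Fin (2 ^ n)} (hi : O.reported i ≠ 0) :
    ∑ j ∈ Finset.range s, Program.rate O P ((i : ℕ) : ℤ) j = ∑ k, drift H O.reported P i k := by
  refine (hO.sum_rowAt hs i (fun y => Program.rateTo O P ((i : ℕ) : ℤ) y) (rateTo_neg_one _ _)
    fun k hk => ?_).trans (Finset.sum_congr rfl fun k _ => hO.rateTo_eq P hi k)
  rw [hO.rateTo_eq P hi]
  simp [drift, hk]

theorem Answers.rateSum_eq (hO : O.Answers p H φ) {s : ℕ}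
    (hs : ∀ x, {y | H x y ≠ 0}.ncard ≤ s) (P : ℤ) {i : Fin (2 ^ n)} (hi : O.reported i ≠ 0) :
    Program.rateSum O P s ((i : ℕ) : ℤ) = totalRate H O.reported P s i := by
  rw [Program.rateSum, totalRate, two_mul]
  congr 1
  refine (hO.sum_rowAt hs i (fun y => max (Program.rateTo O P ((i : ℕ) : ℤ) y) 0)
    (by simp [rateTo_neg_one]) fun k hk => ?_).trans
      (Finset.sum_congr rfl fun k _ => by rw [hO.rateTo_eq P hi k])
  rw [hO.rateTo_eq P hi]
  simp [drift, hk]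

end Oracle

/-! ### Distribution of the seeds, and equality of the program with the walk -/

namespace Program

variable {n : ℕ}

/-- The seeds below `C` have been given away, and the others have not. -/
def Given (C : ℤ) (u : ℤ → ℤ × ℤ) : Prop :=
  ∀ r, 0 ≤ r → (C ≤ r → u r = (r - C, -1)) ∧ (r < C → (u r).1 < 0)

theorem Given.step {C : ℤ} {u : ℤ → ℤ × ℤ} (hu : Given C u) {q : ℤ} (hq : 0 ≤ q)
    (y : ℤ) : Given (C + q) fun r => give y q (u r) := by
  refine fun r hr => ⟨fun h => ?_, fun h => ?_⟩
  · beta_reduce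
    rw [(hu r hr).1 (by omega), Program.give, if_pos (by simp; omega), if_pos (by simp; omega)]
    simp only [Prod.mk.injEq, and_true]; ring
  · beta_reduce
    by_cases hC : C ≤ r
    · rw [(hu r hr).1 hC, Program.give, if_pos (by simp; omega)]
      simp only; omega
    · have := (hu r hr).2 (by omega)
      rwa [Program.give, if_neg (by omega)]

/-- Exactly the seeds in `[C, C + q)` change their target, from `-1` to `y`; the bound by `T`
ensures that all of them are summed over. -/
theorem Given.sum_give {C : ℤ} {u : ℤ → ℤ × ℤ} (hu : Given C u) {q : ℤ} (hq : 0 ≤ q) (hC : 0 ≤ C)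
    (y : ℤ) {T : ℕ} (hT : C + q ≤ T) {F : ℤ → ℝ} (hF : F (-1) = 0) :
    ∑ r ∈ Finset.range T, F (give y q (u r)).2 =
      ∑ r ∈ Finset.range T, F (u r).2 + q * F y := by
  have h1 : ∀ r ∈ Finset.range T, F (give y q (u r)).2 =
      F (u r).2 + if r ∈ Finset.Ico C.toNat (C + q).toNat then F y else 0 := by
    intro r _
    obtain ⟨ha, hb⟩ := hu r (by positivity)
    simp only [Finset.mem_Ico]
    by_cases hr : C ≤ r
    · rw [ha hr, Program.give, if_pos (by simp; omega)]
      by_cases hr' : (r : ℤ) < C + q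
      · rw [if_neg (by simp; omega), if_pos ⟨by omega, by omega⟩]
        simp [hF]
      · rw [if_pos (by simp; omega), if_neg (by omega), add_zero]
    · rw [Program.give, if_neg (by have := hb (by omega); omega), if_neg (by omega), add_zero]
  rw [Finset.sum_congr rfl h1, Finset.sum_add_distrib, Finset.sum_ite_mem,
    Finset.inter_eq_right.2, Finset.sum_const, Nat.card_Ico, nsmul_eq_mul]
  · congr 2
    have : (((C + q).toNat - C.toNat : ℕ) : ℤ) = q := by omega
    exact_mod_cast congrArg (Int.cast (R := ℝ)) this
  · intro r hr
    rw [Finset.mem_Ico] at hr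
    rw [Finset.mem_range]
    omega

theorem sum_picks (O : Oracle n) {P : ℤ} {s T : ℕ} {x : ℤ} (hP : 0 ≤ P)
    (hW : 0 ≤ rateSum O P s x)
    (hT : P * P / rateSum O P s x +
      ∑ j ∈ Finset.range s, max (rate O P x j) 0 * P / rateSum O P s x ≤ T)
    {F : ℤ → ℝ} (hF : F (-1) = 0) {k : ℕ} (hk : k ≤ s) :
    ∑ r ∈ Finset.range T, F (picks O P s x r k).2 =
      ((P * P / rateSum O P s x : ℤ) : ℝ) * F x + ∑ j ∈ Finset.range k,
        ((max (rate O P x j) 0 * P / rateSum O P s x : ℤ) : ℝ) * F (O.rowAt x j) := by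
  have hq : ∀ j : ℕ, 0 ≤ max (rate O P x j) 0 * P / rateSum O P s x := fun j =>
    Int.ediv_nonneg (mul_nonneg (le_max_right _ _) hP) hW
  have hq0 : 0 ≤ P * P / rateSum O P s x := Int.ediv_nonneg (mul_nonneg hP hP) hW
  have hle : ∀ k ≤ s, P * P / rateSum O P s x +
      ∑ j ∈ Finset.range k, max (rate O P x j) 0 * P / rateSum O P s x ≤ T := fun k hk =>
    (add_le_add_right (Finset.sum_le_sum_of_subset_of_nonneg
      (Finset.range_mono hk) fun j _ _ => hq j) _).trans hT
  have hstart : Given 0 fun r => (r, -1) := fun r hr => ⟨fun _ => by simp, fun h => by omega⟩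
  -- The induction must also carry the invariant that the shares given so far fill an initial
  -- interval of seeds.
  suffices H : Given (P * P / rateSum O P s x +
      ∑ j ∈ Finset.range k, max (rate O P x j) 0 * P / rateSum O P s x)
        (fun r => picks O P s x r k) ∧ _ from H.2
  induction k with
  | zero =>
    have h0 := hle 0 (Nat.zero_le _)
    rw [Finset.sum_range_zero, add_zero] at h0 ⊢
    rw [Finset.sum_range_zero, add_zero]
    refine ⟨by simpa [picks] using hstart.step hq0 x, ?_⟩
    refine (hstart.sum_give hq0 le_rfl x (by simpa using h0) hF).trans ?_
    simp [hF]
  | succ k ih =>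
    obtain ⟨ih1, ih2⟩ := ih (by omega)
    have h0 := hle (k + 1) hk
    rw [Finset.sum_range_succ, ← add_assoc] at h0 ⊢
    rw [Finset.sum_range_succ, ← add_assoc, ← ih2]
    simp only [picks]
    by_cases hr : rate O P x k ≤ 0
    · simp only [if_pos hr, max_eq_right hr, zero_mul, Int.zero_ediv, Int.cast_zero, add_zero]
      exact ⟨ih1, trivial⟩
    · simp only [if_neg hr]
      have hm : max (rate O P x k) 0 = rate O P x k := max_eq_left (by omega)
      have hqk := hq k
      rw [hm] at h0 hqk ⊢
      exact ⟨ih1.step hqk _, ih1.sum_give hqk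
        (add_nonneg hq0 (Finset.sum_nonneg fun j _ => hq j)) _ h0 hF⟩

/-- The index `-1` is the cemetery: its amplitude query returns 0, so the local check fails forever.
-/
theorem val_neg_one (O : Oracle n) (s k : ℕ) (a : ℤ) : val O s k (-1) a = 0 := by
  induction k generalizing a with
  | zero => simp [val]
  | succ k ih => simp [val, next, Oracle.ampAt_neg_one, ih]

/-- The algorithm simulates the fixed-node walk. -/
theorem val_eq_survive {O : Oracle n} {p : ℕ} {H : Matrix (Fin (2 ^ n)) (Fin (2 ^ n)) ℝ}
    {φ : Fin (2 ^ n) → ℝ} (hO : O.Answers p H φ) {s : ℕ}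
    (hs : ∀ x, {y | H x y ≠ 0}.ncard ≤ s) (k : ℕ) (i : Fin (2 ^ n)) (a : ℤ) :
    val O s k ((i : ℕ) : ℤ) a = survive (IsGood H O.reported (2 ^ s ^ 2) s)
      (fun x y => (seeds H O.reported (2 ^ s ^ 2) s x y : ℝ) / ((2 ^ s ^ 2 : ℤ) : ℝ))
      (hold H O.reported (2 ^ s ^ 2) s (s ^ 3)) (s ^ 6) k i a := by
  set P : ℤ := 2 ^ s ^ 2 with hP
  have hP0 : 0 < P := by positivity
  induction k generalizing i a with
  | zero => simp [val, survive]
  | succ k ih =>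
    rw [val, survive, ← hP]
    by_cases hψ : O.reported i = 0
    · have hc := not_not.1 ((hO.reported_ne_zero i).not.1 (not_not.2 hψ))
      rw [if_neg fun h => h.1 hψ]
      simp [next, hc, val_neg_one]
    have hc : 1 ≤ (O.ampAt ((i : ℕ) : ℤ)).1 * (O.ampAt ((i : ℕ) : ℤ)).1 :=
      mul_self_pos.2 ((hO.reported_ne_zero i).1 hψ)
    have hZ := hO.sum_rate hs P hψ
    by_cases hgood : -(s : ℤ) ≤ ∑ k, drift H O.reported P i k
    · rw [if_pos ⟨hψ, hgood⟩]
      rw [← hZ] at hgood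
      simp only [next, if_pos (And.intro hc hgood)]
      have hW := hO.rateSum_eq hs P hψ
      have hF := val_neg_one O s k (a + s ^ 3 * P / rateSum O P s ((i : ℕ) : ℤ))
      have hsum : ∀ F : ℤ → ℝ, ∑ j ∈ Finset.range s, ((max (rate O P ((i : ℕ) : ℤ) j) 0 * P /
          rateSum O P s ((i : ℕ) : ℤ) : ℤ) : ℝ) * F (O.rowAt ((i : ℕ) : ℤ) j) =
          ∑ k : Fin (2 ^ n), ((max (drift H O.reported P i k) 0 * P /
            totalRate H O.reported P s i : ℤ) : ℝ) * F ((k : ℕ) : ℤ) := by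
        intro F
        refine (hO.sum_rowAt hs i (fun y => ((max (rateTo O P ((i : ℕ) : ℤ) y) 0 * P /
          rateSum O P s ((i : ℕ) : ℤ) : ℤ) : ℝ) * F y) ?_ fun k hk => ?_).trans
          (Finset.sum_congr rfl fun k _ => by rw [hO.rateTo_eq P hψ k, hW])
        · simp [Oracle.rateTo_neg_one]
        · rw [hO.rateTo_eq P hψ]
          simp [drift, hk]
      -- This is `sum_seeds_le`, rewritten as a sum over positions in the row.
      have hT : P * P / rateSum O P s ((i : ℕ) : ℤ) + ∑ j ∈ Finset.range s,
          max (rate O P ((i : ℕ) : ℤ) j) 0 * P / rateSum O P s ((i : ℕ) : ℤ) ≤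
            ((2 ^ s ^ 2 : ℕ) : ℤ) := by
        have h1 := sum_seeds_le (H := H) (ψ := O.reported) (s := s) hP0 i
        have h2 := hsum fun _ => 1
        simp only [mul_one] at h2
        have h3 : ∑ j ∈ Finset.range s, max (rate O P ((i : ℕ) : ℤ) j) 0 * P /
            rateSum O P s ((i : ℕ) : ℤ) = ∑ k, max (drift H O.reported P i k) 0 * P /
              totalRate H O.reported P s i := by exact_mod_cast h2
        simp only [seeds, Finset.sum_add_distrib, Finset.sum_ite_eq, Finset.mem_univ, if_true]
          at h1
        rw [h3, hW]
        push_cast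
        exact h1
      rw [sum_picks O hP0.le (by rw [hW]; exact (totalRate_pos hP0 i).le) hT
        (F := fun y => val O s k y (a + s ^ 3 * P / rateSum O P s ((i : ℕ) : ℤ))) hF le_rfl,
        hsum fun y => val O s k y (a + s ^ 3 * P / rateSum O P s ((i : ℕ) : ℤ)), hW]
      simp only [ih, seeds, hold]
      push_cast
      simp only [div_mul_eq_mul_div, ← Finset.sum_div, add_mul, Finset.sum_add_distrib, ite_mul,
        zero_mul, Finset.sum_ite_eq, Finset.mem_univ, if_true]
      simp [hP]
    · rw [if_neg fun h => hgood h.2]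
      rw [← hZ] at hgood
      have : ∀ r : ℕ, next O P s ((i : ℕ) : ℤ) r = -1 := fun r => if_neg fun h => hgood h.2
      simp [this, val_neg_one]

end Program

/-! ## Spectral facts -/

/-- The eigenvalues of the Hermitian matrix `H - c` are eigenvalues of `H` shifted by `-c`, hence
nonnegative, so it is positive semidefinite. -/
theorem groundEnergy_mul_le {ι : Type} [Fintype ι] [DecidableEq ι] {H : Matrix ι ι ℝ}
    (hH : H.IsSymm) {c : ℝ} (hc : c ≤ groundEnergy H) (u : ι → ℝ) :
    c * ∑ x, u x ^ 2 ≤ ∑ x, ∑ y, H x y * (u x * u y) := by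
  have hherm : (H - c • (1 : Matrix ι ι ℝ)).IsHermitian := by
    rw [Matrix.IsHermitian, Matrix.conjTranspose_eq_transpose_of_trivial, Matrix.transpose_sub,
      hH, Matrix.transpose_smul, Matrix.transpose_one]
  have hpsd : (H - c • (1 : Matrix ι ι ℝ)).PosSemidef := by
    rw [hherm.posSemidef_iff_eigenvalues_nonneg]
    intro i
    have hv := hherm.mulVec_eigenvectorBasis i
    set v : ι → ℝ := ⇑(hherm.eigenvectorBasis i) with hvdef
    have hv0 : v ≠ 0 := by
      intro h
      have h1 := hherm.eigenvectorBasis.orthonormal.ne_zero i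
      apply h1
      ext x
      exact congrFun h x
    have hev : Module.End.HasEigenvalue (Matrix.toLin' H) (hherm.eigenvalues i + c) := by
      refine Module.End.hasEigenvalue_of_hasEigenvector (x := v)
        (Module.End.hasEigenvector_iff.2 ⟨Module.End.mem_eigenspace_iff.2 ?_, hv0⟩)
      rw [Matrix.sub_mulVec, Matrix.smul_mulVec, Matrix.one_mulVec, sub_eq_iff_eq_add] at hv
      rw [Matrix.toLin'_apply, hv, add_smul]
    have hfin : {μ : ℝ | Module.End.HasEigenvalue (Matrix.toLin' H) μ}.Finite :=
      Module.End.finite_hasEigenvalue _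
    have h2 : groundEnergy H ≤ hherm.eigenvalues i + c := csInf_le hfin.bddBelow hev
    simp only [Pi.zero_apply]
    linarith
  have h3 := hpsd.dotProduct_mulVec_nonneg u
  rw [star_trivial, Matrix.sub_mulVec, Matrix.smul_mulVec, Matrix.one_mulVec, dotProduct_sub,
    dotProduct_smul, smul_eq_mul] at h3
  have h4 : u ⬝ᵥ u = ∑ x, u x ^ 2 := Finset.sum_congr rfl fun x _ => (sq (u x)).symm
  have h5 : u ⬝ᵥ (H *ᵥ u) = ∑ x, ∑ y, H x y * (u x * u y) := by
    refine Finset.sum_congr rfl fun x _ => ?_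
    rw [Matrix.mulVec, dotProduct, Finset.mul_sum]
    exact Finset.sum_congr rfl fun y _ => by ring
  rw [h4, h5] at h3
  linarith

theorem abs_entry_le_spectralNorm2 {ι : Type} [Fintype ι] [DecidableEq ι] (H : Matrix ι ι ℝ)
    (x y : ι) : |H x y| ≤ spectralNorm2 H := by
  have h1 := (Matrix.toEuclideanCLM (n := ι) (𝕜 := ℝ) H).le_opNorm (EuclideanSpace.single y 1)
  rw [PiLp.norm_single, norm_one, mul_one] at h1
  refine le_trans ?_ h1
  have h2 := PiLp.norm_apply_le (Matrix.toEuclideanCLM (n := ι) (𝕜 := ℝ) H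
    (EuclideanSpace.single y 1)) x
  have h3 : (Matrix.toEuclideanCLM (n := ι) (𝕜 := ℝ) H (EuclideanSpace.single y 1)) x = H x y := by
    have : (Matrix.toEuclideanCLM (n := ι) (𝕜 := ℝ) H (EuclideanSpace.single y 1)) x =
      (H *ᵥ Pi.single y 1) x := rfl
    rw [this, Matrix.mulVec_single_one]
    rfl
  rwa [h3] at h2

theorem mulVec_eq_zero_of_groundState {ι : Type} [Fintype ι] [DecidableEq ι] {H : Matrix ι ι ℝ}
    {φ : ι → ℝ} (h : IsGroundState H φ) (h0 : φ ⬝ᵥ (H *ᵥ φ) = 0) : H *ᵥ φ = 0 := by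
  rw [h.2, dotProduct_smul, smul_eq_mul, mul_eq_zero] at h0
  rw [h.2, h0.resolve_right fun h1 => h.1 (dotProduct_self_eq_zero.1 h1), zero_smul]

/-- A bound of this shape can be computed by `k` multiplications by `n + C`. -/
theorem exists_eval_le_pow (q : Polynomial ℕ) : ∃ C k : ℕ, ∀ n, q.eval n ≤ (n + C) ^ k := by
  induction q using Polynomial.induction_on' with
  | add q₁ q₂ h₁ h₂ =>
    obtain ⟨C₁, k₁, h₁⟩ := h₁
    obtain ⟨C₂, k₂, h₂⟩ := h₂
    refine ⟨C₁ + C₂ + 2, k₁ + k₂ + 1, fun n => ?_⟩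
    have h3 : (n + C₁) ^ k₁ ≤ (n + (C₁ + C₂ + 2)) ^ (k₁ + k₂) :=
      (Nat.pow_le_pow_left (by omega) _).trans (Nat.pow_le_pow_right (by omega) (by omega))
    have h4 : (n + C₂) ^ k₂ ≤ (n + (C₁ + C₂ + 2)) ^ (k₁ + k₂) :=
      (Nat.pow_le_pow_left (by omega) _).trans (Nat.pow_le_pow_right (by omega) (by omega))
    rw [Polynomial.eval_add, pow_succ]
    nlinarith [h₁ n, h₂ n, Nat.zero_le ((n + (C₁ + C₂ + 2)) ^ (k₁ + k₂))]
  | monomial k c =>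
    refine ⟨c, k + 1, fun n => ?_⟩
    rw [Polynomial.eval_monomial, pow_succ, mul_comm]
    exact Nat.mul_le_mul (Nat.pow_le_pow_left (by omega) _) (by omega)

/-! ## The parameters -/

namespace Program

variable {n : ℕ}

/-- Multiply register `7` by the `k`-th power of register `28`. -/
def power : ℕ → Program
  | 0 => skip
  | k + 1 => seq (power k) (mul 7 7 28)

/-- Compute the size parameter `(n + C) ^ k`. -/
def initSize (C k : ℕ) : Program :=
  seqs [const 4 1, const 39 C, add 28 39 0, const 7 1, power k]

/-- Compute the parameters that depend polynomially on the size, and the scale. -/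
def initScale : Program :=
  seqs [mul 5 7 7, mul 40 5 7, mul 9 40 40, sub 27 3 7, const 6 1, loop 5 (add 6 6 6)]

/-- Compute the other parameters, and walk. -/
def main : Program := seq (mul 37 6 6) (seq (mul 8 40 6) walk)

/-- The algorithm. -/
def algorithm (C k : ℕ) : Program := seq (initSize C k) (seq initScale main)

theorem coinFree_power (k : ℕ) : (power k).CoinFree := by
  induction k with
  | zero => trivial
  | succ k ih => exact ⟨ih, trivial⟩

theorem coinFree_initSize (C k : ℕ) : (initSize C k).CoinFree := by
  simp [initSize, seqs, CoinFree, coinFree_power]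

theorem coinFree_initScale : initScale.CoinFree := by
  simp [initScale, seqs, CoinFree]

theorem ev_power (O : Oracle n) (k : ℕ) (σ : ℕ → ℤ) :
    ev O (power k) σ = Function.update σ 7 (σ 7 * σ 28 ^ k) := by
  induction k with
  | zero => simp [power, ev]
  | succ k ih =>
    rw [power, ev, ih, ev]
    simp [pow_succ, mul_assoc]

theorem ev_loop_double (O : Oracle n) (a : ℕ) (σ : ℕ → ℤ) :
    ev O (loop a (add 6 6 6)) σ = Function.update σ 6 (σ 6 * 2 ^ (σ a).toNat) := by
  rw [ev]
  generalize (σ a).toNat = k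
  induction k with
  | zero => simp
  | succ k ih =>
    rw [Function.iterate_succ_apply', ih, ev]
    simp only [Function.update_self, Function.update_idem]
    congr 1; ring

/-- The size parameter. -/
def size (C k n : ℕ) : ℕ := (n + C) ^ k

theorem ev_initSize (O : Oracle n) (C k : ℕ) (x : Fin (2 ^ n)) :
    ev O (initSize C k) (Config.start n x).store 7 = size C k n ∧
    ev O (initSize C k) (Config.start n x).store 4 = 1 ∧
    ev O (initSize C k) (Config.start n x).store 1 = ((x : ℕ) : ℤ) ∧
    ev O (initSize C k) (Config.start n x).store 2 = 0 ∧
    ev O (initSize C k) (Config.start n x).store 3 = 0 ∧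
    ev O (initSize C k) (Config.start n x).store 24 = 0 := by
  simp [initSize, seqs, ev, ev_power, Config.start, size, add_comm]

theorem ev_initScale (O : Oracle n) {s : ℕ} {σ : ℕ → ℤ} (h7 : σ 7 = s) (h3 : σ 3 = 0) :
    ev O initScale σ 5 = s ^ 2 ∧ ev O initScale σ 6 = 2 ^ s ^ 2 ∧ ev O initScale σ 7 = s ∧
    ev O initScale σ 40 = s ^ 3 ∧ ev O initScale σ 9 = s ^ 6 ∧ ev O initScale σ 27 = -s := by
  have h5 : ((s : ℤ) * s).toNat = s ^ 2 := by
    rw [sq, ← Nat.cast_mul, Int.toNat_natCast]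
  have h : ev O initScale σ = ev O (loop 5 (add 6 6 6))
    (ev O (seqs [mul 5 7 7, mul 40 5 7, mul 9 40 40, sub 27 3 7, const 6 1]) σ) := rfl
  rw [h, ev_loop_double]
  simp [seqs, ev, h7, h3, h5]
  refine ⟨by ring, by ring, by ring⟩

/-- The registers before the first step of the walk. -/
theorem exists_run_init (O : Oracle n) (C k : ℕ) (x : Fin (2 ^ n)) :
    ∃ c₁ c₂, run O (initSize C k) (Config.start n x) = PMF.pure c₁ ∧
      run O initScale c₁ = PMF.pure c₂ ∧ c₁.store 7 = size C k n ∧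
      c₁.store 3 = 0 ∧ c₂.store 6 = 2 ^ size C k n ^ 2 ∧
      State (size C k n) ((x : ℕ) : ℤ) 0
        ((c₂.arith 37 6 6 fun u v => u * v).arith 8 40 6 fun u v => u * v).store := by
  obtain ⟨c₁, h₁, h₁'⟩ := (coinFree_initSize C k).run_eq O (Config.start n x)
  obtain ⟨c₂, h₂, h₂'⟩ := coinFree_initScale.run_eq O c₁
  obtain ⟨e7, e4, e1, e2, e3, e24⟩ := ev_initSize O C k x
  rw [← h₁'] at e7 e4 e1 e2 e3 e24
  obtain ⟨f5, f6, f7, f40, f9, f27⟩ := ev_initScale O e7 e3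
  have hf : ∀ r, r ∉ initScale.writes → c₂.store r = c₁.store r := fun r hr => by
    rw [h₂', ev_apply_of_notMem O hr]
  rw [← h₂'] at f5 f6 f7 f40 f9 f27
  refine ⟨c₁, c₂, h₁, h₂, e7, e3, f6, ?_⟩
  constructor <;> simp [Config.arith, Config.set, Config.pay, f5, f6, f7, f40, f9, f27,
    hf 1 (by decide), hf 2 (by decide), hf 3 (by decide), hf 4 (by decide), hf 24 (by decide),
    e1, e2, e3, e4, e24]

theorem run_algorithm {O : Oracle n} {C k : ℕ} {c c₁ c₂ : Config}
    (h₁ : run O (initSize C k) c = PMF.pure c₁) (h₂ : run O initScale c₁ = PMF.pure c₂) :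
    run O (algorithm C k) c = run O main c₂ := by
  rw [algorithm, run, h₁, PMF.pure_bind, run, h₂, PMF.pure_bind]

theorem run_main (O : Oracle n) (c : Config) : run O main c =
    run O walk ((c.arith 37 6 6 fun u v => u * v).arith 8 40 6 fun u v => u * v) := by
  simp only [main, run, PMF.pure_bind]

theorem acceptProb_algorithm (O : Oracle n) (C k : ℕ) (x : Fin (2 ^ n)) :
    acceptProb (algorithm C k) O x =
      ENNReal.ofReal (val O (size C k n) (size C k n ^ 6) ((x : ℕ) : ℤ) 0) := by
  obtain ⟨c₁, c₂, h₁, h₂, -, -, -, h⟩ := exists_run_init O C k x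
  rw [acceptProb, run_algorithm h₁ h₂, run_main, run_walk O h]

/-! ### The running time -/

/-- Bounds on the registers while the size is computed. -/
def sizeTyping (C n : ℕ) : Typing where
  β r := if r = 0 then n else if r = 1 then 2 ^ n else if r = 28 then n + C else
    if r = 39 then C else 1
  acc := {7}
  E := n + C
  g := n + C

/-- Bounds on the registers while the scale is computed. -/
def scaleTyping (s : ℕ) : Typing where
  β
    | 3 => 0
    | 5 => s ^ 2
    | 7 => s
    | 9 => s ^ 6
    | 27 => s
    | 40 => s ^ 3
    | _ => 2 ^ s
  acc := {6}
  E := s ^ 2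
  g := 1

/-- Bounds on the registers during the walk. -/
def walkTyping (s : ℕ) : Typing where
  β
    | 3 => 0
    | 5 => s ^ 2
    | 6 => 2 ^ s ^ 2
    | 7 => s
    | 8 => 2 ^ (8 * s ^ 2)
    | 9 => s ^ 6
    | 10 => 2 ^ (8 * s ^ 2)
    | 11 => 2 ^ (8 * s ^ 2)
    | 19 => 2 ^ (2 * s)
    | 20 => 2 ^ (3 * s)
    | 21 => 2 ^ (4 * s + s ^ 2)
    | 22 => 2 ^ (8 * s ^ 2)
    | 23 => 2 ^ (8 * s ^ 2)
    | 24 => 2 ^ (8 * s ^ 2)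
    | 25 => 2 ^ (8 * s ^ 2)
    | 27 => s
    | 30 => 2 ^ (4 * s)
    | 31 => 2 ^ (4 * s + s ^ 2)
    | 32 => 2 ^ (4 * s + s ^ 2)
    | 33 => 2 ^ (2 * s)
    | 34 => 2 ^ (2 * s)
    | 35 => 2 ^ (4 * s)
    | 36 => 2 ^ (4 * s + 2 * s ^ 2)
    | 37 => 2 ^ (2 * s ^ 2)
    | 38 => 2 ^ (s + 1)
    | 40 => s ^ 3
    | _ => 2 ^ s
  acc := {10, 11, 22, 23, 24}
  E := 8 * s ^ 2
  g := 1

theorem valid_sizeTyping {C : ℕ} (hC : 1 ≤ C) (n : ℕ) : (sizeTyping C n).Valid := by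
  have h1 : n + C < 2 ^ (n + C) := Nat.lt_two_pow_self
  refine ⟨fun r => ?_, by simp only [sizeTyping]; omega⟩
  simp only [sizeTyping]
  split_ifs
  · omega
  · exact Nat.pow_le_pow_right two_pos (by omega)
  · omega
  · omega
  · exact Nat.one_le_two_pow

theorem fits_sizeTyping {C : ℕ} (k n p : ℕ) : (sizeTyping C n).Fits n p (initSize C k) := by
  have hpow : (sizeTyping C n).Fits n p (power k) := by
    induction k with
    | zero => trivial
    | succ k ih =>
      refine ⟨ih, Or.inl ⟨by simp [sizeTyping], by simp [sizeTyping], ?_⟩⟩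
      have h1 : n + C < 2 ^ (n + C) := Nat.lt_two_pow_self
      simp only [sizeTyping]
      simpa using h1.le
  simp [initSize, seqs, Typing.Fits, hpow]
  simp [sizeTyping, add_comm]

theorem pow_six_le {s : ℕ} (hs : 64 ≤ s) : s ^ 6 ≤ 2 ^ s ^ 2 :=
  (Nat.pow_le_pow_right (by omega) (by norm_num)).trans (pow_le_two_pow_sq hs)

theorem valid_scaleTyping {s : ℕ} (hs : 64 ≤ s) : (scaleTyping s).Valid := by
  have h0 : 0 < s := by omega
  refine ⟨fun r => ?_, le_rfl⟩
  simp only [scaleTyping]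
  have h1 := pow_six_le hs
  split
  · exact Nat.zero_le _
  · exact (Nat.pow_le_pow_right h0 (by norm_num)).trans h1
  · exact (Nat.le_self_pow (by norm_num) s).trans h1
  · exact h1
  · exact (Nat.le_self_pow (by norm_num) s).trans h1
  · exact (Nat.pow_le_pow_right h0 (by norm_num)).trans h1
  · exact Nat.pow_le_pow_right two_pos (Nat.le_self_pow (by norm_num) s)

/-- Doubling makes register `6` an accumulator here, so products of it would not fit; they are left
to `main`, where its bound is static. Likewise register `7` grows in `initSize` but must be static
before it can bound a loop. Hence the three typings. -/
theorem fits_scaleTyping (s n p : ℕ) : (scaleTyping s).Fits n p initScale := by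
  have h2 := Nat.one_le_two_pow (n := s)
  simp [initScale, seqs, Typing.Fits]
  simp [scaleTyping]
  exact ⟨by ring_nf; exact le_rfl, by ring_nf; exact le_rfl, by ring_nf; exact le_rfl, h2⟩

theorem valid_walkTyping {s : ℕ} (hs : 64 ≤ s) : (walkTyping s).Valid := by
  have h0 : 0 < s := by omega
  have h2 : s ^ 2 = s * s := sq s
  have h3 : 64 * s ≤ s * s := Nat.mul_le_mul_right s hs
  have h1 : s ^ 6 ≤ 2 ^ (8 * s ^ 2) :=
    (pow_six_le hs).trans (Nat.pow_le_pow_right two_pos (by omega))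
  refine ⟨fun r => ?_, le_rfl⟩
  simp only [walkTyping]
  split
  all_goals first
    | exact Nat.zero_le _
    | exact Nat.pow_le_pow_right two_pos (by omega)
    | exact h1
    | exact (Nat.pow_le_pow_right h0 (by norm_num)).trans h1
    | exact (Nat.le_self_pow (by norm_num) s).trans h1

/-- Copying a register by adding register `3` is free because the bound of `3` is 0. -/
theorem fits_walkTyping {s n : ℕ} (hs : 64 ≤ s) (hn : n ≤ s) :
    (walkTyping s).Fits n s main := by
  have h2 : s ^ 2 = s * s := sq s
  have h3 : 64 * s ≤ s * s := Nat.mul_le_mul_right s hs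
  have h4 : s < 2 ^ s := Nat.lt_two_pow_self
  have h5 : s + s ≤ 2 ^ (s + 1) := by rw [pow_succ]; omega
  have h6 : s ^ 3 * 2 ^ s ^ 2 ≤ 2 ^ (8 * s ^ 2) := by
    calc s ^ 3 * 2 ^ s ^ 2 ≤ (2 ^ s) ^ 3 * 2 ^ s ^ 2 :=
          Nat.mul_le_mul_right _ (Nat.pow_le_pow_left h4.le 3)
      _ = 2 ^ (s * 3 + s ^ 2) := by rw [← pow_mul, ← pow_add]
      _ ≤ _ := Nat.pow_le_pow_right two_pos (by omega)
  simp [main, walk, verdict, Program.move, tally, choose, pick, weigh, seqs, Typing.Fits]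
  simp [walkTyping]
  simp only [← pow_add]
  refine ⟨?_, h6, ⟨?_, h5, ⟨?_, ?_, ?_, ?_, ?_, ?_, ?_⟩, Nat.one_le_two_pow, ?_,
    ⟨⟨?_, ?_, ?_, ?_, ?_, ?_, ?_⟩, ?_, ?_⟩, ?_, Nat.one_le_two_pow⟩, Nat.one_le_two_pow⟩
  all_goals exact Nat.pow_le_pow_right two_pos (by omega)

/-- A bound on the number of instructions of the walk. -/
theorem steps_main (s : ℕ) : (walkTyping s).steps main = 8 + s ^ 6 * (54 * s + 28) := by
  simp [main, walk, verdict, Program.move, tally, choose, pick, weigh, seqs, Typing.steps]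
  simp [walkTyping]
  ring

theorem steps_scale (s : ℕ) : (scaleTyping s).steps initScale = 7 + 2 * s ^ 2 := by
  simp [initScale, seqs, Typing.steps]
  simp [scaleTyping]
  ring

theorem steps_power (t : Typing) (k : ℕ) : t.steps (power k) = k + 1 := by
  induction k with
  | zero => rfl
  | succ k ih => rw [power, Typing.steps, ih]; rfl

theorem steps_size (C k n : ℕ) : (sizeTyping C n).steps (initSize C k) = k + 6 := by
  simp [initSize, seqs, Typing.steps, steps_power]
  ring

theorem inv_start (C : ℕ) (x : Fin (2 ^ n)) :
    (sizeTyping C n).Inv 0 (Config.start n x).store := by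
  intro r
  simp only [Config.start]
  split_ifs with h0 h1
  · subst h0; simp [Typing.lim, sizeTyping]
  · subst h1; simp [Typing.lim, sizeTyping, x.2.le]
  · simp

/-- The bounds are reset between phases: the one accumulator of the finished phase has a known exact
value. -/
theorem inv_scale {C s : ℕ} (hs : 64 ≤ s) (hC : n + C ≤ s) {τ : ℕ} {σ : ℕ → ℤ}
    (h : (sizeTyping C n).Inv τ σ) (h7 : σ 7 = s) (h3 : σ 3 = 0) : (scaleTyping s).Inv 0 σ := by
  intro r
  refine le_trans ?_ ((valid_scaleTyping hs).β_le_lim 0 r)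
  rcases eq_or_ne r 7 with rfl | hr7
  · simp [h7, scaleTyping]
  rcases eq_or_ne r 3 with rfl | hr3
  · simp [h3]
  refine (h.le_β (by simpa [sizeTyping] using hr7)).trans ?_
  have h4 : s < 2 ^ s := Nat.lt_two_pow_self
  simp only [sizeTyping]
  split_ifs with h0 h1 h28 h39
  · subst h0; simp only [scaleTyping]; omega
  · subst h1; exact Nat.pow_le_pow_right two_pos (by omega)
  · subst h28; simp only [scaleTyping]; omega
  · subst h39; simp only [scaleTyping]; omega
  · simp only [scaleTyping]
    split
    · exact (hr3 rfl).elim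
    · exact Nat.one_le_pow _ _ (by omega)
    · omega
    · exact Nat.one_le_pow _ _ (by omega)
    · omega
    · exact Nat.one_le_pow _ _ (by omega)
    · exact Nat.one_le_two_pow

theorem inv_walk {s : ℕ} (hs : 64 ≤ s) {τ : ℕ} {σ : ℕ → ℤ}
    (h : (scaleTyping s).Inv τ σ) (h6 : σ 6 = 2 ^ s ^ 2) : (walkTyping s).Inv 0 σ := by
  intro r
  refine le_trans ?_ ((valid_walkTyping hs).β_le_lim 0 r)
  rcases eq_or_ne r 6 with rfl | hr6
  · simp [h6, walkTyping, Int.natAbs_pow]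
  refine (h.le_β (by simpa [scaleTyping] using hr6)).trans ?_
  have h2 : s ^ 2 = s * s := sq s
  have h3 : 64 * s ≤ s * s := Nat.mul_le_mul_right s hs
  simp only [walkTyping]
  split
  all_goals simp only [scaleTyping]
  all_goals first
    | exact le_rfl
    | exact Nat.pow_le_pow_right two_pos (by omega)

/-- The running time of the algorithm for inputs of length `n`. -/
def timeBound (C k n s : ℕ) : ℕ :=
  (k + 6) * Typing.cost (n + C + (n + C) * (k + 6)) +
    (7 + 2 * s ^ 2) * Typing.cost (s ^ 2 + (7 + 2 * s ^ 2)) +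
    (8 + s ^ 6 * (54 * s + 28)) * Typing.cost (8 * s ^ 2 + (8 + s ^ 6 * (54 * s + 28)))

theorem runsWithin_algorithm {O : Oracle n} {C k s : ℕ} (hsize : s = size C k n) (hs : 64 ≤ s)
    (hC1 : 1 ≤ C) (hC : n + C ≤ s) (hO : Typing.Small O s) (x : Fin (2 ^ n)) :
    (algorithm C k).RunsWithin O x (timeBound C k n s)
      (k + 6 + (7 + 2 * s ^ 2) + (8 + s ^ 6 * (54 * s + 28))) := by
  intro c hc
  obtain ⟨c₁, c₂, h₁, h₂, e7, e3, e6, -⟩ := exists_run_init O C k x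
  rw [← hsize] at e7 e6
  rw [run_algorithm h₁ h₂] at hc
  obtain ⟨i₁, t₁, q₁⟩ := (valid_sizeTyping hC1 n).within hO (fits_sizeTyping (C := C) k n s)
    (τ := 0) le_rfl (inv_start C x) (c' := c₁) (by rw [h₁]; simp)
  obtain ⟨i₂, t₂, q₂⟩ := (valid_scaleTyping hs).within hO (fits_scaleTyping s n s)
    (τ := 0) le_rfl (inv_scale hs hC i₁ e7 e3) (c' := c₂) (by rw [h₂]; simp)
  obtain ⟨-, t₃, q₃⟩ := (valid_walkTyping hs).within hO (fits_walkTyping hs (by omega))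
    (τ := 0) le_rfl (inv_walk hs i₂ e6) hc
  simp only [zero_add, steps_size, steps_scale, steps_main] at t₁ q₁ t₂ q₂ t₃ q₃
  simp only [sizeTyping, scaleTyping, walkTyping, one_mul] at t₁ t₂ t₃
  have t₀ : (Config.start n x).time = 0 := rfl
  have q₀ : (Config.start n x).queries = 0 := rfl
  rw [timeBound]
  omega

end Program

/-! ### Assembling the theorem -/

theorem Oracle.Answers.small {n : ℕ} {O : Oracle n} {p : ℕ}
    {H : Matrix (Fin (2 ^ n)) (Fin (2 ^ n)) ℝ} {φ : Fin (2 ^ n) → ℝ} (hO : O.Answers p H φ)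
    {s : ℕ} (hs : p ≤ s) : Typing.Small O s := by
  have hfrac : ∀ {f : ℤ × ℤ} {r : ℝ}, IsFraction p f r →
      f.1.natAbs ≤ 2 ^ s ∧ f.2.natAbs ≤ 2 ^ s := by
    intro f r h
    have h0 : (2 : ℤ) ^ p ≤ 2 ^ s := pow_le_pow_right₀ one_le_two hs
    obtain ⟨h1, h2, h3, -⟩ := h
    constructor
    · zify; exact h1.trans h0
    · zify; rw [abs_of_pos h2]; exact h3.trans h0
  constructor
  · intro x y
    rw [Oracle.entryAt]
    split
    · exact hfrac (hO.entry_spec _ _)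
    · simp
  · intro x
    rw [Oracle.ampAt]
    split
    · rename_i i _
      rcases h : O.amp i with _ | f
      · simp
      · exact hfrac (hO.amp_some i f h)
    · simp

theorem mainTheorem4 (d b p g : Polynomial ℕ) :
    ∃ (A : Program) (T Q : Polynomial ℕ),
      ∀ (n : ℕ) (H : Matrix (Fin (2 ^ n)) (Fin (2 ^ n)) ℝ) (φ : Fin (2 ^ n) → ℝ) (O : Oracle n),
        H.IsSymm → IsSparse (d.eval n) H → spectralNorm2 H ≤ (b.eval n : ℕ) →
        O.Answers (p.eval n) H φ →
          (∀ x, A.RunsWithin O x (T.eval n) (Q.eval n)) ∧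
          (YesInstance (p.eval n) H φ → ∃ x, 1 / 2 ≤ A.acceptProb O x) ∧
          (NoInstance (g.eval n) H → ∀ x, A.acceptProb O x ≤ (1 / 2) ^ n) := by
  obtain ⟨C₀, k₀, hq⟩ := exists_eval_le_pow (d + b + p + g)
  -- This forces `s ≥ 64`, and the exponent `k₀ + 1 ≥ 1` gives `n + C ≤ s`; a single `s` then
  -- dominates all parameters.
  set C := C₀ + 64 with hC
  set k := k₀ + 1 with hk
  let S : Polynomial ℕ := (Polynomial.X + Polynomial.C C) ^ k
  let Y : Polynomial ℕ := Polynomial.X + Polynomial.C C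
  let M : Polynomial ℕ := 8 + S ^ 6 * (54 * S + 28)
  refine ⟨Program.algorithm C k,
    Polynomial.C (k + 6) * (4 * (Y + Y * Polynomial.C (k + 6)) + 5) ^ 2 +
      (7 + 2 * S ^ 2) * (4 * (S ^ 2 + (7 + 2 * S ^ 2)) + 5) ^ 2 +
      M * (4 * (8 * S ^ 2 + M) + 5) ^ 2,
    Polynomial.C (k + 6) + (7 + 2 * S ^ 2) + M, fun n H φ O hH hsp hb hO => ?_⟩
  set s := Program.size C k n with hs
  have hsS : S.eval n = s := by simp [S, hs, Program.size]
  have hY : Y.eval n = n + C := by simp [Y]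
  have hM : M.eval n = 8 + s ^ 6 * (54 * s + 28) := by simp [M, hsS]
  have hCs : n + C ≤ s := Nat.le_self_pow (by omega) _
  have hqs : d.eval n + b.eval n + p.eval n + g.eval n ≤ s := by
    have h1 := hq n
    simp only [Polynomial.eval_add] at h1
    refine h1.trans ((Nat.pow_le_pow_left (by omega) _).trans
      (Nat.pow_le_pow_right (by omega) (Nat.le_succ _)))
  have hs64 : 64 ≤ s := by omega
  have hrow : ∀ x, {y | H x y ≠ 0}.ncard ≤ s := fun x => (hsp.1 x).trans (by omega)
  have hp2 : (2 : ℝ) ^ p.eval n ≤ 2 ^ s := pow_le_pow_right₀ one_le_two (by omega)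
  refine ⟨fun x => ?_, fun hyes => ?_, fun hno x => ?_⟩
  · have h := Program.runsWithin_algorithm hs hs64 (by omega) hCs (hO.small (by omega)) x
    intro c hc
    obtain ⟨h1, h2⟩ := h c hc
    refine ⟨h1.trans_eq ?_, h2.trans_eq ?_⟩
    · simp [hsS, hY, hM, Program.timeBound, Typing.cost]
    · simp [hsS, hM]
  · obtain ⟨hgs, h0, hrep⟩ := hyes
    have hψ : O.reported = φ := funext fun i => hO.reported_eq (hrep i)
    -- Here the entries need the polynomial bound from the spectral norm; the other case makes do
    -- with `2 ^ s` from the bit length.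
    obtain ⟨x, hx⟩ := exists_half_le_survive (P := 2 ^ s ^ 2) hH hs64 hrow
      (fun x y => (abs_entry_le_spectralNorm2 H x y).trans
        (hb.trans (by exact_mod_cast (by omega : b.eval n ≤ s))))
      (mulVec_eq_zero_of_groundState hgs h0) hgs.1 rfl
    refine ⟨x, ?_⟩
    rw [← hψ, ← Program.val_eq_survive hO hrow] at hx
    rw [Program.acceptProb_algorithm, ← hs]
    refine le_trans ?_ (ENNReal.ofReal_le_ofReal hx)
    rw [ENNReal.ofReal_div_of_pos two_pos]
    simp
  · obtain ⟨hg, hge⟩ := hno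
    have hle : 1 / (s : ℝ) ≤ groundEnergy H := by
      refine le_trans ?_ hge
      exact one_div_le_one_div_of_le (by exact_mod_cast hg)
        (by exact_mod_cast (by omega : g.eval n ≤ s))
    -- Nothing about `φ` is needed: whatever amplitudes are reported serve as the guiding vector.
    have h := fixedNode_survive_le (ψ := O.reported) (P := 2 ^ s ^ 2) hH hs64
      (groundEnergy_mul_le hH hle) hrow
      (by rw [Fintype.card_fin]; exact Nat.pow_le_pow_right two_pos (by omega))
      (fun x y => (hO.abs_entry_le x y).trans hp2) (fun x => (hO.abs_reported_le x).trans hp2)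
      (fun x hx => (hO.one_le_abs_reported_mul hx).trans
        (mul_le_mul_of_nonneg_left hp2 (abs_nonneg _))) rfl x
    rw [← Program.val_eq_survive hO hrow] at h
    rw [Program.acceptProb_algorithm, ← hs]
    have h2 : (1 / 2 : ℝ) ^ s ≤ (1 / 2) ^ n :=
      pow_le_pow_of_le_one (by norm_num) (by norm_num) (by omega)
    refine (ENNReal.ofReal_le_ofReal (h.trans h2)).trans_eq ?_
    rw [ENNReal.ofReal_pow (by norm_num), ENNReal.ofReal_div_of_pos two_pos]
    simp
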